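/- Write $\mathbb R_+=[0,\infty)$ and $\check x=\max(1,x)$. For $r\ge 0$ let $Y_{0,r}$ be the space of $c\in L^1(\mathbb R_+)$ with $\|c\|_{0,r}=\int_0^\infty(1+x^r)|c(x)|\,dx<\infty$, let $Y_{0,r}^+$ be its cone of almost everywhere nonnegative elements, and let $M_p(c)=\int_0^\infty x^p c(x)\,dx$. Let $K:\mathbb R_+^3\to[0,\infty)$ be measurable with $K(x,y,z)=K(y,x,z)$, and $K(x,y,z)=0$ whenever $z>x$. Put $\kappa[c](x,y,z)=K(x,y,z)c(x)c(y)$ and $(\Delta_zf)(x)=f(x+z)-2f(x)+f(x-z)$. For $T\in(0,\infty]$ and $c_0\in Y_{0,2}^+$, a weak solution in $Y_{0,2}^+$ on $[0,T)$ with initial datum $c_0$ of the continuous generalized exchange-driven growth equation with kernel $K$ is a map $c:[0,T)\to Y_{0,2}^+$ such that (a) $t\mapsto\int_0^\infty f(x)c_t(x)\,dx$ is continuous on $[0,T)$ for every $f\in L^\infty(\mathbb R_+)$, and $\sup_{t\in[0,T)}\|c_t\|_{0,2}<\infty$; (b) $\int_0^t\int_0^\infty\int_z^\infty\int_0^\infty\kappa[c_s](x,y,z)\,dy\,dx\,dz\,ds<\infty$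 for all $t\in[0,T)$; (c) for all $t\in[0,T)$ and all $f\in L^\infty(\mathbb R_+)$, $$\int_0^\infty f(x)\,[c_t(x)-c_0(x)]\,dx=\int_0^t\iiint_{\{x\ge z,\ y\ge z,\ z\ge 0\}}(\Delta_zf)(x)\,\kappa[c_s](x,y,z)\,dx\,dy\,dz\,ds .$$ Theorem. Let $\varphi\in Y_{0,2}^+$ and assume that $K(x,y,z)\le\check x^2\,\check y^2\,\varphi(z)$ for all $x,y,z\ge 0$, and that for all $y,z\ge0$ the function $x\mapsto K(x,y,z)$ is twice differentiable on $(z,\infty)$ with $\partial_x^2K(x,y,z)\le\check y^2\,\varphi(z)$ there. Let $c_0\in Y_{0,2}^+$ be not almost everywhere zero, and let $$T_0=\bigl(2\,\|\varphi\|_{0,2}\,(M_0(c_0)+M_2(c_0))\bigr)^{-1}\in(0,\infty]$$ ($T_0=\infty$ if $\varphi=0$ almost everywhere). Then there is a weak solution $c$ in $Y_{0,2}^+$ on $[0,T_0)$ with initial datum $c_0$ such that $M_0(c_t)=M_0(c_0)$ and $M_1(c_t)=M_1(c_0)$ for all $t\in[0,T_0)$. -/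

import Mathlib

open MeasureTheory Set
open scoped ENNReal NNReal

noncomputable section

namespace CGEDG

/-- Lebesgue measure on `ℝ₊ = [0, ∞)`. Functions on `ℝ₊` are modelled by functions `ℝ → ℝ` whose
values on `(-∞, 0)` are never used. -/
def halfLine : Measure ℝ := volume.restrict (Ici 0)

/-- The weight `x^{-β} + x^r` of the space `Y_{-β,r}`. -/
def weight (β r : ℝ) (x : ℝ) : ℝ := x ^ (-β) + x ^ r

/-- `c ∈ Y_{-β,r}`: `c ∈ L¹(ℝ₊)` and `∫ (x^{-β} + x^r) |c(x)| dx < ∞`. -/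
def MemY (β r : ℝ) (c : ℝ → ℝ) : Prop :=
  Integrable c halfLine ∧ Integrable (fun x => weight β r x * |c x|) halfLine

/-- `c ∈ Y_{-β,r}⁺`, the positive cone. -/
def MemYPos (β r : ℝ) (c : ℝ → ℝ) : Prop :=
  MemY β r c ∧ ∀ᵐ x ∂halfLine, 0 ≤ c x

/-- The norm `‖c‖_{-β,r} = ∫ (x^{-β} + x^r) |c(x)| dx`. -/
def normY (β r : ℝ) (c : ℝ → ℝ) : ℝ := ∫ x, weight β r x * |c x| ∂halfLine

/-- The moment `M_p(c) = ∫ x^p c(x) dx`. -/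
def moment (p : ℝ) (c : ℝ → ℝ) : ℝ := ∫ x, x ^ p * c x ∂halfLine

/-- The time interval `[0, T)` with `T ∈ [0, ∞]`. -/
def timeInterval (T : ℝ≥0∞) : Set ℝ := {t | 0 ≤ t ∧ ENNReal.ofReal t < T}

/-- Weak continuity of `t ↦ c_t` on `[0, T)` in `Y_{-β,r}`: for every `f ∈ L^∞(ℝ₊)` the map
`t ↦ ∫ (x^{-β} + x^r) f(x) c_t(x) dx` is continuous. -/
def WeaklyContinuous (β r : ℝ) (T : ℝ≥0∞) (c : ℝ → ℝ → ℝ) : Prop :=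
  ∀ f : ℝ → ℝ, MemLp f ∞ halfLine →
    ContinuousOn (fun t => ∫ x, weight β r x * f x * c t x ∂halfLine) (timeInterval T)

/-- The discrete Laplacian `(Δ_z f)(x) = f(x+z) - 2 f(x) + f(x-z)`. -/
def discreteLaplacian (z : ℝ) (f : ℝ → ℝ) (x : ℝ) : ℝ := f (x + z) - 2 * f x + f (x - z)

/-- `κ[c](x,y,z) = K(x,y,z) c(x) c(y)`. -/
def rate (K : ℝ → ℝ → ℝ → ℝ) (c : ℝ → ℝ) (x y z : ℝ) : ℝ := K x y z * c x * c y

/-- The domain `{(x,y,z) ∈ ℝ₊³ : x ≥ z, y ≥ z}`. -/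
def domain : Set (ℝ × ℝ × ℝ) := {p | 0 ≤ p.2.2 ∧ p.2.2 ≤ p.1 ∧ p.2.2 ≤ p.2.1}

/-- `∭_{x ≥ z, y ≥ z} (Δ_z f)(x) κ[c](x,y,z) dz dx dy`. -/
def weakForm (K : ℝ → ℝ → ℝ → ℝ) (f c : ℝ → ℝ) : ℝ :=
  ∫ p in domain, discreteLaplacian p.2.2 f p.1 * rate K c p.1 p.2.1 p.2.2

/-- The standing assumptions on a kernel: measurable and nonnegative on `ℝ₊³`, symmetric in the
first two variables, and zero when the exchanged mass `z` exceeds the donor mass `x`. -/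
structure IsKernel (K : ℝ → ℝ → ℝ → ℝ) : Prop where
  measurable : Measurable fun p : ℝ≥0 × ℝ≥0 × ℝ≥0 => K p.1 p.2.1 p.2.2
  nonneg : ∀ x y z, 0 ≤ x → 0 ≤ y → 0 ≤ z → 0 ≤ K x y z
  symm : ∀ x y z, 0 ≤ x → 0 ≤ y → 0 ≤ z → K x y z = K y x z
  eq_zero : ∀ x y z, 0 ≤ x → 0 ≤ y → x < z → K x y z = 0

/-- The growth bound `K(x,y,z) ≤ (1 ∨ x)² (1 ∨ y)² φ(z)` on `ℝ₊³`. -/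
def QuadraticGrowth (K : ℝ → ℝ → ℝ → ℝ) (φ : ℝ → ℝ) : Prop :=
  ∀ x y z, 0 ≤ x → 0 ≤ y → 0 ≤ z → K x y z ≤ (max 1 x) ^ 2 * (max 1 y) ^ 2 * φ z

/-- The bound `∂₁² K(·,y,z)(x) ≤ (1 ∨ y)² φ(z)`. Since `K(·,y,z)` is cut off to zero on `[0, z)`,
where the bound is trivial, (twice) differentiability and the bound are only asked for at `x > z`;
a jump of `K(·,y,z)` at `x = z` is allowed. -/
def SecondDerivBound (K : ℝ → ℝ → ℝ → ℝ) (φ : ℝ → ℝ) : Prop :=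
  ∀ y z, 0 ≤ y → 0 ≤ z → ∀ x, z < x →
    DifferentiableAt ℝ (fun x' => K x' y z) x ∧
    DifferentiableAt ℝ (deriv fun x' => K x' y z) x ∧
    deriv (deriv fun x' => K x' y z) x ≤ (max 1 y) ^ 2 * φ z

/-- `c : [0,T) → Y_{-β,r}⁺` is a weak solution with initial datum `c₀`. -/
structure IsWeakSolution (K : ℝ → ℝ → ℝ → ℝ) (β r : ℝ) (T : ℝ≥0∞) (c₀ : ℝ → ℝ)
    (c : ℝ → ℝ → ℝ) : Prop where
  mem : ∀ t ∈ timeInterval T, MemYPos β r (c t)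
  initial : c 0 =ᵐ[halfLine] c₀
  /-- `c ∈ C([0,T), Y_0)` -/
  continuous : WeaklyContinuous 0 0 T c
  /-- `c ∈ L^∞([0,T), Y_{-β,r})` -/
  bounded : ∃ C : ℝ, ∀ t ∈ timeInterval T, normY β r (c t) ≤ C
  /-- `∫₀ᵗ ds ∫₀^∞ dz ∫_z^∞ dx ∫₀^∞ dy κ[c_s](x,y,z) < ∞` -/
  finite_rate : ∀ t ∈ timeInterval T,
    ∫⁻ s in Icc 0 t, ∫⁻ z in Ici (0 : ℝ), ∫⁻ x in Ici z, ∫⁻ y in Ici (0 : ℝ),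
      ENNReal.ofReal (rate K (c s) x y z) < ∞
  /-- The weak equation, for all `f ∈ L^∞(ℝ₊)`, with a convergent time integral. -/
  weak_eq : ∀ t ∈ timeInterval T, ∀ f : ℝ → ℝ, MemLp f ∞ halfLine →
    IntervalIntegrable (fun s => weakForm K f (c s)) volume 0 t ∧
    ∫ x, f x * (c t x - c₀ x) ∂halfLine = ∫ s in (0 : ℝ)..t, weakForm K f (c s)

/-- `T₀ = (2 ‖φ‖_{0,2} (M₀(c₀) + M₂(c₀)))⁻¹ ∈ (0, ∞]`, which is `∞` if `φ = 0` almost everywhere. -/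
def existenceTime (φ c₀ : ℝ → ℝ) : ℝ≥0∞ :=
  (ENNReal.ofReal (2 * normY 0 2 φ * (moment 0 c₀ + moment 2 c₀)))⁻¹

end CGEDG

end

/-!
The solution is a limit of explicit Euler schemes. An Euler step for the measure `μ = c dx` is one
step of a linear jump process: with the rates `a(x, z) = ∫ K(x, y, z) dμ(y)`, the fraction `h a(x,
z)` of the mass at `x` is moved to `x + z` and the same fraction to `x - z` (`eulerStep`). As the
kernel is not bounded in `x`, it is first truncated to `min (K, λ (1 + y²) φ(z))`, where `λ` grows
with the number of steps in such a way that all steps remain positive. Total mass and first moment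
are conserved exactly. The second difference of `x²` is `2 z²`, so that `u = ∫ (1 + x²) dμ` grows
at most as the solution of `u' = 2 (∫ z² φ) u²`; since `∫ z² φ < ‖φ‖`, this solution stays bounded
up to and including the existence time.

Two further estimates make the schemes uniformly dominated, even after multiplication by `1 + x²`.
The bound on the second derivative, and the growth bound near the jump at `x = z`, show that the
second differences of `x ↦ K(x, y, z)` are at most a multiple of `(1 + z²) (1 + y²) φ(z)`
(`kernel_semiconcave`), and the truncation preserves this. By duality the step sends Lebesgue
measure to at most `1 + h C` times Lebesgue measure, so the part of the solution that starts from a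
bounded density keeps a bounded density, while the rest has small mass: concentration is excluded.
The functions `min (v² / m, v)` with `v = 1 + x²` (`tailWeight`) satisfy a Gronwall inequality
uniformly in `m`, which excludes a loss of second moment at infinity.

By uniform domination the weighted measures `(1 + x²) c_t dx` of the schemes converge setwise along
an ultrafilter, at all times simultaneously, to absolutely continuous measures, and so do their
products (`UniformlyDominated`). Fluxes are integrals of bounded functions against such products
(`flux`), hence they pass to the limit. The schemes are equicontinuous in total variation, so the
limit fluxes are continuous in time, and `∫ f c_t` has the limit flux as its right derivative,
which is the weak equation (`EulerProblem.weak_equation_limit`). The conserved quantities `∫ c` and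
`∫ x c` are integrals of bounded functions against the weighted measures and pass to the limit as
well. If `φ` vanishes almost everywhere, the datum is a stationary solution.
-/

noncomputable section

namespace CGEDG

open Filter Topology

/-! ### Setwise convergence of measures along an ultrafilter -/

lemma exists_tendsto_ultrafilter {ι : Type*} (U : Ultrafilter ι) (a : ι → ℝ≥0∞) :
    ∃ b, Tendsto a U (𝓝 b) := by
  obtain ⟨b, -, hb⟩ := isCompact_univ.ultrafilter_le_nhds (U.map a) (by simp)
  exact ⟨b, hb⟩

/-- A family of measures is uniformly dominated if, up to an arbitrarily small error, all its
members lie below one and the same finite measure. This is a form of uniform countable additivity;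
for densities with respect to a fixed measure it expresses uniform integrability. -/
def UniformlyDominated {X ι : Type*} [MeasurableSpace X] (μ : ι → Measure X) : Prop :=
  ∀ ε : ℝ≥0∞, ε ≠ 0 → ∃ ρ : Measure X, IsFiniteMeasure ρ ∧
    ∀ i E, MeasurableSet E → μ i E ≤ ρ E + ε

section Setwise

variable {X Y ι : Type*} [MeasurableSpace X] [MeasurableSpace Y] {U : Ultrafilter ι}
  {μ : ι → Measure X} {ν : Measure X}

/-- Uniform domination is what makes limits of measures on disjoint sets countably additive. -/
lemma UniformlyDominated.tendsto_iUnion (hμ : UniformlyDominated μ) {E : ℕ → Set X}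
    (hE : ∀ n, MeasurableSet (E n)) (hd : Pairwise (Function.onFun Disjoint E)) {m : ℕ → ℝ≥0∞}
    (hm : ∀ n, Tendsto (fun i => μ i (E n)) U (𝓝 (m n))) :
    Tendsto (fun i => μ i (⋃ n, E n)) U (𝓝 (∑' n, m n)) := by
  obtain ⟨L, hL⟩ := exists_tendsto_ultrafilter U (fun i => μ i (⋃ n, E n))
  suffices L = ∑' n, m n by rwa [← this]
  have hfin : ∀ n, Tendsto (fun i => ∑ l ∈ Finset.range n, μ i (E l)) U
      (𝓝 (∑ l ∈ Finset.range n, m l)) := fun n => tendsto_finsetSum _ fun l _ => hm l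
  apply le_antisymm
  · refine ENNReal.le_of_forall_pos_le_add fun ε hε _ => ?_
    obtain ⟨ρ, hρ, hρE⟩ := hμ ε (by simpa using hε.ne')
    have htail := tendsto_measure_biUnion_Ici_zero_of_pairwise_disjoint (μ := ρ)
      (fun n => (hE n).nullMeasurableSet) hd
    have hn : ∀ n, L ≤ ∑' l, m l + (ρ (⋃ l ≥ n, E l) + ε) := by
      intro n
      refine le_trans (le_of_tendsto_of_tendsto hL ((hfin n).add_const _)
        (Eventually.of_forall fun i => ?_)) (add_le_add_left (ENNReal.sum_le_tsum _) _)
      have hsub : (⋃ l, E l) ⊆ (⋃ l ∈ Finset.range n, E l) ∪ ⋃ l ≥ n, E l := by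
        intro x hx
        obtain ⟨l, hl⟩ := mem_iUnion.1 hx
        rcases lt_or_ge l n with h | h
        · exact Or.inl (mem_biUnion (by simpa using h) hl)
        · exact Or.inr (mem_biUnion h hl)
      calc μ i (⋃ l, E l) ≤ μ i (⋃ l ∈ Finset.range n, E l) + μ i (⋃ l ≥ n, E l) :=
            (measure_mono hsub).trans (measure_union_le _ _)
        _ ≤ _ := add_le_add (measure_biUnion_finset_le _ _)
            (hρE i _ (MeasurableSet.biUnion (to_countable _) fun l _ => hE l))
    have hlim : Tendsto (fun n => ∑' l, m l + (ρ (⋃ l ≥ n, E l) + ε)) atTop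
        (𝓝 (∑' l, m l + (0 + ε))) := (htail.add_const _).const_add _
    simpa using ge_of_tendsto' hlim hn
  · rw [ENNReal.tsum_eq_iSup_nat]
    refine iSup_le fun n => le_of_tendsto_of_tendsto (hfin n) hL (Eventually.of_forall fun i => ?_)
    beta_reduce
    rw [← measure_biUnion_finset (fun a _ b _ hab => hd hab) fun l _ => hE l]
    exact measure_mono (iUnion₂_subset_iUnion _ _)

/-- A uniformly dominated family of measures converges setwise along every ultrafilter. -/
lemma UniformlyDominated.exists_tendsto (hμ : UniformlyDominated μ) (U : Ultrafilter ι) :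
    ∃ ν : Measure X, ∀ E, MeasurableSet E → Tendsto (fun i => μ i E) U (𝓝 (ν E)) := by
  choose m hm using fun E : Set X => exists_tendsto_ultrafilter U (fun i => μ i E)
  refine ⟨Measure.ofMeasurable (fun E _ => m E) ?_ ?_, fun E hE => ?_⟩
  · exact tendsto_nhds_unique (hm ∅) (by simp)
  · intro E hE hd
    exact tendsto_nhds_unique (hm _) (hμ.tendsto_iUnion hE hd fun n => hm _)
  · rw [Measure.ofMeasurable_apply E hE]
    exact hm E

lemma lintegral_le_of_tendsto_setwise
    (hν : ∀ E, MeasurableSet E → Tendsto (fun i => μ i E) U (𝓝 (ν E)))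
    {g : X → ℝ≥0∞} {L : ℝ≥0∞} (hL : Tendsto (fun i => ∫⁻ x, g x ∂μ i) U (𝓝 L)) :
    ∫⁻ x, g x ∂ν ≤ L := by
  rw [lintegral_eq_nnreal]
  refine iSup₂_le fun s hs => ?_
  have h1 : Tendsto (fun i => (s.map ((↑) : ℝ≥0 → ℝ≥0∞)).lintegral (μ i)) U
      (𝓝 ((s.map ((↑) : ℝ≥0 → ℝ≥0∞)).lintegral ν)) := by
    simp only [SimpleFunc.map_lintegral]
    exact tendsto_finsetSum _ fun c _ => ENNReal.Tendsto.const_mul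
      (hν _ (s.measurableSet_preimage _)) (Or.inr ENNReal.coe_ne_top)
  refine le_of_tendsto_of_tendsto h1 hL (Eventually.of_forall fun i => ?_)
  beta_reduce
  rw [lintegral_eq_nnreal]
  exact le_iSup₂_of_le s hs le_rfl

/-- Setwise convergence integrates against all bounded measurable functions `g`: lower
semicontinuity applies both to `g` and to `b - g`, and their sum passes to the limit. -/
lemma tendsto_lintegral_of_tendsto_setwise [IsFiniteMeasure ν]
    (hν : ∀ E, MeasurableSet E → Tendsto (fun i => μ i E) U (𝓝 (ν E)))
    {g : X → ℝ≥0∞} (hg : Measurable g) {b : ℝ≥0∞} (hb : b ≠ ∞) (hgb : ∀ x, g x ≤ b) :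
    Tendsto (fun i => ∫⁻ x, g x ∂μ i) U (𝓝 (∫⁻ x, g x ∂ν)) := by
  obtain ⟨L, hL⟩ := exists_tendsto_ultrafilter U (fun i => ∫⁻ x, g x ∂μ i)
  obtain ⟨L', hL'⟩ := exists_tendsto_ultrafilter U (fun i => ∫⁻ x, (b - g x) ∂μ i)
  have key : ∀ μ' : Measure X, ∫⁻ x, g x ∂μ' + ∫⁻ x, (b - g x) ∂μ' = b * μ' univ := by
    intro μ'
    rw [← lintegral_add_left hg]
    simp_rw [add_tsub_cancel_of_le (hgb _)]
    simp
  have hsum : L + L' = b * ν univ := by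
    refine tendsto_nhds_unique (hL.add hL') ?_
    simp_rw [key]
    exact ENNReal.Tendsto.const_mul (hν _ MeasurableSet.univ) (Or.inr hb)
  have h1 := lintegral_le_of_tendsto_setwise hν hL
  have h2 := lintegral_le_of_tendsto_setwise hν hL'
  suffices L = ∫⁻ x, g x ∂ν by rwa [← this]
  have hfin : ∫⁻ x, (b - g x) ∂ν ≠ ∞ := by
    refine ne_top_of_le_ne_top (ENNReal.mul_ne_top hb (measure_ne_top ν univ)) ?_
    rw [← key ν]
    exact le_add_self
  refine le_antisymm ((ENNReal.add_le_add_iff_right hfin).1 ?_) h1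
  rw [key ν, ← hsum]
  gcongr

/-- The first factor is replaced by a dominating measure `ρ`; the accuracy with which the second factor
is then dominated may depend on the mass of `ρ`. -/
lemma UniformlyDominated.prod [∀ i, IsFiniteMeasure (μ i)] (hμ : UniformlyDominated μ)
    {C : ℝ≥0∞} (hC : C ≠ ∞) (hμC : ∀ i, μ i univ ≤ C) :
    UniformlyDominated fun i => (μ i).prod (μ i) := by
  intro ε hε
  have hpos : ∀ {D : ℝ≥0∞}, D ≠ ∞ → (ε / 2) / (D + 1) ≠ 0 := fun hD =>
    ENNReal.div_ne_zero.2 ⟨(ENNReal.half_pos hε).ne', ENNReal.add_ne_top.2 ⟨hD, by simp⟩⟩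
  have hle : ∀ D : ℝ≥0∞, (ε / 2) / (D + 1) * D ≤ ε / 2 := fun D =>
    (mul_le_mul_right (le_self_add (a := D) (b := 1)) _).trans (ENNReal.mul_le_of_le_div le_rfl)
  obtain ⟨ρ, hρ, hρE⟩ := hμ _ (hpos hC)
  obtain ⟨ρ', hρ', hρE'⟩ := hμ _ (hpos (measure_ne_top ρ univ))
  refine ⟨ρ.prod ρ', inferInstance, fun i E hE => ?_⟩
  calc (μ i).prod (μ i) E = ∫⁻ y, μ i ((fun x => (x, y)) ⁻¹' E) ∂μ i := Measure.prod_apply_symm hE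
    _ ≤ ∫⁻ y, (ρ ((fun x => (x, y)) ⁻¹' E) + (ε / 2) / (C + 1)) ∂μ i :=
        lintegral_mono fun y => hρE i _ (measurable_prodMk_right hE)
    _ = ρ.prod (μ i) E + (ε / 2) / (C + 1) * μ i univ := by
        rw [lintegral_add_right _ measurable_const, Measure.prod_apply_symm hE, lintegral_const]
    _ ≤ ρ.prod (μ i) E + ε / 2 := by
        gcongr
        exact (mul_le_mul_right (hμC i) _).trans (hle C)
    _ = ∫⁻ x, μ i (Prod.mk x ⁻¹' E) ∂ρ + ε / 2 := by rw [Measure.prod_apply hE]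
    _ ≤ ∫⁻ x, (ρ' (Prod.mk x ⁻¹' E) + (ε / 2) / (ρ univ + 1)) ∂ρ + ε / 2 := by
        gcongr with x
        exact hρE' i _ (measurable_prodMk_left hE)
    _ = ρ.prod ρ' E + (ε / 2) / (ρ univ + 1) * ρ univ + ε / 2 := by
        rw [lintegral_add_right _ measurable_const, Measure.prod_apply hE, lintegral_const]
    _ ≤ ρ.prod ρ' E + ε / 2 + ε / 2 := by
        gcongr
        exact hle _
    _ = ρ.prod ρ' E + ε := by rw [add_assoc, ENNReal.add_halves]

/-- Setwise convergence of a uniformly dominated family passes to the product measures. The sets on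
which the products converge form a `λ`-system containing all rectangles. -/
lemma UniformlyDominated.tendsto_prod [∀ i, IsFiniteMeasure (μ i)] [IsFiniteMeasure ν]
    (hμ : UniformlyDominated μ) {C : ℝ≥0∞} (hC : C ≠ ∞) (hμC : ∀ i, μ i univ ≤ C)
    (hν : ∀ E, MeasurableSet E → Tendsto (fun i => μ i E) U (𝓝 (ν E)))
    (E : Set (X × X)) (hE : MeasurableSet E) :
    Tendsto (fun i => (μ i).prod (μ i) E) U (𝓝 (ν.prod ν E)) := by
  have hrect : ∀ s t : Set X, MeasurableSet s → MeasurableSet t →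
      Tendsto (fun i => (μ i).prod (μ i) (s ×ˢ t)) U (𝓝 (ν.prod ν (s ×ˢ t))) := by
    intro s t hs ht
    simp_rw [Measure.prod_prod]
    exact ENNReal.Tendsto.mul (hν s hs) (Or.inr (measure_ne_top _ _)) (hν t ht)
      (Or.inr (measure_ne_top _ _))
  induction E, hE using MeasurableSpace.induction_on_inter generateFrom_prod.symm
    isPiSystem_prod with
  | empty => simp
  | basic E hE =>
    obtain ⟨s, hs, t, ht, rfl⟩ := hE
    exact hrect s t hs ht
  | compl E hE ih =>
    simp_rw [measure_compl hE (measure_ne_top _ _)]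
    refine ENNReal.Tendsto.sub ?_ ih (Or.inl (measure_ne_top _ _))
    simpa using hrect univ univ MeasurableSet.univ MeasurableSet.univ
  | iUnion E hd hE ih =>
    rw [measure_iUnion hd hE]
    exact (hμ.prod hC hμC).tendsto_iUnion hE hd ih

end Setwise

/-- `WithinTV δ μ μ'`: integrating a function with values in `[0, b]` against `μ` exceeds its
integral against `μ'` by at most `b δ`; a one-sided bound on the total variation of `μ - μ'`. -/
def WithinTV {X : Type*} [MeasurableSpace X] (δ : ℝ≥0∞) (μ μ' : Measure X) : Prop :=
  ∀ (b : ℝ≥0∞) (g : X → ℝ≥0∞), Measurable g → (∀ x, g x ≤ b) →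
    ∫⁻ x, g x ∂μ ≤ ∫⁻ x, g x ∂μ' + b * δ

lemma WithinTV.trans {X : Type*} [MeasurableSpace X] {δ δ' : ℝ≥0∞} {μ₁ μ₂ μ₃ : Measure X}
    (h : WithinTV δ μ₁ μ₂) (h' : WithinTV δ' μ₂ μ₃) : WithinTV (δ + δ') μ₁ μ₃ := by
  intro b g hg hgb
  calc ∫⁻ x, g x ∂μ₁ ≤ ∫⁻ x, g x ∂μ₂ + b * δ := h b g hg hgb
    _ ≤ ∫⁻ x, g x ∂μ₃ + b * δ' + b * δ := by gcongr; exact h' b g hg hgb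
    _ = _ := by ring

lemma WithinTV.mono {X : Type*} [MeasurableSpace X] {δ δ' : ℝ≥0∞} {μ₁ μ₂ : Measure X}
    (h : WithinTV δ μ₁ μ₂) (hδ : δ ≤ δ') : WithinTV δ' μ₁ μ₂ := fun b g hg hgb =>
  (h b g hg hgb).trans (by gcongr)

lemma WithinTV.prod {X : Type*} [MeasurableSpace X] {δ C : ℝ≥0∞} {μ μ' : Measure X} [SFinite μ]
    [SFinite μ'] (h : WithinTV δ μ μ') (hμ : μ univ ≤ C) (hμ' : μ' univ ≤ C) :
    WithinTV (2 * C * δ) (μ.prod μ) (μ'.prod μ') := by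
  intro b g hg hgb
  have hswap : ∫⁻ x, ∫⁻ y, g (x, y) ∂μ' ∂μ = ∫⁻ y, ∫⁻ x, g (x, y) ∂μ ∂μ' :=
    lintegral_lintegral_swap hg.aemeasurable
  rw [lintegral_prod _ hg.aemeasurable, lintegral_prod_symm _ hg.aemeasurable]
  calc ∫⁻ x, ∫⁻ y, g (x, y) ∂μ ∂μ ≤ ∫⁻ x, (∫⁻ y, g (x, y) ∂μ' + b * δ) ∂μ :=
        lintegral_mono fun x => h b _ (hg.comp measurable_prodMk_left) fun _ => hgb _
    _ = ∫⁻ y, ∫⁻ x, g (x, y) ∂μ ∂μ' + b * δ * μ univ := by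
        rw [lintegral_add_right _ measurable_const, lintegral_const, hswap]
    _ ≤ ∫⁻ y, (∫⁻ x, g (x, y) ∂μ' + b * δ) ∂μ' + b * δ * C := by
        gcongr with y
        exact h b _ (hg.comp measurable_prodMk_right) fun _ => hgb _
    _ = ∫⁻ y, ∫⁻ x, g (x, y) ∂μ' ∂μ' + b * δ * μ' univ + b * δ * C := by
        rw [lintegral_add_right _ measurable_const, lintegral_const]
    _ ≤ ∫⁻ y, ∫⁻ x, g (x, y) ∂μ' ∂μ' + b * δ * C + b * δ * C := by gcongr
    _ = _ := by ring

/-! ### One explicit Euler step -/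

/-- The explicit Euler step of length `h` for the linear jump process on `ℝ` in which a particle at
`x` jumps at rate `a x z` to `x + z` and at the same rate to `x - z`. The measure-valued form keeps
the step linear in `μ`, and it is dual to the operator in `lintegral_eulerStep`. -/
def eulerStep (h : ℝ≥0∞) (a : ℝ → ℝ → ℝ≥0∞) (μ : Measure ℝ) : Measure ℝ :=
  μ.withDensity (fun x => 1 - 2 * ∫⁻ z, h * a x z) +
    (Measure.map (fun p : ℝ × ℝ => p.1 + p.2) ((μ.prod volume).withDensity fun p => h * a p.1 p.2) +
      Measure.map (fun p : ℝ × ℝ => p.1 - p.2)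
        ((μ.prod volume).withDensity fun p => h * a p.1 p.2))

section Step

variable {h : ℝ≥0∞} {a : ℝ → ℝ → ℝ≥0∞} {μ : Measure ℝ} {f : ℝ → ℝ≥0∞}

/-- The step is dual to the operator `f ↦ f + h ∫ a(·, z) (Δ_z f) dz`, provided the step is so small
that the truncated subtraction is a true one. -/
lemma lintegral_eulerStep (ha : Measurable fun p : ℝ × ℝ => a p.1 p.2) (hf : Measurable f) :
    ∫⁻ x, f x ∂eulerStep h a μ =
      ∫⁻ x, ((1 - 2 * ∫⁻ z, h * a x z) * f x + ∫⁻ z, h * a x z * (f (x + z) + f (x - z))) ∂μ := by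
  have hha : Measurable fun p : ℝ × ℝ => h * a p.1 p.2 := ha.const_mul h
  have hx : ∀ x, Measurable fun z => h * a x z := fun x => hha.comp measurable_prodMk_left
  have hα : Measurable fun x => (1 - 2 * ∫⁻ z, h * a x z : ℝ≥0∞) :=
    (hha.lintegral_prod_right'.const_mul 2).const_sub 1
  have hαf : Measurable fun x => (1 - 2 * ∫⁻ z, h * a x z) * f x := hα.mul hf
  have hj : ∀ s : ℝ × ℝ → ℝ, Measurable s →
      ∫⁻ x, f x ∂Measure.map s ((μ.prod volume).withDensity fun p => h * a p.1 p.2) =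
        ∫⁻ x, (∫⁻ z, h * a x z * f (s (x, z))) ∂μ := by
    intro s hs
    have hfs : Measurable fun p => f (s p) := hf.comp hs
    rw [lintegral_map hf hs, lintegral_withDensity_eq_lintegral_mul _ hha hfs,
      lintegral_prod _ (hha.mul hfs).aemeasurable]
    rfl
  have hp : ∀ s : ℝ × ℝ → ℝ, Measurable s → Measurable fun p : ℝ × ℝ => h * a p.1 p.2 * f (s p) :=
    fun s hs => hha.mul (hf.comp hs)
  have h1 := hp (fun p => p.1 + p.2) (by fun_prop)
  have h1' : Measurable fun x => ∫⁻ z, h * a x z * f (x + z) := h1.lintegral_prod_right'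
  rw [eulerStep, lintegral_add_measure, lintegral_add_measure,
    lintegral_withDensity_eq_lintegral_mul _ hα hf, hj _ (by fun_prop), hj _ (by fun_prop),
    ← lintegral_add_left h1']
  refine (lintegral_add_left hαf _).symm.trans (lintegral_congr fun x => ?_)
  congr 1
  have : Measurable fun z => h * a x z * f (x + z) := h1.comp measurable_prodMk_left
  rw [← lintegral_add_left this]
  simp_rw [mul_add]

/-- The balance of an Euler step: the change of `∫ f dμ` is gain minus loss. -/
lemma lintegral_eulerStep_add (ha : Measurable fun p : ℝ × ℝ => a p.1 p.2) (hf : Measurable f)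
    (hh : ∀ x, 2 * ∫⁻ z, h * a x z ≤ 1) :
    ∫⁻ x, f x ∂eulerStep h a μ + ∫⁻ x, (∫⁻ z, h * a x z * (2 * f x)) ∂μ =
      ∫⁻ x, f x ∂μ + ∫⁻ x, (∫⁻ z, h * a x z * (f (x + z) + f (x - z))) ∂μ := by
  have hha : Measurable fun p : ℝ × ℝ => h * a p.1 p.2 := ha.const_mul h
  have hx : ∀ x, Measurable fun z => h * a x z := fun x => hha.comp measurable_prodMk_left
  have hg : Measurable fun x => ∫⁻ z, h * a x z * (2 * f x) :=
    Measurable.lintegral_prod_right' (f := fun p : ℝ × ℝ => h * a p.1 p.2 * (2 * f p.1))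
      (hha.mul ((hf.comp measurable_fst).const_mul 2))
  rw [lintegral_eulerStep ha hf, ← lintegral_add_right _ hg, ← lintegral_add_left hf]
  refine lintegral_congr fun x => ?_
  have h2 : ∫⁻ z, h * a x z * (2 * f x) = (2 * ∫⁻ z, h * a x z) * f x := by
    rw [lintegral_mul_const _ (hx x)]
    ring
  rw [h2, add_right_comm, ← add_mul, tsub_add_cancel_of_le (hh x), one_mul]

/-- A bound on the second differences of `f`, weighted with the rates, bounds the growth of `∫ f`. -/
lemma lintegral_eulerStep_le (ha : Measurable fun p : ℝ × ℝ => a p.1 p.2) (hf : Measurable f)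
    (hh : ∀ x, 2 * ∫⁻ z, h * a x z ≤ 1) {e : ℝ → ℝ → ℝ≥0∞}
    (hfe : ∀ x z, a x z * (f (x + z) + f (x - z)) ≤ a x z * (2 * f x) + e x z) :
    ∫⁻ x, f x ∂eulerStep h a μ ≤ ∫⁻ x, f x ∂μ + ∫⁻ x, (∫⁻ z, h * e x z) ∂μ := by
  have hha : Measurable fun p : ℝ × ℝ => h * a p.1 p.2 := ha.const_mul h
  have hx : ∀ x, Measurable fun z => h * a x z := fun x => hha.comp measurable_prodMk_left
  rw [lintegral_eulerStep ha hf, ← lintegral_add_left hf]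
  refine lintegral_mono fun x => ?_
  have h2 : ∫⁻ z, h * a x z * (2 * f x) = (2 * ∫⁻ z, h * a x z) * f x := by
    rw [lintegral_mul_const _ (hx x)]
    ring
  calc (1 - 2 * ∫⁻ z, h * a x z) * f x + ∫⁻ z, h * a x z * (f (x + z) + f (x - z))
      ≤ (1 - 2 * ∫⁻ z, h * a x z) * f x + ∫⁻ z, (h * a x z * (2 * f x) + h * e x z) := by
        gcongr with z
        rw [mul_assoc, mul_assoc, ← mul_add]
        gcongr
        exact hfe x z
    _ = f x + ∫⁻ z, h * e x z := by
        rw [lintegral_add_left ((hx x).mul_const _), h2, ← add_assoc,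
          ← add_mul, tsub_add_cancel_of_le (hh x), one_mul]

/-- Quantities whose second difference vanishes along all jumps are conserved. -/
lemma lintegral_eulerStep_eq (ha : Measurable fun p : ℝ × ℝ => a p.1 p.2) (hf : Measurable f)
    (hh : ∀ x, 2 * ∫⁻ z, h * a x z ≤ 1)
    (hfe : ∀ x z, a x z ≠ 0 → f (x + z) + f (x - z) = 2 * f x) :
    ∫⁻ x, f x ∂eulerStep h a μ = ∫⁻ x, f x ∂μ := by
  have hha : Measurable fun p : ℝ × ℝ => h * a p.1 p.2 := ha.const_mul h
  have hx : ∀ x, Measurable fun z => h * a x z := fun x => hha.comp measurable_prodMk_left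
  rw [lintegral_eulerStep ha hf]
  refine lintegral_congr fun x => ?_
  have h1 : ∀ z, h * a x z * (f (x + z) + f (x - z)) = h * a x z * (2 * f x) := by
    intro z
    rcases eq_or_ne (a x z) 0 with h0 | h0
    · simp [h0]
    · rw [hfe x z h0]
  have h2 : ∫⁻ z, h * a x z * (2 * f x) = (2 * ∫⁻ z, h * a x z) * f x := by
    rw [lintegral_mul_const _ (hx x)]
    ring
  simp_rw [h1]
  rw [h2, ← add_mul, tsub_add_cancel_of_le (hh x), one_mul]

/-- A step moves at most the fraction `2 h ∫ a(x, z) dz` of the mass at `x`. -/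
lemma withinTV_eulerStep (ha : Measurable fun p : ℝ × ℝ => a p.1 p.2)
    (hh : ∀ x, 2 * ∫⁻ z, h * a x z ≤ 1) {δ : ℝ≥0∞}
    (hδ : 2 * ∫⁻ x, (∫⁻ z, h * a x z) ∂μ ≤ δ) :
    WithinTV δ (eulerStep h a μ) μ ∧ WithinTV δ μ (eulerStep h a μ) := by
  have hha : Measurable fun p : ℝ × ℝ => h * a p.1 p.2 := ha.const_mul h
  have hx : ∀ x, Measurable fun z => h * a x z := fun x => hha.comp measurable_prodMk_left
  have key : ∀ b : ℝ≥0∞, ∫⁻ x, (∫⁻ z, h * a x z * (2 * b)) ∂μ ≤ b * δ := by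
    intro b
    have h1 : ∀ x, ∫⁻ z, h * a x z * (2 * b) = (∫⁻ z, h * a x z) * (2 * b) := fun x =>
      lintegral_mul_const _ (hx x)
    simp_rw [h1]
    rw [lintegral_mul_const _ hha.lintegral_prod_right']
    calc _ = b * (2 * ∫⁻ x, (∫⁻ z, h * a x z) ∂μ) := by ring
      _ ≤ b * δ := by gcongr
  constructor
  · intro b g hg hgb
    calc ∫⁻ x, g x ∂eulerStep h a μ
        ≤ ∫⁻ x, g x ∂eulerStep h a μ + ∫⁻ x, (∫⁻ z, h * a x z * (2 * g x)) ∂μ := le_self_add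
      _ = ∫⁻ x, g x ∂μ + ∫⁻ x, (∫⁻ z, h * a x z * (g (x + z) + g (x - z))) ∂μ :=
          lintegral_eulerStep_add ha hg hh
      _ ≤ ∫⁻ x, g x ∂μ + ∫⁻ x, (∫⁻ z, h * a x z * (2 * b)) ∂μ := by
          gcongr with x z
          rw [two_mul]
          exact add_le_add (hgb _) (hgb _)
      _ ≤ _ := by gcongr; exact key b
  · intro b g hg hgb
    calc ∫⁻ x, g x ∂μ
        ≤ ∫⁻ x, g x ∂μ + ∫⁻ x, (∫⁻ z, h * a x z * (g (x + z) + g (x - z))) ∂μ := le_self_add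
      _ = ∫⁻ x, g x ∂eulerStep h a μ + ∫⁻ x, (∫⁻ z, h * a x z * (2 * g x)) ∂μ :=
          (lintegral_eulerStep_add ha hg hh).symm
      _ ≤ ∫⁻ x, g x ∂eulerStep h a μ + ∫⁻ x, (∫⁻ z, h * a x z * (2 * b)) ∂μ := by
          gcongr with x z
          exact hgb _
      _ ≤ _ := by gcongr; exact key b

/-- An upper bound on the second differences of the rates bounds the growth of the density of
Lebesgue measure under an Euler step. -/
lemma eulerStep_volume_le (ha : Measurable fun p : ℝ × ℝ => a p.1 p.2)
    (hh : ∀ x, 2 * ∫⁻ z, h * a x z ≤ 1) {b : ℝ → ℝ≥0∞}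
    (hab : ∀ x z, a (x + z) z + a (x - z) z ≤ 2 * a x z + b z) :
    eulerStep h a volume ≤ (1 + ∫⁻ z, h * b z) • (volume : Measure ℝ) := by
  have hha : Measurable fun p : ℝ × ℝ => h * a p.1 p.2 := ha.const_mul h
  have hx : ∀ x, Measurable fun z => h * a x z := fun x => hha.comp measurable_prodMk_left
  refine Measure.le_iff.2 fun E hE => ?_
  set f : ℝ → ℝ≥0∞ := E.indicator 1
  have hf : Measurable f := measurable_one.indicator hE
  have hα : Measurable fun x => (1 - 2 * ∫⁻ z, h * a x z : ℝ≥0∞) :=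
    (hha.lintegral_prod_right'.const_mul 2).const_sub 1
  have hαf : Measurable fun x => (1 - 2 * ∫⁻ z, h * a x z) * f x := hα.mul hf
  have hp : ∀ s : ℝ × ℝ → ℝ, Measurable s → Measurable fun p : ℝ × ℝ => h * a p.1 p.2 * f (s p) :=
    fun s hs => hha.mul (hf.comp hs)
  have m1 := hp (fun p => p.1 + p.2) (by fun_prop)
  have m2 := hp (fun p => p.1 - p.2) (by fun_prop)
  have m3 : Measurable fun p : ℝ × ℝ => h * a (p.1 - p.2) p.2 * f p.1 :=
    (hha.comp (measurable_fst.sub measurable_snd |>.prodMk measurable_snd)).mul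
      (hf.comp measurable_fst)
  have m4 : Measurable fun p : ℝ × ℝ => h * a (p.1 + p.2) p.2 * f p.1 :=
    (hha.comp (measurable_fst.add measurable_snd |>.prodMk measurable_snd)).mul
      (hf.comp measurable_fst)
  have m1' : Measurable fun x => ∫⁻ z, h * a x z * f (x + z) := m1.lintegral_prod_right'
  have m3' : Measurable fun x => ∫⁻ z, h * a (x - z) z * f x := m3.lintegral_prod_right'
  -- Translation invariance moves the shift from `f` to the rates.
  have s1 : ∫⁻ x, ∫⁻ z, h * a x z * f (x + z) = ∫⁻ x, ∫⁻ z, h * a (x - z) z * f x := by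
    rw [lintegral_lintegral_swap (f := fun x z => h * a x z * f (x + z)) m1.aemeasurable,
      lintegral_lintegral_swap (f := fun x z => h * a (x - z) z * f x) m3.aemeasurable]
    refine lintegral_congr fun z => ?_
    rw [← lintegral_sub_right_eq_self _ z]
    simp
  have s2 : ∫⁻ x, ∫⁻ z, h * a x z * f (x - z) = ∫⁻ x, ∫⁻ z, h * a (x + z) z * f x := by
    rw [lintegral_lintegral_swap (f := fun x z => h * a x z * f (x - z)) m2.aemeasurable,
      lintegral_lintegral_swap (f := fun x z => h * a (x + z) z * f x) m4.aemeasurable]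
    refine lintegral_congr fun z => ?_
    rw [← lintegral_add_right_eq_self _ z]
    simp
  have hEf : ∀ μ' : Measure ℝ, μ' E = ∫⁻ x, f x ∂μ' := fun μ' => (lintegral_indicator_one hE).symm
  have split : ∀ x, ∫⁻ z, h * a x z * (f (x + z) + f (x - z)) =
      (∫⁻ z, h * a x z * f (x + z)) + ∫⁻ z, h * a x z * f (x - z) := by
    intro x
    have : Measurable fun z => h * a x z * f (x + z) := m1.comp measurable_prodMk_left
    rw [← lintegral_add_left this]
    simp_rw [mul_add]
  rw [Measure.smul_apply, smul_eq_mul, hEf, hEf, lintegral_eulerStep ha hf,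
    lintegral_add_left hαf]
  simp_rw [split]
  rw [lintegral_add_left m1', s1, s2,
    ← lintegral_add_left m3', ← lintegral_add_left hαf,
    ← lintegral_const_mul _ hf]
  refine lintegral_mono fun x => ?_
  calc (1 - 2 * ∫⁻ z, h * a x z) * f x +
        ((∫⁻ z, h * a (x - z) z * f x) + ∫⁻ z, h * a (x + z) z * f x)
      = ((1 - 2 * ∫⁻ z, h * a x z) + ∫⁻ z, (h * a (x + z) z + h * a (x - z) z)) * f x := by
        have m5 : Measurable fun z => h * a (x - z) z :=
          hha.comp ((measurable_const.sub measurable_id).prodMk measurable_id)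
        have m6 : Measurable fun z => h * a (x + z) z :=
          hha.comp ((measurable_const.add measurable_id).prodMk measurable_id)
        rw [lintegral_mul_const _ m5, lintegral_mul_const _ m6, lintegral_add_left m6]
        ring
    _ ≤ ((1 - 2 * ∫⁻ z, h * a x z) + ∫⁻ z, (2 * (h * a x z) + h * b z)) * f x := by
        refine mul_le_mul_left (add_le_add_right (lintegral_mono fun z => ?_) _) _
        rw [← mul_add, mul_left_comm, ← mul_add]
        exact mul_le_mul_right (hab x z) _
    _ ≤ (1 + ∫⁻ z, h * b z) * f x := by
        have m7 : Measurable fun z => 2 * (h * a x z) :=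
          (hx x).const_mul 2
        refine mul_le_mul_left ?_ _
        rw [lintegral_add_left m7, lintegral_const_mul _ (hx x),
          ← add_assoc, tsub_add_cancel_of_le (hh x)]
/-- The step is linear and monotone in the measure, so a bounded density and a remainder can be
followed separately. -/
lemma eulerStep_le (ha : Measurable fun p : ℝ × ℝ => a p.1 p.2) {κ : ℝ≥0∞} {c : ℝ≥0∞}
    {q : Measure ℝ} (hvol : eulerStep h a volume ≤ c • (volume : Measure ℝ))
    (hμ : μ ≤ κ • volume + q) :
    eulerStep h a μ ≤ (κ * c) • volume + eulerStep h a q := by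
  refine Measure.le_iff.2 fun E hE => ?_
  have hEf : ∀ μ' : Measure ℝ, μ' E = ∫⁻ x, E.indicator 1 x ∂μ' :=
    fun μ' => (lintegral_indicator_one hE).symm
  have hf : Measurable (E.indicator (1 : ℝ → ℝ≥0∞)) := measurable_one.indicator hE
  rw [hEf, lintegral_eulerStep ha hf]
  refine (lintegral_mono' hμ le_rfl).trans ?_
  rw [lintegral_add_measure, lintegral_smul_measure, ← lintegral_eulerStep ha hf,
    ← lintegral_eulerStep ha hf, ← hEf, ← hEf, smul_eq_mul, Measure.add_apply, Measure.smul_apply,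
    smul_eq_mul, mul_assoc]
  gcongr
  simpa using hvol E

end Step

/-! ### Regular kernels and their jump rates -/

/-- The weight `1 + x²`. -/
def wt (x : ℝ) : ℝ≥0∞ := ENNReal.ofReal (1 + x ^ 2)

@[fun_prop]
lemma measurable_wt : Measurable wt := by unfold wt; fun_prop

lemma wt_ne_top (x : ℝ) : wt x ≠ ∞ := ENNReal.ofReal_ne_top

lemma one_le_wt (x : ℝ) : 1 ≤ wt x := by
  rw [wt, ← ENNReal.ofReal_one]
  exact ENNReal.ofReal_le_ofReal (by nlinarith [sq_nonneg x])

lemma wt_ne_zero (x : ℝ) : wt x ≠ 0 := (zero_lt_one.trans_le (one_le_wt x)).ne'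

/-- The properties of the kernel that are used by the construction: an `ℝ≥0∞`-valued kernel on all
of `ℝ³`, extended by zero, with second differences in the donor size bounded from above. The bound
on second differences is stated at all points, so it includes the jump of the kernel at `x = z`. -/
structure IsRegularKernel (k : ℝ → ℝ → ℝ → ℝ≥0∞) (φ : ℝ → ℝ≥0∞) : Prop where
  measurable : Measurable fun p : ℝ × ℝ × ℝ => k p.1 p.2.1 p.2.2
  measurable_majorant : Measurable φ
  eq_zero : ∀ x y z, ¬(0 ≤ z ∧ z ≤ x) → k x y z = 0
  le : ∀ x y z, k x y z ≤ wt x * wt y * φ z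
  semiconcave : ∀ x y z,
    k (x + z) y z + k (x - z) y z ≤ 2 * k x y z + 10 * (wt z * φ z) * wt y

/-- Truncation of a kernel, bounding it in the donor variable. A minimum is used because it
preserves upper bounds on second differences. -/
def truncate (lam : ℝ≥0∞) (k : ℝ → ℝ → ℝ → ℝ≥0∞) (φ : ℝ → ℝ≥0∞) (x y z : ℝ) : ℝ≥0∞ :=
  min (k x y z) (lam * wt y * φ z)

/-- The rate `∫ k(x,y,z) μ(dy)` at which donors of size `x` give away mass `z`. -/
def jumpRate (k : ℝ → ℝ → ℝ → ℝ≥0∞) (μ : Measure ℝ) (x z : ℝ) : ℝ≥0∞ := ∫⁻ y, k x y z ∂μ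

section Kernel

variable {k : ℝ → ℝ → ℝ → ℝ≥0∞} {φ : ℝ → ℝ≥0∞} {lam h : ℝ≥0∞} {μ : Measure ℝ}

lemma IsRegularKernel.truncate (hk : IsRegularKernel k φ) (lam : ℝ≥0∞) :
    IsRegularKernel (truncate lam k φ) φ where
  measurable := hk.measurable.min (by
    have := hk.measurable_majorant
    fun_prop)
  measurable_majorant := hk.measurable_majorant
  eq_zero x y z hz := by simp [CGEDG.truncate, hk.eq_zero x y z hz]
  le x y z := (min_le_left _ _).trans (hk.le x y z)
  semiconcave x y z := by
    rcases le_total (k x y z) (lam * wt y * φ z) with h1 | h1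
    · simp only [CGEDG.truncate]
      rw [min_eq_left h1]
      exact (add_le_add (min_le_left _ _) (min_le_left _ _)).trans (hk.semiconcave x y z)
    · simp only [CGEDG.truncate]
      rw [min_eq_right h1, two_mul]
      exact (add_le_add (min_le_right _ _) (min_le_right _ _)).trans le_self_add

lemma truncate_le (x y z : ℝ) : truncate lam k φ x y z ≤ lam * wt y * φ z := min_le_right _ _

lemma IsRegularKernel.truncate_eq (hk : IsRegularKernel k φ) {x : ℝ} (hx : wt x ≤ lam) (y z : ℝ) :
    CGEDG.truncate lam k φ x y z = k x y z := by
  refine min_eq_left ((hk.le x y z).trans ?_)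
  gcongr

lemma IsRegularKernel.measurable_jumpRate (hk : IsRegularKernel k φ) [SFinite μ] :
    Measurable fun p : ℝ × ℝ => jumpRate k μ p.1 p.2 :=
  Measurable.lintegral_prod_right' (f := fun q : (ℝ × ℝ) × ℝ => k q.1.1 q.2 q.1.2)
    (hk.measurable.comp (by fun_prop : Measurable fun q : (ℝ × ℝ) × ℝ => (q.1.1, q.2, q.1.2)))

lemma IsRegularKernel.jumpRate_eq_zero (hk : IsRegularKernel k φ) {x z : ℝ}
    (hz : ¬(0 ≤ z ∧ z ≤ x)) : jumpRate k μ x z = 0 := by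
  simp [jumpRate, hk.eq_zero x _ z hz]

lemma IsRegularKernel.jumpRate_le (hk : IsRegularKernel k φ) (x z : ℝ) :
    jumpRate k μ x z ≤ wt x * φ z * ∫⁻ y, wt y ∂μ := by
  rw [← lintegral_const_mul _ measurable_wt]
  exact lintegral_mono fun y => (hk.le x y z).trans_eq (by ring)

lemma jumpRate_le_of_le (hlam : ∀ x y z, k x y z ≤ lam * wt y * φ z) (x z : ℝ) :
    jumpRate k μ x z ≤ lam * φ z * ∫⁻ y, wt y ∂μ := by
  rw [← lintegral_const_mul _ measurable_wt]
  exact lintegral_mono fun y => (hlam x y z).trans_eq (by ring)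

lemma IsRegularKernel.jumpRate_semiconcave (hk : IsRegularKernel k φ) (x z : ℝ) :
    jumpRate k μ (x + z) z + jumpRate k μ (x - z) z ≤
      2 * jumpRate k μ x z + 10 * (wt z * φ z) * ∫⁻ y, wt y ∂μ := by
  have hm : ∀ x, Measurable fun y => k x y z := fun x =>
    hk.measurable.comp (by fun_prop : Measurable fun y : ℝ => (x, y, z))
  unfold jumpRate
  rw [← lintegral_add_left (hm _), ← lintegral_const_mul _ (hm _),
    ← lintegral_const_mul _ measurable_wt, ← lintegral_add_left ((hm _).const_mul _)]
  exact lintegral_mono fun y => hk.semiconcave x y z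

/-- For a truncated kernel the positivity condition on the step length holds uniformly in `x`. -/
lemma IsRegularKernel.lintegral_jumpRate_small (hk : IsRegularKernel k φ)
    (hlam : ∀ x y z, k x y z ≤ lam * wt y * φ z)
    (hh : 2 * (h * (lam * ((∫⁻ z, wt z * φ z) * ∫⁻ y, wt y ∂μ))) ≤ 1) (x : ℝ) :
    2 * ∫⁻ z, h * jumpRate k μ x z ≤ 1 := by
  refine le_trans (mul_le_mul_right ?_ _) hh
  have hm := hk.measurable_majorant
  calc ∫⁻ z, h * jumpRate k μ x z
      ≤ ∫⁻ z, h * lam * (∫⁻ y, wt y ∂μ) * (wt z * φ z) := by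
        refine lintegral_mono fun z => ?_
        calc h * jumpRate k μ x z ≤ h * (lam * (1 * φ z) * ∫⁻ y, wt y ∂μ) := by
              rw [one_mul]
              gcongr
              exact jumpRate_le_of_le hlam x z
          _ ≤ h * (lam * (wt z * φ z) * ∫⁻ y, wt y ∂μ) := by
              gcongr
              exact one_le_wt z
          _ = _ := by ring
    _ = _ := by
        rw [lintegral_const_mul _ (by fun_prop)]
        ring

end Kernel

/-- The size cut-off `min((1 + x²)²/m, 1 + x²)`: comparable to `1 + x²` for large `x` only, and, as
a minimum of two powers of `1 + x²`, with second differences controlled by its own size. -/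
def tailWeight (m x : ℝ) : ℝ := min ((1 + x ^ 2) ^ 2 / m) (1 + x ^ 2)

lemma tailWeight_nonneg {m : ℝ} (hm : 0 < m) (x : ℝ) : 0 ≤ tailWeight m x :=
  le_min (by positivity) (by positivity)

/-- The second differences of the tail weight are bounded by `14 z²` times the weight itself, divided by
`1 + x²`, uniformly in `m`: the division cancels the quadratic growth of the kernel. -/
lemma tailWeight_diff_le {m x z : ℝ} (hm : 0 < m) (hz : 0 ≤ z) (hzx : z ≤ x) :
    tailWeight m (x + z) + tailWeight m (x - z) ≤
      2 * tailWeight m x + 14 * z ^ 2 * tailWeight m x / (1 + x ^ 2) := by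
  have hv : 0 < 1 + x ^ 2 := by positivity
  have hzx2 : z ^ 2 ≤ x ^ 2 := by gcongr
  rcases le_total ((1 + x ^ 2) ^ 2 / m) (1 + x ^ 2) with h | h
  · have e : tailWeight m x = (1 + x ^ 2) ^ 2 / m := min_eq_left h
    have l1 : tailWeight m (x + z) ≤ (1 + (x + z) ^ 2) ^ 2 / m := min_le_left _ _
    have l2 : tailWeight m (x - z) ≤ (1 + (x - z) ^ 2) ^ 2 / m := min_le_left _ _
    have key : (1 + (x + z) ^ 2) ^ 2 / m + (1 + (x - z) ^ 2) ^ 2 / m ≤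
        2 * ((1 + x ^ 2) ^ 2 / m) + 14 * z ^ 2 * (1 + x ^ 2) / m := by
      rw [← add_div, ← mul_div_assoc, ← add_div]
      refine div_le_div_of_nonneg_right ?_ hm.le
      nlinarith [mul_le_mul_of_nonneg_left hzx2 (sq_nonneg z), sq_nonneg z, sq_nonneg x]
    have e2 : 14 * z ^ 2 * ((1 + x ^ 2) ^ 2 / m) / (1 + x ^ 2) = 14 * z ^ 2 * (1 + x ^ 2) / m := by
      field_simp
    rw [e, e2]
    linarith
  · have e : tailWeight m x = 1 + x ^ 2 := min_eq_right h
    have l1 : tailWeight m (x + z) ≤ 1 + (x + z) ^ 2 := min_le_right _ _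
    have l2 : tailWeight m (x - z) ≤ 1 + (x - z) ^ 2 := min_le_right _ _
    rw [e, mul_div_assoc, div_self hv.ne']
    nlinarith [sq_nonneg z]

section EulerStep

variable {k : ℝ → ℝ → ℝ → ℝ≥0∞} {φ : ℝ → ℝ≥0∞} {lam h : ℝ≥0∞} {μ : Measure ℝ} [SFinite μ]

/-- The discrete form of the inequality `u' ≤ 2 (∫ z² φ) u²` for `u = ∫ (1 + x²) dμ`. -/
lemma IsRegularKernel.lintegral_wt_eulerStep (hk : IsRegularKernel k φ)
    (hh : ∀ x, 2 * ∫⁻ z, h * jumpRate k μ x z ≤ 1) :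
    ∫⁻ x, wt x ∂eulerStep h (jumpRate k μ) μ ≤
      ∫⁻ x, wt x ∂μ + 2 * h * (∫⁻ z, ENNReal.ofReal (z ^ 2) * φ z) * (∫⁻ x, wt x ∂μ) ^ 2 := by
  have hm := hk.measurable_majorant
  refine (lintegral_eulerStep_le hk.measurable_jumpRate measurable_wt hh
    (e := fun x z => jumpRate k μ x z * ENNReal.ofReal (2 * z ^ 2)) fun x z => ?_).trans ?_
  · rw [← mul_add]
    refine mul_le_mul_right ?_ _
    simp only [wt]
    rw [← ENNReal.ofReal_add (by positivity) (by positivity), two_mul (ENNReal.ofReal _),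
      ← ENNReal.ofReal_add (by positivity) (by positivity),
      ← ENNReal.ofReal_add (by positivity) (by positivity)]
    exact ENNReal.ofReal_le_ofReal (by nlinarith)
  · gcongr
    set u := ∫⁻ x, wt x ∂μ
    calc ∫⁻ x, (∫⁻ z, h * (jumpRate k μ x z * ENNReal.ofReal (2 * z ^ 2))) ∂μ
        ≤ ∫⁻ x, (∫⁻ z, (2 * h * u * wt x) * (ENNReal.ofReal (z ^ 2) * φ z)) ∂μ := by
          refine lintegral_mono fun x => lintegral_mono fun z => ?_
          calc h * (jumpRate k μ x z * ENNReal.ofReal (2 * z ^ 2))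
              ≤ h * (wt x * φ z * u * ENNReal.ofReal (2 * z ^ 2)) := by
                gcongr
                exact hk.jumpRate_le x z
            _ = _ := by
                rw [ENNReal.ofReal_mul zero_le_two, ENNReal.ofReal_ofNat]
                ring
      _ = ∫⁻ x, (2 * h * u * ∫⁻ z, ENNReal.ofReal (z ^ 2) * φ z) * wt x ∂μ := by
          refine lintegral_congr fun x => ?_
          rw [lintegral_const_mul _ (by fun_prop)]
          ring
      _ = _ := by
          rw [lintegral_const_mul _ measurable_wt]
          ring

/-- The discrete Gronwall inequality for the tails of the second moment; its constant does not depend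
on `m`. -/
lemma IsRegularKernel.lintegral_tailWeight_eulerStep (hk : IsRegularKernel k φ)
    (hh : ∀ x, 2 * ∫⁻ z, h * jumpRate k μ x z ≤ 1) {m : ℝ} (hm : 0 < m) :
    ∫⁻ x, ENNReal.ofReal (tailWeight m x) ∂eulerStep h (jumpRate k μ) μ ≤
      (1 + 14 * h * (∫⁻ z, ENNReal.ofReal (z ^ 2) * φ z) * ∫⁻ x, wt x ∂μ) *
        ∫⁻ x, ENNReal.ofReal (tailWeight m x) ∂μ := by
  have hφ := hk.measurable_majorant
  have hψ : Measurable fun x => ENNReal.ofReal (tailWeight m x) := by unfold tailWeight; fun_prop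
  set u := ∫⁻ x, wt x ∂μ
  set d : ℝ → ℝ → ℝ≥0∞ := fun x z =>
    ENNReal.ofReal (14 * z ^ 2 * tailWeight m x / (1 + x ^ 2)) with hd
  refine (lintegral_eulerStep_le hk.measurable_jumpRate hψ hh
    (e := fun x z => jumpRate k μ x z * d x z) fun x z => ?_).trans ?_
  · by_cases hz : 0 ≤ z ∧ z ≤ x
    · rw [← mul_add]
      refine mul_le_mul_right ?_ _
      have h0 := tailWeight_nonneg hm x
      rw [← ENNReal.ofReal_add (tailWeight_nonneg hm _) (tailWeight_nonneg hm _),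
        two_mul (ENNReal.ofReal _), ← ENNReal.ofReal_add h0 h0,
        ← ENNReal.ofReal_add (by positivity) (by positivity)]
      exact ENNReal.ofReal_le_ofReal (by linarith [tailWeight_diff_le hm hz.1 hz.2])
    · simp [hk.jumpRate_eq_zero hz]
  · rw [add_mul, one_mul]
    gcongr
    calc ∫⁻ x, (∫⁻ z, h * (jumpRate k μ x z * d x z)) ∂μ
        ≤ ∫⁻ x, (∫⁻ z, (14 * h * u * ENNReal.ofReal (tailWeight m x)) *
            (ENNReal.ofReal (z ^ 2) * φ z)) ∂μ := by
          refine lintegral_mono fun x => lintegral_mono fun z => ?_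
          have e : wt x * d x z =
              14 * (ENNReal.ofReal (z ^ 2) * ENNReal.ofReal (tailWeight m x)) := by
            rw [wt, hd, ← ENNReal.ofReal_mul (by positivity), ← ENNReal.ofReal_mul (by positivity),
              ← ENNReal.ofReal_ofNat 14, ← ENNReal.ofReal_mul (by positivity)]
            congr 1
            field_simp
          calc h * (jumpRate k μ x z * d x z) ≤ h * (wt x * φ z * u * d x z) := by
                gcongr
                exact hk.jumpRate_le x z
            _ = h * φ z * u * (wt x * d x z) := by ring
            _ = _ := by rw [e]; ring
      _ = ∫⁻ x, (14 * h * (∫⁻ z, ENNReal.ofReal (z ^ 2) * φ z) * u) *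
            ENNReal.ofReal (tailWeight m x) ∂μ := by
          refine lintegral_congr fun x => ?_
          rw [lintegral_const_mul _ (by fun_prop)]
          ring
      _ = _ := lintegral_const_mul _ hψ

lemma IsRegularKernel.withinTV_eulerStep (hk : IsRegularKernel k φ)
    (hh : ∀ x, 2 * ∫⁻ z, h * jumpRate k μ x z ≤ 1) {U : ℝ≥0∞} (hU : ∫⁻ x, wt x ∂μ ≤ U) :
    WithinTV (h * (2 * (∫⁻ z, wt z * φ z) * U ^ 2)) (eulerStep h (jumpRate k μ) μ) μ ∧
      WithinTV (h * (2 * (∫⁻ z, wt z * φ z) * U ^ 2)) μ (eulerStep h (jumpRate k μ) μ) := by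
  have hm := hk.measurable_majorant
  refine CGEDG.withinTV_eulerStep hk.measurable_jumpRate hh ?_
  calc 2 * ∫⁻ x, (∫⁻ z, h * jumpRate k μ x z) ∂μ
      ≤ 2 * ∫⁻ x, (∫⁻ z, (h * U * wt x) * (wt z * φ z)) ∂μ := by
        refine mul_le_mul_right (lintegral_mono fun x => lintegral_mono fun z => ?_) _
        calc h * jumpRate k μ x z ≤ h * (wt x * (1 * φ z) * U) := by
              rw [one_mul]
              gcongr
              exact (hk.jumpRate_le x z).trans (by gcongr)
          _ ≤ h * (wt x * (wt z * φ z) * U) := by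
              gcongr
              exact one_le_wt z
          _ = _ := by ring
    _ = 2 * ∫⁻ x, (h * U * ∫⁻ z, wt z * φ z) * wt x ∂μ := by
        congr 1
        refine lintegral_congr fun x => ?_
        rw [lintegral_const_mul _ (by fun_prop)]
        ring
    _ = 2 * (h * U * ∫⁻ z, wt z * φ z) * ∫⁻ x, wt x ∂μ := by
        rw [lintegral_const_mul _ measurable_wt]
        ring
    _ ≤ 2 * (h * U * ∫⁻ z, wt z * φ z) * U := by gcongr
    _ = _ := by ring

lemma IsRegularKernel.eulerStep_univ (hk : IsRegularKernel k φ)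
    (hh : ∀ x, 2 * ∫⁻ z, h * jumpRate k μ x z ≤ 1) :
    eulerStep h (jumpRate k μ) μ univ = μ univ := by
  have := lintegral_eulerStep_eq (μ := μ) (f := fun _ => 1) hk.measurable_jumpRate
    measurable_const hh fun x z _ => by norm_num
  simpa using this

lemma IsRegularKernel.lintegral_eulerStep_id (hk : IsRegularKernel k φ)
    (hh : ∀ x, 2 * ∫⁻ z, h * jumpRate k μ x z ≤ 1) :
    ∫⁻ x, ENNReal.ofReal x ∂eulerStep h (jumpRate k μ) μ = ∫⁻ x, ENNReal.ofReal x ∂μ := by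
  refine lintegral_eulerStep_eq hk.measurable_jumpRate (by fun_prop) hh fun x z hxz => ?_
  obtain ⟨hz, hzx⟩ : 0 ≤ z ∧ z ≤ x := by
    by_contra hc
    exact hxz (hk.jumpRate_eq_zero hc)
  rw [← ENNReal.ofReal_add (by linarith) (by linarith), two_mul,
    ← ENNReal.ofReal_add (by linarith) (by linarith)]
  congr 1
  ring

lemma IsRegularKernel.eulerStep_Iio (hk : IsRegularKernel k φ)
    (hh : ∀ x, 2 * ∫⁻ z, h * jumpRate k μ x z ≤ 1) :
    eulerStep h (jumpRate k μ) μ (Iio 0) = μ (Iio 0) := by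
  have := lintegral_eulerStep_eq (μ := μ) (f := (Iio 0).indicator 1) hk.measurable_jumpRate
    (measurable_one.indicator measurableSet_Iio) hh fun x z hxz => by
      obtain ⟨hz, hzx⟩ : 0 ≤ z ∧ z ≤ x := by
        by_contra hc
        exact hxz (hk.jumpRate_eq_zero hc)
      have h1 : ¬ x + z < 0 := by linarith
      have h2 : ¬ x < z := by linarith
      have h3 : ¬ x < 0 := by linarith
      simp [indicator, h1, h2, h3]
  simpa [lintegral_indicator_one measurableSet_Iio] using this

lemma IsRegularKernel.eulerStep_volume_le (hk : IsRegularKernel k φ)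
    (hh : ∀ x, 2 * ∫⁻ z, h * jumpRate k μ x z ≤ 1) {U : ℝ≥0∞} (hU : ∫⁻ x, wt x ∂μ ≤ U) :
    eulerStep h (jumpRate k μ) volume ≤
      (1 + h * (10 * (∫⁻ z, wt z * φ z) * U)) • (volume : Measure ℝ) := by
  have hm := hk.measurable_majorant
  refine (CGEDG.eulerStep_volume_le hk.measurable_jumpRate hh hk.jumpRate_semiconcave).trans ?_
  refine Measure.le_iff.2 fun E _ => ?_
  simp only [Measure.smul_apply, smul_eq_mul]
  gcongr
  have : ∀ z, h * (10 * (wt z * φ z) * ∫⁻ y, wt y ∂μ) = (10 * h * ∫⁻ y, wt y ∂μ) * (wt z * φ z) :=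
    fun z => by ring
  simp_rw [this]
  rw [lintegral_const_mul _ (by fun_prop)]
  calc _ = h * (10 * (∫⁻ z, wt z * φ z) * ∫⁻ y, wt y ∂μ) := by ring
    _ ≤ _ := by gcongr

end EulerStep

/-! ### The Euler scheme and its uniform estimates -/

/-- The explicit Euler scheme for the exchange equation: the rates of each step are those generated
by the current state. -/
def eulerSeq (h : ℝ≥0∞) (k : ℝ → ℝ → ℝ → ℝ≥0∞) (μ₀ : Measure ℝ) : ℕ → Measure ℝ
  | 0 => μ₀
  | j + 1 => eulerStep h (jumpRate k (eulerSeq h k μ₀ j)) (eulerSeq h k μ₀ j)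

instance (h : ℝ≥0∞) (a : ℝ → ℝ → ℝ≥0∞) (μ : Measure ℝ) [SFinite μ] :
    SFinite (eulerStep h a μ) := by
  unfold eulerStep; infer_instance

instance (h : ℝ≥0∞) (k : ℝ → ℝ → ℝ → ℝ≥0∞) (μ₀ : Measure ℝ) [SFinite μ₀] (j : ℕ) :
    SFinite (eulerSeq h k μ₀ j) := by
  induction j with
  | zero => assumption
  | succ j ih => rw [eulerSeq]; infer_instance

/-- The data of the problem after the reduction to kernels on `ℝ³` and data on `ℝ`: a regular kernel
`k` with majorant `φ`, an initial density `c`, and a time `T` before the blow-up of the differential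
inequality `u' ≤ 2 (∫ z² φ) u²` for `u = ∫ (1 + x²) c_t`. -/
structure EulerProblem where
  /-- the kernel -/
  k : ℝ → ℝ → ℝ → ℝ≥0∞
  /-- the majorant of the kernel in the exchanged mass -/
  φ : ℝ → ℝ≥0∞
  /-- the initial density -/
  c : ℝ → ℝ≥0∞
  /-- the final time -/
  T : ℝ
  regular : IsRegularKernel k φ
  majorant_ne_top : ∫⁻ z, wt z * φ z ≠ ∞
  measurable_datum : Measurable c
  datum_ne_top : ∫⁻ x, wt x * c x ≠ ∞
  datum_neg : ∀ x < 0, c x = 0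
  T_pos : 0 < T
  lt_one : 2 * (∫⁻ z, ENNReal.ofReal (z ^ 2) * φ z).toReal * (∫⁻ x, wt x * c x).toReal * T < 1

namespace EulerProblem

variable (P : EulerProblem)

/-- `‖φ‖ = ∫ (1 + z²) φ(z) dz`. -/
def normφ : ℝ≥0∞ := ∫⁻ z, wt z * P.φ z

/-- `∫ z² φ(z) dz`. -/
def secondφ : ℝ≥0∞ := ∫⁻ z, ENNReal.ofReal (z ^ 2) * P.φ z

/-- The initial value of `u = ∫ (1 + x²) c_t`. -/
def initialMoment : ℝ := (∫⁻ x, wt x * P.c x).toReal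

/-- The solution `u₀ / (1 - 2 (∫ z² φ) u₀ t)` of the equation `u' = 2 (∫ z² φ) u²`, which bounds
`∫ (1 + x²) c_t`. -/
def momentProfile (t : ℝ) : ℝ :=
  P.initialMoment / (1 - 2 * P.secondφ.toReal * P.initialMoment * t)

/-- A bound for `∫ (1 + x²) c_t` on `[0, T]`. -/
def bound : ℝ≥0∞ := ENNReal.ofReal (P.momentProfile P.T)

/-- The step length `T / (n + 1)`. -/
def step (n : ℕ) : ℝ≥0∞ := ENNReal.ofReal (P.T / (n + 1))

/-- The truncation level of the kernel. It is the largest one for which the explicit Euler step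
preserves positivity, and tends to infinity with `n`. -/
def level (n : ℕ) : ℝ≥0∞ := (2 * P.step n * P.normφ * P.bound)⁻¹

/-- The truncated kernel of the `n`-th scheme. -/
def kern (n : ℕ) : ℝ → ℝ → ℝ → ℝ≥0∞ := truncate (P.level n) P.k P.φ

/-- The `n`-th Euler approximation at time `j T / (n + 1)`. -/
def approx (n j : ℕ) : Measure ℝ :=
  eulerSeq (P.step n) (P.kern n) (volume.withDensity P.c) j

/-- The `n`-th Euler approximation with the weight `1 + x²`. -/
def weighted (n j : ℕ) : Measure ℝ := (P.approx n j).withDensity wt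

instance (n j : ℕ) : SFinite (P.approx n j) := by unfold approx; infer_instance

instance (n j : ℕ) : SFinite (P.weighted n j) := by unfold weighted; infer_instance

lemma regular_kern (n : ℕ) : IsRegularKernel (P.kern n) P.φ := P.regular.truncate _

lemma approx_succ (n j : ℕ) : P.approx n (j + 1) =
    eulerStep (P.step n) (jumpRate (P.kern n) (P.approx n j)) (P.approx n j) := rfl

lemma approx_zero (n : ℕ) : P.approx n 0 = volume.withDensity P.c := rfl

lemma bound_ne_top : P.bound ≠ ∞ := ENNReal.ofReal_ne_top

lemma secondφ_le : P.secondφ ≤ P.normφ := by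
  refine lintegral_mono fun z => ?_
  gcongr
  exact ENNReal.ofReal_le_ofReal (by linarith)

lemma secondφ_ne_top : P.secondφ ≠ ∞ := ne_top_of_le_ne_top P.majorant_ne_top P.secondφ_le

lemma initialMoment_nonneg : 0 ≤ P.initialMoment := ENNReal.toReal_nonneg

lemma one_sub_pos {t : ℝ} (ht : t ≤ P.T) :
    0 < 1 - 2 * P.secondφ.toReal * P.initialMoment * t := by
  have h1 := P.lt_one
  have h2 : 2 * P.secondφ.toReal * P.initialMoment * t ≤
      2 * P.secondφ.toReal * P.initialMoment * P.T := by
    have := P.initialMoment_nonneg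
    gcongr
  have h3 : 2 * P.secondφ.toReal * P.initialMoment * P.T < 1 := h1
  linarith

lemma momentProfile_nonneg {t : ℝ} (ht : t ≤ P.T) : 0 ≤ P.momentProfile t :=
  div_nonneg P.initialMoment_nonneg (P.one_sub_pos ht).le

lemma momentProfile_mono {s t : ℝ} (hst : s ≤ t) (ht : t ≤ P.T) :
    P.momentProfile s ≤ P.momentProfile t := by
  have h0 := P.initialMoment_nonneg
  have h1 := P.one_sub_pos ht
  unfold momentProfile
  gcongr

/-- The moment profile is convex, so an explicit Euler step stays below it. -/
lemma momentProfile_step {s η : ℝ} (hη : 0 ≤ η) (hs : s + η ≤ P.T) :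
    P.momentProfile s + 2 * η * P.secondφ.toReal * P.momentProfile s ^ 2 ≤
      P.momentProfile (s + η) := by
  have h1 := P.one_sub_pos hs
  have h0 := P.one_sub_pos (show s ≤ P.T by linarith)
  have hu := P.initialMoment_nonneg
  have hα : 0 ≤ P.secondφ.toReal := ENNReal.toReal_nonneg
  unfold momentProfile
  set u := P.initialMoment
  set α := P.secondφ.toReal
  set d := 1 - 2 * α * u * s with hd
  have e : 1 - 2 * α * u * (s + η) = d - 2 * α * u * η := by rw [hd]; ring
  rw [e] at h1 ⊢
  have hp : 0 ≤ 2 * α * u * η := by positivity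
  rw [le_div_iff₀ h1]
  have : (u / d + 2 * η * α * (u / d) ^ 2) * (d - 2 * α * u * η) =
      u - u * (2 * α * u * η) ^ 2 / d ^ 2 := by
    field_simp
    ring
  rw [this]
  have : 0 ≤ u * (2 * α * u * η) ^ 2 / d ^ 2 := by positivity
  linarith

lemma small_of_le {n j : ℕ} (hj : ∫⁻ x, wt x ∂P.approx n j ≤ P.bound) (x : ℝ) :
    2 * ∫⁻ z, P.step n * jumpRate (P.kern n) (P.approx n j) x z ≤ 1 := by
  refine (P.regular_kern n).lintegral_jumpRate_small (lam := P.level n) truncate_le ?_ x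
  calc 2 * (P.step n * (P.level n * (P.normφ * ∫⁻ y, wt y ∂P.approx n j)))
      ≤ 2 * (P.step n * (P.level n * (P.normφ * P.bound))) := by gcongr
    _ = (2 * P.step n * P.normφ * P.bound) * (2 * P.step n * P.normφ * P.bound)⁻¹ := by
        rw [level]; ring
    _ ≤ 1 := ENNReal.mul_inv_le_one _

lemma time_le {n j : ℕ} (hj : j ≤ n + 1) : j * (P.T / (n + 1)) ≤ P.T := by
  have h1 : (j : ℝ) ≤ n + 1 := by exact_mod_cast hj
  have := P.T_pos
  rw [← mul_div_assoc, div_le_iff₀ (by positivity)]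
  nlinarith

lemma lintegral_wt_approx_le_profile {n j : ℕ} (hj : j ≤ n + 1) :
    ∫⁻ x, wt x ∂P.approx n j ≤ ENNReal.ofReal (P.momentProfile (j * (P.T / (n + 1)))) := by
  induction j with
  | zero =>
    rw [approx_zero, lintegral_withDensity_eq_lintegral_mul _ P.measurable_datum measurable_wt]
    simp only [momentProfile, Nat.cast_zero, zero_mul, mul_zero, sub_zero, div_one]
    rw [initialMoment, ENNReal.ofReal_toReal P.datum_ne_top]
    refine lintegral_mono fun x => ?_
    simp [mul_comm]
  | succ j ih =>
    have ih := ih (by omega)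
    have hη : 0 ≤ P.T / (n + 1) := by have := P.T_pos; positivity
    have hT := P.time_le (show j ≤ n + 1 by omega)
    have hT' := P.time_le hj
    have hs := P.small_of_le
      (ih.trans (ENNReal.ofReal_le_ofReal (P.momentProfile_mono hT le_rfl)))
    have h0 := P.momentProfile_nonneg hT
    rw [approx_succ]
    refine ((P.regular_kern n).lintegral_wt_eulerStep hs).trans ?_
    push_cast at hT' ⊢
    rw [add_mul, one_mul] at hT' ⊢
    refine le_trans ?_ (ENNReal.ofReal_le_ofReal (P.momentProfile_step hη hT'))
    rw [ENNReal.ofReal_add h0 (by positivity), ENNReal.ofReal_mul (by positivity),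
      ENNReal.ofReal_mul (by positivity), ENNReal.ofReal_mul (by positivity),
      ENNReal.ofReal_toReal P.secondφ_ne_top, ENNReal.ofReal_pow h0, ENNReal.ofReal_ofNat]
    gcongr
    · exact le_rfl
    · exact le_rfl

/-- The bound on `∫ (1 + x²)` along the scheme. -/
lemma lintegral_wt_approx_le {n j : ℕ} (hj : j ≤ n + 1) :
    ∫⁻ x, wt x ∂P.approx n j ≤ P.bound :=
  (P.lintegral_wt_approx_le_profile hj).trans
    (ENNReal.ofReal_le_ofReal (P.momentProfile_mono (P.time_le hj) le_rfl))

lemma small {n j : ℕ} (hj : j ≤ n + 1) (x : ℝ) :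
    2 * ∫⁻ z, P.step n * jumpRate (P.kern n) (P.approx n j) x z ≤ 1 :=
  P.small_of_le (P.lintegral_wt_approx_le hj) x

lemma approx_univ {n j : ℕ} (hj : j ≤ n + 1) :
    P.approx n j univ = volume.withDensity P.c univ := by
  induction j with
  | zero => rfl
  | succ j ih =>
    rw [approx_succ, (P.regular_kern n).eulerStep_univ (P.small (by omega)),
      ih (by omega)]

lemma lintegral_id_approx {n j : ℕ} (hj : j ≤ n + 1) :
    ∫⁻ x, ENNReal.ofReal x ∂P.approx n j = ∫⁻ x, ENNReal.ofReal x ∂volume.withDensity P.c := by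
  induction j with
  | zero => rfl
  | succ j ih =>
    rw [approx_succ, (P.regular_kern n).lintegral_eulerStep_id (P.small (by omega)),
      ih (by omega)]

lemma approx_Iio {n j : ℕ} (hj : j ≤ n + 1) : P.approx n j (Iio 0) = 0 := by
  induction j with
  | zero =>
    rw [approx_zero, withDensity_apply _ measurableSet_Iio]
    exact (setLIntegral_congr_fun measurableSet_Iio fun x hx => P.datum_neg x hx).trans (by simp)
  | succ j ih =>
    rw [approx_succ, (P.regular_kern n).eulerStep_Iio (P.small (by omega)), ih (by omega)]

lemma weighted_univ_le {n j : ℕ} (hj : j ≤ n + 1) : P.weighted n j univ ≤ P.bound := by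
  rw [weighted, withDensity_apply _ MeasurableSet.univ, setLIntegral_univ]
  exact P.lintegral_wt_approx_le hj

lemma isFiniteMeasure_weighted {n j : ℕ} (hj : j ≤ n + 1) : IsFiniteMeasure (P.weighted n j) :=
  ⟨(P.weighted_univ_le hj).trans_lt P.bound_ne_top.lt_top⟩

/-- Discrete Gronwall growth factors are bounded by the exponential. -/
lemma one_add_step_mul_pow_le {C : ℝ≥0∞} (hC : C ≠ ∞) {n j : ℕ} (hj : j ≤ n + 1) :
    (1 + P.step n * C) ^ j ≤ ENNReal.ofReal (Real.exp (P.T * C.toReal)) := by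
  have hT := P.T_pos
  have h0 : 0 ≤ P.T / (n + 1) * C.toReal := by positivity
  rw [step, ← ENNReal.ofReal_toReal hC, ← ENNReal.ofReal_mul (by positivity),
    ← ENNReal.ofReal_one, ← ENNReal.ofReal_add zero_le_one h0,
    ← ENNReal.ofReal_pow (by positivity), ENNReal.toReal_ofReal ENNReal.toReal_nonneg]
  refine ENNReal.ofReal_le_ofReal ?_
  calc (1 + P.T / (n + 1) * C.toReal) ^ j ≤ Real.exp (P.T / (n + 1) * C.toReal) ^ j := by
        gcongr
        linarith [Real.add_one_le_exp (P.T / (n + 1) * C.toReal)]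
    _ = Real.exp (j * (P.T / (n + 1)) * C.toReal) := by
        rw [← Real.exp_nat_mul]
        ring_nf
    _ ≤ Real.exp (P.T * C.toReal) := by
        gcongr
        exact P.time_le hj

lemma lintegral_tailWeight_approx_le {n j : ℕ} (hj : j ≤ n + 1) {m : ℝ} (hm : 0 < m) :
    ∫⁻ x, ENNReal.ofReal (tailWeight m x) ∂P.approx n j ≤
      (1 + P.step n * (14 * P.secondφ * P.bound)) ^ j *
        ∫⁻ x, ENNReal.ofReal (tailWeight m x) ∂volume.withDensity P.c := by
  induction j with
  | zero => simp [approx_zero]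
  | succ j ih =>
    have hj' : j ≤ n + 1 := by omega
    rw [approx_succ]
    refine ((P.regular_kern n).lintegral_tailWeight_eulerStep (P.small hj') hm).trans ?_
    rw [pow_succ', mul_assoc (1 + _)]
    refine mul_le_mul' (add_le_add_right ?_ (1 : ℝ≥0∞)) (ih hj')
    calc 14 * P.step n * P.secondφ * ∫⁻ x, wt x ∂P.approx n j
        ≤ 14 * P.step n * P.secondφ * P.bound := by
          gcongr
          exact P.lintegral_wt_approx_le hj'
      _ = _ := by ring

lemma tendsto_tailWeight_datum :
    Tendsto (fun N : ℕ => ∫⁻ x, ENNReal.ofReal (tailWeight (N + 1) x) ∂volume.withDensity P.c)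
      atTop (𝓝 0) := by
  have hψ : ∀ N : ℕ, Measurable fun x => ENNReal.ofReal (tailWeight (N + 1) x) := by
    intro N; unfold tailWeight; fun_prop
  have hfin : ∫⁻ x, wt x ∂volume.withDensity P.c ≠ ∞ :=
    ne_top_of_le_ne_top P.bound_ne_top (P.lintegral_wt_approx_le (n := 0) (j := 0) (by omega))
  have := tendsto_lintegral_of_dominated_convergence (μ := volume.withDensity P.c)
    (f := fun _ => 0) wt hψ
    (fun N => ae_of_all _ fun x => ENNReal.ofReal_le_ofReal (min_le_right _ _)) hfin
    (ae_of_all _ fun x => by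
      rw [← ENNReal.ofReal_zero]
      refine ENNReal.tendsto_ofReal (squeeze_zero (fun N => tailWeight_nonneg (by positivity) x)
        (fun N => min_le_left _ _) ?_)
      exact (tendsto_const_div_atTop_nhds_zero_nat ((1 + x ^ 2) ^ 2)).comp (tendsto_add_atTop_nat 1)
        |>.congr fun N => by simp)
  simpa using this

/-- Uniform smallness of the tails of the second moment. -/
lemma exists_tail_le {ε : ℝ≥0∞} (hε : ε ≠ 0) : ∃ m : ℝ, 0 < m ∧ ∀ n j, j ≤ n + 1 →
    ∫⁻ x in {x | m ≤ 1 + x ^ 2}, wt x ∂P.approx n j ≤ ε := by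
  have hC : 14 * P.secondφ * P.bound ≠ ∞ :=
    ENNReal.mul_ne_top (ENNReal.mul_ne_top (by simp) P.secondφ_ne_top) P.bound_ne_top
  set G := ENNReal.ofReal (Real.exp (P.T * (14 * P.secondφ * P.bound).toReal))
  have hlim := ENNReal.Tendsto.const_mul (a := G) P.tendsto_tailWeight_datum
    (Or.inr ENNReal.ofReal_ne_top)
  rw [mul_zero] at hlim
  obtain ⟨N, hN⟩ := (hlim.eventually (Iic_mem_nhds (pos_iff_ne_zero.2 hε))).exists
  refine ⟨N + 1, by positivity, fun n j hj => ?_⟩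
  have hS : MeasurableSet {x : ℝ | (N : ℝ) + 1 ≤ 1 + x ^ 2} :=
    measurableSet_le (by fun_prop) (by fun_prop)
  calc ∫⁻ x in {x | (N : ℝ) + 1 ≤ 1 + x ^ 2}, wt x ∂P.approx n j
      ≤ ∫⁻ x in {x | (N : ℝ) + 1 ≤ 1 + x ^ 2}, ENNReal.ofReal (tailWeight (N + 1) x)
          ∂P.approx n j := by
        refine setLIntegral_mono' hS fun x (hx : (N : ℝ) + 1 ≤ 1 + x ^ 2) => ?_
        refine ENNReal.ofReal_le_ofReal (le_min ?_ le_rfl)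
        rw [le_div_iff₀ (by positivity), sq (1 + x ^ 2)]
        exact mul_le_mul_of_nonneg_left hx (by positivity)
    _ ≤ ∫⁻ x, ENNReal.ofReal (tailWeight (N + 1) x) ∂P.approx n j := setLIntegral_le_lintegral _ _
    _ ≤ _ := P.lintegral_tailWeight_approx_le hj (by positivity)
    _ ≤ G * _ := mul_le_mul_left (P.one_add_step_mul_pow_le hC hj) _
    _ ≤ ε := hN

/-- Up to a small mass, the initial density is bounded. -/
lemma exists_truncated_datum {ε : ℝ≥0∞} (hε : ε ≠ 0) :
    ∃ κ : ℝ≥0∞, κ ≠ ∞ ∧ ∫⁻ x, (P.c x - κ) ≤ ε := by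
  have hc : ∫⁻ x, P.c x ≠ ∞ := by
    refine ne_top_of_le_ne_top P.datum_ne_top (lintegral_mono fun x => ?_)
    simpa using mul_le_mul_left (one_le_wt x) (P.c x)
  have := tendsto_lintegral_of_dominated_convergence (F := fun (N : ℕ) x => P.c x - N)
    (f := fun _ => 0) P.c (fun N => P.measurable_datum.sub measurable_const)
    (fun N => ae_of_all _ fun x => tsub_le_self) hc
    ((ae_lt_top P.measurable_datum hc).mono fun x hx => by
      refine tendsto_const_nhds.congr' ?_
      obtain ⟨N, hN⟩ := ENNReal.exists_nat_gt hx.ne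
      filter_upwards [eventually_ge_atTop N] with l hl
      rw [tsub_eq_zero_of_le]
      exact hN.le.trans (by exact_mod_cast hl))
  rw [lintegral_zero] at this
  obtain ⟨N, hN⟩ := (this.eventually (Iic_mem_nhds (pos_iff_ne_zero.2 hε))).exists
  exact ⟨N, by simp, hN⟩

/-- Uniform integrability along the scheme. The part of the datum above the level `κ` keeps its
mass; the rest stays below a multiple of Lebesgue measure that grows at most exponentially. -/
lemma exists_approx_le {ε : ℝ≥0∞} (hε : ε ≠ 0) : ∃ κ : ℝ≥0∞, κ ≠ ∞ ∧ ∀ n j, j ≤ n + 1 →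
    ∀ E, P.approx n j E ≤ κ * volume E + ε := by
  obtain ⟨κ, hκ, hκε⟩ := P.exists_truncated_datum hε
  set C := 10 * P.normφ * P.bound
  have hC : C ≠ ∞ :=
    ENNReal.mul_ne_top (ENNReal.mul_ne_top (by simp) P.majorant_ne_top) P.bound_ne_top
  have key : ∀ n j, j ≤ n + 1 → ∃ q : Measure ℝ,
      P.approx n j ≤ (κ * (1 + P.step n * C) ^ j) • volume + q ∧ q univ ≤ ε := by
    intro n j hj
    induction j with
    | zero =>
      refine ⟨volume.withDensity fun x => P.c x - κ, ?_, ?_⟩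
      · rw [approx_zero, pow_zero, mul_one, ← withDensity_const, ← withDensity_add_left
          measurable_const]
        exact withDensity_mono (ae_of_all _ fun x => le_add_tsub)
      · rwa [withDensity_apply _ MeasurableSet.univ, setLIntegral_univ]
    | succ j ih =>
      have hj' : j ≤ n + 1 := by omega
      obtain ⟨q, hq, hqε⟩ := ih hj'
      have hm := (P.regular_kern n).measurable_jumpRate (μ := P.approx n j)
      refine ⟨eulerStep (P.step n) (jumpRate (P.kern n) (P.approx n j)) q, ?_, ?_⟩
      · rw [approx_succ, pow_succ, ← mul_assoc]
        exact eulerStep_le hm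
          ((P.regular_kern n).eulerStep_volume_le (P.small hj') (P.lintegral_wt_approx_le hj')) hq
      · have := lintegral_eulerStep_eq (μ := q) (f := fun _ => 1) hm measurable_const
          (P.small hj') fun x z _ => by norm_num
        simp only [lintegral_const, one_mul] at this
        rwa [this]
  refine ⟨κ * ENNReal.ofReal (Real.exp (P.T * C.toReal)),
    ENNReal.mul_ne_top hκ ENNReal.ofReal_ne_top, fun n j hj E => ?_⟩
  obtain ⟨q, hq, hqε⟩ := key n j hj
  calc P.approx n j E ≤ ((κ * (1 + P.step n * C) ^ j) • volume + q : Measure ℝ) E := hq E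
    _ = κ * (1 + P.step n * C) ^ j * volume E + q E := by simp
    _ ≤ _ := by
        gcongr
        · exact P.one_add_step_mul_pow_le hC hj
        · exact (measure_mono (subset_univ E)).trans hqε

lemma volume_sublevel_ne_top (m : ℝ) : volume {x : ℝ | 1 + x ^ 2 < m} ≠ ∞ := by
  refine ne_top_of_le_ne_top (measure_Icc_lt_top (a := -m) (b := m)).ne (measure_mono ?_)
  intro x (hx : 1 + x ^ 2 < m)
  exact ⟨by nlinarith [sq_nonneg (x + 1)], by nlinarith [sq_nonneg (x - 1)]⟩

/-- Concentration is excluded by `exists_approx_le` where `1 + x² < m`, and the rest is a small tail by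
`exists_tail_le`. -/
lemma exists_weighted_le {ε : ℝ≥0∞} (hε : ε ≠ 0) : ∃ (κ : ℝ≥0∞) (m : ℝ), κ ≠ ∞ ∧
    ∀ n j, j ≤ n + 1 → ∀ E, MeasurableSet E →
      P.weighted n j E ≤ κ * volume (E ∩ {x | 1 + x ^ 2 < m}) + ε := by
  obtain ⟨m, hm, htail⟩ := P.exists_tail_le (ENNReal.half_pos hε).ne'
  have hε' : (ε / 2) / ENNReal.ofReal m ≠ 0 :=
    ENNReal.div_ne_zero.2 ⟨(ENNReal.half_pos hε).ne', ENNReal.ofReal_ne_top⟩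
  obtain ⟨κ, hκ, hui⟩ := P.exists_approx_le hε'
  refine ⟨ENNReal.ofReal m * κ, m, ENNReal.mul_ne_top ENNReal.ofReal_ne_top hκ,
    fun n j hj E hE => ?_⟩
  have hS : MeasurableSet {x : ℝ | 1 + x ^ 2 < m} := measurableSet_lt (by fun_prop) (by fun_prop)
  have hSc : {x : ℝ | 1 + x ^ 2 < m}ᶜ = {x | m ≤ 1 + x ^ 2} := by ext x; simp
  have hdiff : E \ {x : ℝ | 1 + x ^ 2 < m} ⊆ {x | m ≤ 1 + x ^ 2} := by
    rw [← hSc]; exact fun x hx => hx.2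
  rw [← measure_inter_add_sdiff E hS, weighted, withDensity_apply _ (hE.inter hS),
    withDensity_apply _ (hE.diff hS)]
  calc _ ≤ ∫⁻ x in E ∩ {x | 1 + x ^ 2 < m}, ENNReal.ofReal m ∂P.approx n j + ε / 2 := by
        refine add_le_add ?_ ((lintegral_mono_set hdiff).trans (htail n j hj))
        exact setLIntegral_mono' (hE.inter hS) fun x hx =>
          ENNReal.ofReal_le_ofReal (le_of_lt hx.2)
    _ = ENNReal.ofReal m * P.approx n j (E ∩ {x | 1 + x ^ 2 < m}) + ε / 2 := by
        rw [setLIntegral_const]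
    _ ≤ ENNReal.ofReal m * (κ * volume (E ∩ {x | 1 + x ^ 2 < m}) + ε / 2 / ENNReal.ofReal m) +
          ε / 2 := by
        gcongr
        exact hui n j hj _
    _ = ENNReal.ofReal m * κ * volume (E ∩ {x | 1 + x ^ 2 < m}) + ε := by
        rw [mul_add, ENNReal.mul_div_cancel (by simpa using hm) ENNReal.ofReal_ne_top, add_assoc,
          ENNReal.add_halves, mul_assoc]

lemma weighted_eq_zero {n j : ℕ} (hj : j ≤ n + 1) {E : Set ℝ} (hE : MeasurableSet E)
    (h0 : volume E = 0) : P.weighted n j E = 0 := by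
  refine le_antisymm (ENNReal.le_of_forall_pos_le_add fun ε hε _ => ?_) zero_le
  obtain ⟨κ, m, -, h⟩ := P.exists_weighted_le (ε := ε) (by simpa using hε.ne')
  have h1 := h n j hj E hE
  rwa [measure_mono_null inter_subset_left h0, mul_zero] at h1

lemma uniformlyDominated_weighted {ι : Type*} (n j : ι → ℕ) (hj : ∀ i, j i ≤ n i + 1) :
    UniformlyDominated fun i => P.weighted (n i) (j i) := by
  intro ε hε
  obtain ⟨κ, m, hκ, h⟩ := P.exists_weighted_le hε
  have hS : MeasurableSet {x : ℝ | 1 + x ^ 2 < m} := measurableSet_lt (by fun_prop) (by fun_prop)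
  refine ⟨κ • volume.restrict {x | 1 + x ^ 2 < m}, ⟨?_⟩, fun i E hE => ?_⟩
  · simpa using ENNReal.mul_lt_top hκ.lt_top (volume_sublevel_ne_top m).lt_top
  · simpa [Measure.restrict_apply hE] using h _ _ (hj i) E hE

/-- The Lipschitz constant in time of the Euler approximations, in total variation. -/
def speed : ℝ≥0∞ := 2 * P.normφ * P.bound ^ 2

lemma speed_ne_top : P.speed ≠ ∞ :=
  ENNReal.mul_ne_top (ENNReal.mul_ne_top (by simp) P.majorant_ne_top)
    (ENNReal.pow_ne_top P.bound_ne_top)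

lemma withinTV_approx_add {n i d : ℕ} (hj : i + d ≤ n + 1) :
    WithinTV (d * (P.step n * P.speed)) (P.approx n (i + d)) (P.approx n i) ∧
      WithinTV (d * (P.step n * P.speed)) (P.approx n i) (P.approx n (i + d)) := by
  induction d with
  | zero => exact ⟨fun b g _ _ => by simp, fun b g _ _ => by simp⟩
  | succ d ih =>
    have hj' : i + d ≤ n + 1 := by omega
    have h1 := (P.regular_kern n).withinTV_eulerStep (P.small hj') (P.lintegral_wt_approx_le hj')
    have h2 := ih hj'
    have e : (↑(d + 1) : ℝ≥0∞) * (P.step n * P.speed) =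
        d * (P.step n * P.speed) + P.step n * P.speed := by push_cast; ring
    rw [e]
    exact ⟨(h1.1.trans h2.1).mono (add_comm _ _).le, h2.2.trans h1.2⟩

/-- Equicontinuity in time of the weighted approximations: Lipschitz continuity in total variation
on bounded sets, and uniformly small tails. -/
lemma exists_withinTV_weighted {ε : ℝ≥0∞} (hε : ε ≠ 0) : ∃ δ : ℝ, 0 < δ ∧ ∀ n i j : ℕ,
    i ≤ n + 1 → j ≤ n + 1 → |(i : ℝ) - j| * (P.T / (n + 1)) ≤ δ →
      WithinTV ε (P.weighted n i) (P.weighted n j) := by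
  obtain ⟨m, -, htail⟩ := P.exists_tail_le (ENNReal.half_pos hε).ne'
  have hD : ENNReal.ofReal m * P.speed ≠ ∞ :=
    ENNReal.mul_ne_top ENNReal.ofReal_ne_top P.speed_ne_top
  obtain ⟨δ, hδ, hδε⟩ : ∃ δ : ℝ, 0 < δ ∧
      ENNReal.ofReal m * (ENNReal.ofReal δ * P.speed) ≤ ε / 2 := by
    have hlim : Tendsto (fun δ : ℝ => ENNReal.ofReal m * P.speed * ENNReal.ofReal δ)
        (𝓝[>] 0) (𝓝 0) := by
      have h1 : Tendsto (fun δ : ℝ => ENNReal.ofReal δ) (𝓝[>] 0) (𝓝 0) := by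
        simpa using (ENNReal.continuous_ofReal.tendsto 0).mono_left nhdsWithin_le_nhds
      simpa using ENNReal.Tendsto.const_mul h1 (Or.inr hD)
    obtain ⟨δ, hδ1, hδ2⟩ := ((hlim.eventually (Iic_mem_nhds (ENNReal.half_pos hε))).and
      self_mem_nhdsWithin).exists
    exact ⟨δ, hδ2, le_of_eq_of_le (by ring) hδ1⟩
  refine ⟨δ, hδ, fun n i j hi hj hij b g hg hgb => ?_⟩
  have hTV : WithinTV (ENNReal.ofReal δ * P.speed) (P.approx n i) (P.approx n j) := by
    have hle : ∀ d : ℕ, (d : ℝ) * (P.T / (n + 1)) ≤ δ →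
        d * (P.step n * P.speed) ≤ ENNReal.ofReal δ * P.speed := by
      intro d hd
      rw [← mul_assoc, step, ← ENNReal.ofReal_natCast, ← ENNReal.ofReal_mul (by positivity)]
      gcongr
    rcases le_total i j with h | h
    · obtain ⟨d, rfl⟩ := Nat.exists_eq_add_of_le h
      refine (P.withinTV_approx_add hj).2.mono (hle d ?_)
      simpa [abs_sub_comm] using hij
    · obtain ⟨d, rfl⟩ := Nat.exists_eq_add_of_le h
      refine (P.withinTV_approx_add hi).1.mono (hle d ?_)
      simpa using hij
  have hS : MeasurableSet {x : ℝ | m ≤ 1 + x ^ 2} := measurableSet_le (by fun_prop) (by fun_prop)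
  have hw : ∀ l, ∫⁻ x, g x ∂P.weighted n l = ∫⁻ x, wt x * g x ∂P.approx n l := fun l =>
    lintegral_withDensity_eq_lintegral_mul _ measurable_wt hg
  have hwg : Measurable fun x => wt x * g x := measurable_wt.mul hg
  rw [hw, hw, ← lintegral_add_compl _ hS]
  have h1 : ∫⁻ x in {x | m ≤ 1 + x ^ 2}, wt x * g x ∂P.approx n i ≤ b * (ε / 2) := by
    calc ∫⁻ x in {x | m ≤ 1 + x ^ 2}, wt x * g x ∂P.approx n i
        ≤ ∫⁻ x in {x | m ≤ 1 + x ^ 2}, b * wt x ∂P.approx n i := by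
          refine lintegral_mono fun x => ?_
          rw [mul_comm]
          exact mul_le_mul_left (hgb x) _
      _ = b * ∫⁻ x in {x | m ≤ 1 + x ^ 2}, wt x ∂P.approx n i := lintegral_const_mul _ measurable_wt
      _ ≤ b * (ε / 2) := by
          gcongr
          exact htail n i hi
  have h2 : ∫⁻ x in {x | m ≤ 1 + x ^ 2}ᶜ, wt x * g x ∂P.approx n i ≤
      ∫⁻ x, wt x * g x ∂P.approx n j + b * (ε / 2) := by
    rw [← lintegral_indicator hS.compl]
    refine (hTV (ENNReal.ofReal m * b) _ (hwg.indicator hS.compl) fun x => ?_).trans ?_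
    · by_cases hx : m ≤ 1 + x ^ 2
      · simp [hx]
      · rw [indicator_of_mem (by simpa using hx)]
        exact mul_le_mul' (ENNReal.ofReal_le_ofReal (not_le.1 hx).le) (hgb x)
    · refine add_le_add (lintegral_mono fun x => indicator_le_self _ _ _) ?_
      calc ENNReal.ofReal m * b * (ENNReal.ofReal δ * P.speed)
          ≤ b * (ENNReal.ofReal m * (ENNReal.ofReal δ * P.speed)) := by
            rw [mul_comm (ENNReal.ofReal m) b, mul_assoc]
        _ ≤ b * (ε / 2) := by gcongr
  calc _ ≤ b * (ε / 2) + (∫⁻ x, wt x * g x ∂P.approx n j + b * (ε / 2)) := add_le_add h1 h2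
    _ = ∫⁻ x, wt x * g x ∂P.approx n j + b * (ε / 2 + ε / 2) := by ring
    _ = _ := by rw [ENNReal.add_halves]

end EulerProblem

/-! ### Fluxes as bounded functions of the donor and the receiver -/

/-- The integral `∫ k(x,y,z) g(x,z) dz` divided by the weights `(1 + x²)(1 + y²)`. For bounded `g` it
is a bounded function of `(x, y)`, so that it can be tested against setwise limits. -/
def flux (k : ℝ → ℝ → ℝ → ℝ≥0∞) (g : ℝ → ℝ → ℝ≥0∞) (p : ℝ × ℝ) : ℝ≥0∞ :=
  (wt p.1 * wt p.2)⁻¹ * ∫⁻ z, k p.1 p.2 z * g p.1 z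

section Flux

variable {k : ℝ → ℝ → ℝ → ℝ≥0∞} {φ : ℝ → ℝ≥0∞} {g : ℝ → ℝ → ℝ≥0∞} {μ : Measure ℝ} {b : ℝ≥0∞}

lemma IsRegularKernel.measurable_flux (hk : IsRegularKernel k φ)
    (hg : Measurable fun p : ℝ × ℝ => g p.1 p.2) : Measurable (flux k g) := by
  refine Measurable.mul (by fun_prop) ?_
  exact Measurable.lintegral_prod_right' (f := fun q : (ℝ × ℝ) × ℝ => k q.1.1 q.1.2 q.2 * g q.1.1 q.2)
    ((hk.measurable.comp
      (by fun_prop : Measurable fun q : (ℝ × ℝ) × ℝ => (q.1.1, q.1.2, q.2))).mul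
      (hg.comp (by fun_prop : Measurable fun q : (ℝ × ℝ) × ℝ => (q.1.1, q.2))))

lemma wt_mul_flux (p : ℝ × ℝ) :
    wt p.1 * wt p.2 * flux k g p = ∫⁻ z, k p.1 p.2 z * g p.1 z := by
  rw [flux, ← mul_assoc, ENNReal.mul_inv_cancel (mul_ne_zero (wt_ne_zero _) (wt_ne_zero _))
    (ENNReal.mul_ne_top (wt_ne_top _) (wt_ne_top _)), one_mul]

lemma IsRegularKernel.flux_le (hk : IsRegularKernel k φ) (hg : ∀ x z, g x z ≤ b) (p : ℝ × ℝ) :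
    flux k g p ≤ b * ∫⁻ z, wt z * φ z := by
  have hm := hk.measurable_majorant
  have h0 : wt p.1 * wt p.2 ≠ 0 := mul_ne_zero (wt_ne_zero _) (wt_ne_zero _)
  have ht : wt p.1 * wt p.2 ≠ ∞ := ENNReal.mul_ne_top (wt_ne_top _) (wt_ne_top _)
  rw [flux, ENNReal.inv_mul_le_iff h0 ht]
  calc ∫⁻ z, k p.1 p.2 z * g p.1 z ≤ ∫⁻ z, (wt p.1 * wt p.2 * b) * (wt z * φ z) := by
        refine lintegral_mono fun z => ?_
        calc k p.1 p.2 z * g p.1 z ≤ (wt p.1 * wt p.2 * (1 * φ z)) * b := by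
              rw [one_mul]
              exact mul_le_mul' (hk.le _ _ _) (hg _ _)
          _ ≤ (wt p.1 * wt p.2 * (wt z * φ z)) * b := by
              gcongr
              exact one_le_wt z
          _ = _ := by ring
    _ = _ := by
        rw [lintegral_const_mul _ (by fun_prop), mul_assoc]

/-- Integrating out the receiver and the exchanged mass, in terms of the weighted measures. -/
lemma IsRegularKernel.lintegral_flux (hk : IsRegularKernel k φ)
    (hg : Measurable fun p : ℝ × ℝ => g p.1 p.2) [SFinite μ] :
    ∫⁻ x, (∫⁻ z, jumpRate k μ x z * g x z) ∂μ =
      ∫⁻ p, flux k g p ∂(μ.withDensity wt).prod (μ.withDensity wt) := by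
  have hkm : ∀ x, Measurable fun q : ℝ × ℝ => k x q.2 q.1 := fun x =>
    hk.measurable.comp (by fun_prop : Measurable fun q : ℝ × ℝ => (x, q.2, q.1))
  have hw : Measurable fun p : ℝ × ℝ => wt p.1 * wt p.2 := by fun_prop
  have hF := hk.measurable_flux hg
  rw [prod_withDensity measurable_wt measurable_wt,
    lintegral_withDensity_eq_lintegral_mul _ hw hF]
  simp only [Pi.mul_apply, wt_mul_flux]
  have hm : Measurable fun p : ℝ × ℝ => ∫⁻ z, k p.1 p.2 z * g p.1 z := by
    simp_rw [← wt_mul_flux]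
    exact hw.mul hF
  rw [lintegral_prod _ hm.aemeasurable]
  refine lintegral_congr fun x => ?_
  have hgx : Measurable fun z => g x z := hg.comp measurable_prodMk_left
  rw [lintegral_lintegral_swap]
  · refine lintegral_congr fun z => ?_
    exact (lintegral_mul_const _ ((hkm x).comp measurable_prodMk_left)).symm
  · exact (((hkm x).comp measurable_swap).mul (hgx.comp measurable_snd)).aemeasurable

lemma IsRegularKernel.flux_truncate_le (lam : ℝ≥0∞) (p : ℝ × ℝ) :
    flux (CGEDG.truncate lam k φ) g p ≤ flux k g p := by
  unfold flux
  gcongr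
  exact min_le_left _ _

/-- The truncation matters only where `1 + x²` exceeds its level. -/
lemma IsRegularKernel.flux_le_truncate_add (hk : IsRegularKernel k φ) (hg : ∀ x z, g x z ≤ b)
    (lam : ℝ≥0∞) (p : ℝ × ℝ) : flux k g p ≤ flux (CGEDG.truncate lam k φ) g p +
      (b * ∫⁻ z, wt z * φ z) * {x | lam < wt x}.indicator 1 p.1 := by
  by_cases hp : lam < wt p.1
  · rw [indicator_of_mem (by exact hp), Pi.one_apply, mul_one]
    exact (hk.flux_le hg p).trans le_add_self
  · simp only [flux, hk.truncate_eq (not_lt.1 hp)]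
    exact le_self_add

end Flux

/-! ### Passing to the limit in an Euler scheme -/

/-- The index of the last grid point `j T / (n + 1)` not after `t`, cut off at `n + 1`. -/
def timeIndex (T : ℝ) (n : ℕ) (t : ℝ) : ℕ := min ⌊t / (T / (n + 1))⌋₊ (n + 1)

lemma timeIndex_le (T : ℝ) (n : ℕ) (t : ℝ) : timeIndex T n t ≤ n + 1 := min_le_right _ _

section TimeIndex

variable {T : ℝ}

lemma timeIndex_zero (n : ℕ) : timeIndex T n 0 = 0 := by simp [timeIndex]

lemma timeIndex_mono (hT : 0 < T) (n : ℕ) : Monotone (timeIndex T n) := by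
  intro s t hst
  exact min_le_min_right _ (Nat.floor_le_floor (div_le_div_of_nonneg_right hst (by positivity)))

lemma timeIndex_mul_le (hT : 0 < T) (n : ℕ) {t : ℝ} (ht : 0 ≤ t) :
    timeIndex T n t * (T / (n + 1)) ≤ t := by
  have hη : 0 < T / (n + 1) := by positivity
  rw [← le_div_iff₀ hη]
  exact (Nat.cast_le.2 (min_le_left _ _)).trans (Nat.floor_le (by positivity))

lemma le_timeIndex_mul_add (hT : 0 < T) (n : ℕ) {t : ℝ} (ht : t ≤ T) :
    t ≤ timeIndex T n t * (T / (n + 1)) + T / (n + 1) := by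
  have hη : 0 < T / (n + 1) := by positivity
  have hle : t / (T / (n + 1)) ≤ n + 1 := by
    rw [div_le_iff₀ hη]
    field_simp
    exact ht
  have : t / (T / (n + 1)) ≤ timeIndex T n t + 1 := by
    rw [timeIndex, Nat.cast_min, ← min_add_add_right]
    refine le_min (Nat.lt_floor_add_one _).le ?_
    push_cast
    linarith
  rw [div_le_iff₀ hη] at this
  linarith

lemma tendsto_stepLength (T : ℝ) : Tendsto (fun n : ℕ => T / (n + 1)) atTop (𝓝 0) := by
  exact ((tendsto_const_div_atTop_nhds_zero_nat T).comp (tendsto_add_atTop_nat 1)).congr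
    fun n => by simp

lemma tendsto_timeIndex_mul (hT : 0 < T) {t : ℝ} (ht : t ∈ Icc 0 T) :
    Tendsto (fun n : ℕ => timeIndex T n t * (T / (n + 1))) atTop (𝓝 t) := by
  refine tendsto_of_tendsto_of_tendsto_of_le_of_le
    (g := fun n : ℕ => t - T / (n + 1)) ?_ tendsto_const_nhds
    (fun n => by linarith [le_timeIndex_mul_add hT n ht.2]) fun n => timeIndex_mul_le hT n ht.1
  simpa using (tendsto_stepLength T).const_sub t

end TimeIndex

/-- A sequence whose increments are `η` times almost constant slopes is almost linear. -/
lemma abs_eulerSum_le {a w : ℕ → ℝ} {η x ε : ℝ} (hη : 0 ≤ η) (i d : ℕ)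
    (hstep : ∀ e < d, a (i + e + 1) = a (i + e) + η * w (i + e))
    (hw : ∀ e < d, |w (i + e) - x| ≤ ε) :
    |a (i + d) - a i - d * η * x| ≤ d * η * ε := by
  induction d with
  | zero => simp
  | succ d ih =>
    have ih := ih (fun e he => hstep e (by omega)) fun e he => hw e (by omega)
    have e1 : a (i + (d + 1)) - a i - ↑(d + 1) * η * x =
        (a (i + d) - a i - d * η * x) + η * (w (i + d) - x) := by
      rw [← add_assoc, hstep d (by omega)]
      push_cast
      ring
    rw [e1]
    refine (abs_add_le _ _).trans ?_
    rw [abs_mul, abs_of_nonneg hη]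
    have := mul_le_mul_of_nonneg_left (hw d (by omega)) hη
    push_cast
    linarith

/-- If Euler schemes `a` with slopes `w` converge pointwise in time along a filter, and the slopes
are equicontinuous, then the limit satisfies the limit equation. Only pointwise convergence is
needed: the limit `F` has right derivative `G`, and `G` is continuous. -/
theorem integral_eq_of_tendsto_euler {T : ℝ} (hT : 0 < T) {U : Filter ℕ} [U.NeBot] (hU : U ≤ atTop)
    {a w : ℕ → ℕ → ℝ} {F G : ℝ → ℝ} {C : ℝ}
    (hstep : ∀ n j, j < n + 1 → a n (j + 1) = a n j + T / (n + 1) * w n j)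
    (hw : ∀ n j, j ≤ n + 1 → |w n j| ≤ C)
    (hequi : ∀ ε > 0, ∃ δ > 0, ∀ n i j : ℕ, i ≤ n + 1 → j ≤ n + 1 →
      |(i : ℝ) - j| * (T / (n + 1)) ≤ δ → |w n i - w n j| ≤ ε)
    (hF : ∀ t ∈ Icc 0 T, Tendsto (fun n => a n (timeIndex T n t)) U (𝓝 (F t)))
    (hG : ∀ t ∈ Icc 0 T, Tendsto (fun n => w n (timeIndex T n t)) U (𝓝 (G t))) :
    ContinuousOn F (Icc 0 T) ∧ ContinuousOn G (Icc 0 T) ∧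
      ∀ t ∈ Icc 0 T, F t - F 0 = ∫ s in (0 : ℝ)..t, G s := by
  have hη : ∀ n : ℕ, 0 ≤ T / (n + 1) := fun n => by positivity
  have hdiff : ∀ s ∈ Icc 0 T, ∀ t ∈ Icc 0 T, Tendsto (fun n : ℕ =>
      ((timeIndex T n t : ℝ) - timeIndex T n s) * (T / (n + 1))) U (𝓝 (t - s)) := by
    intro s hs t ht
    simp_rw [sub_mul]
    exact ((tendsto_timeIndex_mul hT ht).sub (tendsto_timeIndex_mul hT hs)).mono_left hU
  have hd : ∀ n s t, s ≤ t → ∃ d : ℕ, timeIndex T n t = timeIndex T n s + d ∧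
      (d : ℝ) = (timeIndex T n t : ℝ) - timeIndex T n s := by
    intro n s t hst
    obtain ⟨d, hd⟩ := Nat.exists_eq_add_of_le (timeIndex_mono hT n hst)
    exact ⟨d, hd, by rw [hd]; push_cast; ring⟩
  have hLip : ∀ s ∈ Icc 0 T, ∀ t ∈ Icc 0 T, s ≤ t → |F t - F s| ≤ (t - s) * C := by
    intro s hs t ht hst
    refine le_of_tendsto_of_tendsto ((hF t ht).sub (hF s hs)).abs
      ((hdiff s hs t ht).mul_const C) (Eventually.of_forall fun n => ?_)
    obtain ⟨d, hd1, hd2⟩ := hd n s t hst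
    have hle := timeIndex_le T n t
    have := abs_eulerSum_le (a := a n) (w := w n) (x := 0) (ε := C) (hη n) (timeIndex T n s) d
      (fun e he => hstep n _ (by omega)) fun e he => by simpa using hw n _ (by omega)
    simp only [mul_zero, sub_zero] at this
    beta_reduce
    rw [← hd2, hd1]
    exact this
  have hGcont : ∀ ε > 0, ∃ δ > 0, ∀ s ∈ Icc 0 T, ∀ t ∈ Icc 0 T, |t - s| < δ → |G t - G s| ≤ ε := by
    intro ε hε
    obtain ⟨δ, hδ, h⟩ := hequi ε hε
    refine ⟨δ, hδ, fun s hs t ht hst => ?_⟩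
    refine le_of_tendsto ((hG t ht).sub (hG s hs)).abs ?_
    filter_upwards [(hdiff s hs t ht).abs.eventually (Iio_mem_nhds hst)] with n hn
    refine h n _ _ (timeIndex_le _ _ _) (timeIndex_le _ _ _) ?_
    rw [← abs_of_nonneg (hη n), ← abs_mul]
    exact (mem_Iio.1 hn).le
  have hderiv : ∀ ε > 0, ∃ δ > 0, ∀ s ∈ Icc 0 T, ∀ t ∈ Icc 0 T, s ≤ t → t - s < δ →
      |F t - F s - (t - s) * G s| ≤ (t - s) * ε := by
    intro ε hε
    obtain ⟨δ, hδ, h⟩ := hequi ε hε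
    refine ⟨δ, hδ, fun s hs t ht hst hlt => ?_⟩
    refine le_of_tendsto_of_tendsto
      (((hF t ht).sub (hF s hs)).sub ((hdiff s hs t ht).mul (hG s hs))).abs
      ((hdiff s hs t ht).mul_const ε) ?_
    filter_upwards [(hdiff s hs t ht).eventually (Iio_mem_nhds hlt)] with n hn
    obtain ⟨d, hd1, hd2⟩ := hd n s t hst
    have hle := timeIndex_le T n t
    rw [← hd2] at hn ⊢
    rw [hd1]
    refine abs_eulerSum_le (hη n) _ d (fun e he => hstep n _ (by omega)) fun e he =>
      h n _ _ (by omega) (by omega) ?_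
    have he' : (e : ℝ) ≤ d := by exact_mod_cast he.le
    have : |((timeIndex T n s + e : ℕ) : ℝ) - timeIndex T n s| = e := by
      push_cast
      simp
    rw [this]
    exact (mul_le_mul_of_nonneg_right he' (hη n)).trans (mem_Iio.1 hn).le
  have hC0 : 0 ≤ C := (abs_nonneg _).trans (hw 0 0 (by omega))
  have hFc : ContinuousOn F (Icc 0 T) := by
    have : LipschitzOnWith C.toNNReal F (Icc 0 T) := by
      refine LipschitzOnWith.of_dist_le_mul fun s hs t ht => ?_
      rw [Real.coe_toNNReal _ hC0, Real.dist_eq, Real.dist_eq]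
      rcases le_total s t with hst | hst
      · rw [abs_sub_comm, abs_sub_comm s, abs_of_nonneg (sub_nonneg.2 hst), mul_comm]
        exact hLip s hs t ht hst
      · rw [abs_of_nonneg (sub_nonneg.2 hst), mul_comm]
        exact hLip t ht s hs hst
    exact this.continuousOn
  have hGc : ContinuousOn G (Icc 0 T) := by
    refine Metric.continuousOn_iff.2 fun s hs ε hε => ?_
    obtain ⟨δ, hδ, h⟩ := hGcont (ε / 2) (half_pos hε)
    exact ⟨δ, hδ, fun t ht hts => (h s hs t ht hts).trans_lt (half_lt_self hε)⟩
  refine ⟨hFc, hGc, fun t ht => ?_⟩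
  have hsub : Icc 0 t ⊆ Icc 0 T := Icc_subset_Icc_right ht.2
  rw [intervalIntegral.integral_eq_sub_of_hasDeriv_right_of_le ht.1 (hFc.mono hsub) (fun s hs => ?_)]
  · exact (hGc.mono (by rwa [uIcc_of_le ht.1])).intervalIntegrable
  · have hsT : s ∈ Icc 0 T := hsub ⟨hs.1.le, hs.2.le⟩
    rw [hasDerivWithinAt_iff_isLittleO, Asymptotics.isLittleO_iff]
    intro ε hε
    obtain ⟨δ, hδ, h⟩ := hderiv ε hε
    have hlt : s < min (s + δ) t := lt_min (by linarith) hs.2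
    filter_upwards [Ioo_mem_nhdsGT hlt] with r hr
    have h1 := hr.2.trans_le (min_le_left _ _)
    have h2 := hr.2.trans_le (min_le_right _ _)
    have := h s hsT r ⟨hsT.1.trans hr.1.le, (h2.trans_le ht.2).le⟩ hr.1.le (by linarith)
    rw [Real.norm_eq_abs, Real.norm_eq_abs, smul_eq_mul, abs_of_pos (sub_pos.2 hr.1)]
    linarith

/-! ### The limit of the Euler approximations -/

namespace EulerProblem

variable (P : EulerProblem)

/-- The approximations at the index belonging to the time `t`. -/
def weightedAt (t : ℝ) (n : ℕ) : Measure ℝ := P.weighted n (timeIndex P.T n t)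

instance (t : ℝ) (n : ℕ) : IsFiniteMeasure (P.weightedAt t n) :=
  P.isFiniteMeasure_weighted (timeIndex_le _ _ _)

lemma weightedAt_univ_le (t : ℝ) (n : ℕ) : P.weightedAt t n univ ≤ P.bound :=
  P.weighted_univ_le (timeIndex_le _ _ _)

lemma uniformlyDominated_weightedAt (t : ℝ) : UniformlyDominated (P.weightedAt t) :=
  P.uniformlyDominated_weighted _ _ fun _ => timeIndex_le _ _ _

/-- The setwise limit, along a fixed nonprincipal ultrafilter on `ℕ`, of the weighted approximations
at time `t`. A single ultrafilter serves all times simultaneously. -/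
def limit (t : ℝ) : Measure ℝ :=
  ((P.uniformlyDominated_weightedAt t).exists_tendsto (hyperfilter ℕ)).choose

lemma tendsto_limit (t : ℝ) (E : Set ℝ) (hE : MeasurableSet E) :
    Tendsto (fun n => P.weightedAt t n E) (hyperfilter ℕ) (𝓝 (P.limit t E)) :=
  ((P.uniformlyDominated_weightedAt t).exists_tendsto (hyperfilter ℕ)).choose_spec E hE

lemma limit_univ_le (t : ℝ) : P.limit t univ ≤ P.bound :=
  le_of_tendsto' (P.tendsto_limit t univ MeasurableSet.univ) fun n => P.weightedAt_univ_le t n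

instance (t : ℝ) : IsFiniteMeasure (P.limit t) :=
  ⟨(P.limit_univ_le t).trans_lt P.bound_ne_top.lt_top⟩

lemma limit_absolutelyContinuous (t : ℝ) : P.limit t ≪ halfLine := by
  refine Measure.AbsolutelyContinuous.mk fun E hE h0 => ?_
  rw [halfLine, Measure.restrict_apply hE] at h0
  have hneg : ∀ n, P.weightedAt t n (Iio 0) = 0 := fun n =>
    withDensity_absolutelyContinuous _ _ (P.approx_Iio (timeIndex_le _ _ _))
  refine tendsto_nhds_unique (P.tendsto_limit t E hE) (tendsto_const_nhds.congr fun n => ?_)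
  refine (le_antisymm ?_ zero_le).symm
  calc P.weightedAt t n E ≤ P.weightedAt t n (E ∩ Ici 0) + P.weightedAt t n (Iio 0) := by
        refine (measure_mono fun x hx => ?_).trans (measure_union_le _ _)
        rcases lt_or_ge x 0 with h | h
        · exact Or.inr h
        · exact Or.inl ⟨hx, h⟩
    _ = 0 := by
        rw [hneg, weightedAt, P.weighted_eq_zero (timeIndex_le _ _ _)
          (hE.inter measurableSet_Ici) h0, add_zero]

lemma limit_zero : P.limit 0 = (volume.withDensity P.c).withDensity wt := by
  refine Measure.ext fun E hE => tendsto_nhds_unique (P.tendsto_limit 0 E hE) ?_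
  simp [weightedAt, timeIndex_zero, weighted, approx_zero]

lemma tendsto_lintegral_limit (t : ℝ) {g : ℝ → ℝ≥0∞} (hg : Measurable g) {b : ℝ≥0∞} (hb : b ≠ ∞)
    (hgb : ∀ x, g x ≤ b) :
    Tendsto (fun n => ∫⁻ x, g x ∂P.weightedAt t n) (hyperfilter ℕ) (𝓝 (∫⁻ x, g x ∂P.limit t)) :=
  tendsto_lintegral_of_tendsto_setwise (P.tendsto_limit t) hg hb hgb

lemma tendsto_lintegral_prod_limit (t : ℝ) {g : ℝ × ℝ → ℝ≥0∞} (hg : Measurable g) {b : ℝ≥0∞}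
    (hb : b ≠ ∞) (hgb : ∀ p, g p ≤ b) :
    Tendsto (fun n => ∫⁻ p, g p ∂(P.weightedAt t n).prod (P.weightedAt t n)) (hyperfilter ℕ)
      (𝓝 (∫⁻ p, g p ∂(P.limit t).prod (P.limit t))) :=
  tendsto_lintegral_of_tendsto_setwise ((P.uniformlyDominated_weightedAt t).tendsto_prod
    P.bound_ne_top (P.weightedAt_univ_le t) (P.tendsto_limit t)) hg hb hgb

lemma lintegral_weighted (n j : ℕ) {f : ℝ → ℝ≥0∞} (hf : Measurable f) :
    ∫⁻ x, (wt x)⁻¹ * f x ∂P.weighted n j = ∫⁻ x, f x ∂P.approx n j := by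
  rw [weighted, lintegral_withDensity_eq_lintegral_mul _ measurable_wt (by fun_prop)]
  refine lintegral_congr fun x => ?_
  simp only [Pi.mul_apply]
  rw [← mul_assoc, ENNReal.mul_inv_cancel (wt_ne_zero x) (wt_ne_top x), one_mul]

lemma inv_wt_mul_le {b : ℝ≥0∞} {x : ℝ} {y : ℝ≥0∞} (h : y ≤ b) : (wt x)⁻¹ * y ≤ b := by
  calc (wt x)⁻¹ * y ≤ 1 * b := mul_le_mul' (ENNReal.inv_le_one.2 (one_le_wt x)) h
    _ = b := one_mul b

/-- Conservation of mass in the limit. -/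
lemma lintegral_limit_one (t : ℝ) :
    ∫⁻ x, (wt x)⁻¹ ∂P.limit t = volume.withDensity P.c univ := by
  refine tendsto_nhds_unique (P.tendsto_lintegral_limit t (b := 1) (by fun_prop) (by simp)
    fun x => ENNReal.inv_le_one.2 (one_le_wt x)) (tendsto_const_nhds.congr fun n => ?_)
  have := P.lintegral_weighted n (timeIndex P.T n t) (f := fun _ => 1) measurable_const
  simp only [mul_one, lintegral_const, one_mul] at this
  rw [weightedAt, this, P.approx_univ (timeIndex_le _ _ _)]

/-- Conservation of the first moment in the limit; `x / (1 + x²)` is a bounded test function. -/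
lemma lintegral_limit_id (t : ℝ) : ∫⁻ x, (wt x)⁻¹ * ENNReal.ofReal x ∂P.limit t =
    ∫⁻ x, ENNReal.ofReal x ∂volume.withDensity P.c := by
  refine tendsto_nhds_unique (P.tendsto_lintegral_limit t (b := 1) (by fun_prop) (by simp)
    fun x => ?_) (tendsto_const_nhds.congr fun n => ?_)
  · rw [ENNReal.inv_mul_le_iff (wt_ne_zero x) (wt_ne_top x), mul_one]
    exact ENNReal.ofReal_le_ofReal (by nlinarith [sq_nonneg (x - 1)])
  · rw [weightedAt, P.lintegral_weighted _ _ (by fun_prop),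
      P.lintegral_id_approx (timeIndex_le _ _ _)]

lemma tendsto_level : Tendsto P.level atTop (𝓝 ∞) := by
  have h1 : Tendsto P.step atTop (𝓝 0) := by
    rw [← ENNReal.ofReal_zero]
    exact ENNReal.tendsto_ofReal (tendsto_stepLength P.T)
  have h2 : Tendsto (fun n => 2 * P.normφ * P.bound * P.step n) atTop (𝓝 0) := by
    rw [← mul_zero (2 * P.normφ * P.bound)]
    exact ENNReal.Tendsto.const_mul h1 (Or.inr
      (ENNReal.mul_ne_top (ENNReal.mul_ne_top (by simp) P.majorant_ne_top) P.bound_ne_top))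
  have h3 := tendsto_inv_iff.2 h2
  rw [ENNReal.inv_zero] at h3
  refine h3.congr fun n => ?_
  rw [level]
  congr 1
  ring

section Flux

variable {g : ℝ → ℝ → ℝ≥0∞} {b : ℝ≥0∞}

lemma lintegral_flux_weighted_le (hgb : ∀ x z, g x z ≤ b) {n j : ℕ} (hj : j ≤ n + 1) :
    ∫⁻ p, flux (P.kern n) g p ∂(P.weighted n j).prod (P.weighted n j) ≤
      b * P.normφ * P.bound ^ 2 := by
  calc _ ≤ ∫⁻ p, b * P.normφ ∂(P.weighted n j).prod (P.weighted n j) :=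
        lintegral_mono fun p => (P.regular_kern n).flux_le hgb p
    _ = b * P.normφ * (P.weighted n j univ * P.weighted n j univ) := by
        rw [lintegral_const, ← univ_prod_univ, Measure.prod_prod]
    _ ≤ _ := by
        rw [sq]
        gcongr <;> exact P.weighted_univ_le hj

/-- The fluxes of the truncated kernels converge to the flux of the kernel: the truncation only
affects the uniformly small tails. -/
lemma tendsto_lintegral_flux (hg : Measurable fun p : ℝ × ℝ => g p.1 p.2) (hb : b ≠ ∞)
    (hgb : ∀ x z, g x z ≤ b) (t : ℝ) :
    Tendsto (fun n => ∫⁻ p, flux (P.kern n) g p ∂(P.weightedAt t n).prod (P.weightedAt t n))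
      (hyperfilter ℕ) (𝓝 (∫⁻ p, flux P.k g p ∂(P.limit t).prod (P.limit t))) := by
  have hbφ : b * P.normφ ≠ ∞ := ENNReal.mul_ne_top hb P.majorant_ne_top
  have h1 := P.tendsto_lintegral_prod_limit t (P.regular.measurable_flux hg) hbφ
    (P.regular.flux_le hgb)
  have htail : Tendsto (fun n => P.weightedAt t n {x | P.level n < wt x}) (hyperfilter ℕ) (𝓝 0) := by
    refine Tendsto.mono_left ?_ Nat.hyperfilter_le_atTop
    refine ENNReal.tendsto_nhds_zero.2 fun ε hε => ?_
    obtain ⟨m, hm, htail⟩ := P.exists_tail_le hε.ne'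
    filter_upwards [P.tendsto_level.eventually (Ioi_mem_nhds (ENNReal.ofReal_lt_top (r := m)))]
      with n hn
    have hS : MeasurableSet {x : ℝ | P.level n < wt x} :=
      measurableSet_lt measurable_const measurable_wt
    rw [weightedAt, weighted, withDensity_apply _ hS]
    refine (lintegral_mono_set fun x (hx : P.level n < wt x) => ?_).trans
      (htail n _ (timeIndex_le _ _ _))
    have := (mem_Ioi.1 hn).trans hx
    exact ((ENNReal.ofReal_lt_ofReal_iff (by positivity)).1 this).le
  have herr : Tendsto (fun n => b * P.normφ * (P.weightedAt t n {x | P.level n < wt x} * P.bound))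
      (hyperfilter ℕ) (𝓝 0) := by
    simpa using ENNReal.Tendsto.const_mul
      (ENNReal.Tendsto.mul_const htail (Or.inr P.bound_ne_top)) (Or.inr hbφ)
  have h2 := ENNReal.Tendsto.sub h1 herr (Or.inr ENNReal.zero_ne_top)
  rw [tsub_zero] at h2
  refine tendsto_of_tendsto_of_tendsto_of_le_of_le h2 h1 (fun n => ?_) fun n =>
    lintegral_mono fun p => IsRegularKernel.flux_truncate_le _ p
  rw [tsub_le_iff_right]
  have hS : MeasurableSet {x : ℝ | P.level n < wt x} :=
    measurableSet_lt measurable_const measurable_wt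
  have hmi : Measurable fun p : ℝ × ℝ => {x | P.level n < wt x}.indicator (1 : ℝ → ℝ≥0∞) p.1 :=
    (measurable_one.indicator hS).comp measurable_fst
  calc ∫⁻ p, flux P.k g p ∂(P.weightedAt t n).prod (P.weightedAt t n)
      ≤ ∫⁻ p, (flux (P.kern n) g p + b * P.normφ * {x | P.level n < wt x}.indicator 1 p.1)
          ∂(P.weightedAt t n).prod (P.weightedAt t n) :=
        lintegral_mono fun p => P.regular.flux_le_truncate_add hgb _ p
    _ = ∫⁻ p, flux (P.kern n) g p ∂(P.weightedAt t n).prod (P.weightedAt t n) +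
          b * P.normφ * (P.weightedAt t n {x | P.level n < wt x} * P.weightedAt t n univ) := by
        rw [lintegral_add_right _ (hmi.const_mul _), lintegral_const_mul _ hmi,
          lintegral_prod _ hmi.aemeasurable]
        simp only [lintegral_const]
        rw [lintegral_mul_const _ (measurable_one.indicator hS), lintegral_indicator_one hS]
    _ ≤ _ := by
        gcongr
        exact P.weightedAt_univ_le t n

/-- Equicontinuity in time of the fluxes. -/
lemma exists_flux_equicontinuous (hg : Measurable fun p : ℝ × ℝ => g p.1 p.2) (hb : b ≠ ∞)
    (hgb : ∀ x z, g x z ≤ b) {ε : ℝ} (hε : 0 < ε) : ∃ δ > 0, ∀ n i j : ℕ, i ≤ n + 1 → j ≤ n + 1 →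
      |(i : ℝ) - j| * (P.T / (n + 1)) ≤ δ →
      (∫⁻ p, flux (P.kern n) g p ∂(P.weighted n i).prod (P.weighted n i)).toReal ≤
        (∫⁻ p, flux (P.kern n) g p ∂(P.weighted n j).prod (P.weighted n j)).toReal + ε := by
  have hbφ : b * P.normφ ≠ ∞ := ENNReal.mul_ne_top hb P.majorant_ne_top
  have hD : b * P.normφ * (2 * P.bound) ≠ ∞ :=
    ENNReal.mul_ne_top hbφ (ENNReal.mul_ne_top (by simp) P.bound_ne_top)
  set ε' : ℝ≥0∞ := ENNReal.ofReal ε / (b * P.normφ * (2 * P.bound) + 1) with hε'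
  have hε0 : ε' ≠ 0 := ENNReal.div_ne_zero.2
    ⟨by simpa using hε, ENNReal.add_ne_top.2 ⟨hD, by simp⟩⟩
  obtain ⟨δ, hδ, h⟩ := P.exists_withinTV_weighted hε0
  refine ⟨δ, hδ, fun n i j hi hj hij => ?_⟩
  have hTV := (h n i j hi hj hij).prod (P.weighted_univ_le hi) (P.weighted_univ_le hj)
    (b * P.normφ) _ ((P.regular_kern n).measurable_flux hg) ((P.regular_kern n).flux_le hgb)
  have hsmall : b * P.normφ * (2 * P.bound * ε') ≤ ENNReal.ofReal ε := by
    calc b * P.normφ * (2 * P.bound * ε') = ε' * (b * P.normφ * (2 * P.bound)) := by ring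
      _ ≤ ε' * (b * P.normφ * (2 * P.bound) + 1) := by gcongr; exact le_self_add
      _ ≤ ENNReal.ofReal ε := ENNReal.mul_le_of_le_div le_rfl
  have hfin : ∀ l ≤ n + 1,
      ∫⁻ p, flux (P.kern n) g p ∂(P.weighted n l).prod (P.weighted n l) ≠ ∞ := fun l hl =>
    ne_top_of_le_ne_top (ENNReal.mul_ne_top hbφ (ENNReal.pow_ne_top P.bound_ne_top))
      (P.lintegral_flux_weighted_le hgb hl)
  have := ENNReal.toReal_mono (ENNReal.add_ne_top.2 ⟨hfin j hj, ENNReal.ofReal_ne_top⟩)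
    (hTV.trans (add_le_add_right hsmall _))
  rwa [ENNReal.toReal_add (hfin j hj) ENNReal.ofReal_ne_top, ENNReal.toReal_ofReal hε.le] at this

end Flux

/-- The weak equation of the Euler scheme. -/
lemma lintegral_approx_succ {n j : ℕ} (hj : j ≤ n + 1) {f : ℝ → ℝ≥0∞} (hf : Measurable f) :
    ∫⁻ x, f x ∂P.approx n (j + 1) + P.step n * ∫⁻ p, flux (P.kern n) (fun x _ => 2 * f x) p
        ∂(P.weighted n j).prod (P.weighted n j) =
      ∫⁻ x, f x ∂P.approx n j + P.step n * ∫⁻ p, flux (P.kern n)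
        (fun x z => f (x + z) + f (x - z)) p ∂(P.weighted n j).prod (P.weighted n j) := by
  have hs : P.step n ≠ ∞ := ENNReal.ofReal_ne_top
  have key : ∀ g : ℝ → ℝ → ℝ≥0∞, (Measurable fun p : ℝ × ℝ => g p.1 p.2) →
      P.step n * ∫⁻ p, flux (P.kern n) g p ∂(P.weighted n j).prod (P.weighted n j) =
        ∫⁻ x, (∫⁻ z, P.step n * jumpRate (P.kern n) (P.approx n j) x z * g x z)
          ∂P.approx n j := by
    intro g hg
    rw [weighted, ← (P.regular_kern n).lintegral_flux hg, ← lintegral_const_mul' _ _ hs]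
    refine lintegral_congr fun x => ?_
    rw [← lintegral_const_mul' _ _ hs]
    simp_rw [mul_assoc]
  rw [key _ (by fun_prop), key _ (by fun_prop), approx_succ]
  exact lintegral_eulerStep_add (P.regular_kern n).measurable_jumpRate hf (P.small hj)

/-- The weak equation for the limit, tested with bounded nonnegative functions. -/
theorem weak_equation_limit {f : ℝ → ℝ≥0∞} (hf : Measurable f) {b : ℝ≥0∞} (hb : b ≠ ∞)
    (hfb : ∀ x, f x ≤ b) {F G : ℝ → ℝ}
    (hF : ∀ t, F t = (∫⁻ x, (wt x)⁻¹ * f x ∂P.limit t).toReal)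
    (hG : ∀ t, G t = (∫⁻ p, flux P.k (fun x z => f (x + z) + f (x - z)) p
        ∂(P.limit t).prod (P.limit t)).toReal -
      (∫⁻ p, flux P.k (fun x _ => 2 * f x) p ∂(P.limit t).prod (P.limit t)).toReal) :
    ContinuousOn F (Icc 0 P.T) ∧ ContinuousOn G (Icc 0 P.T) ∧
      ∀ t ∈ Icc 0 P.T, F t - F 0 = ∫ s in (0 : ℝ)..t, G s := by
  have h2b : 2 * b ≠ ∞ := ENNReal.mul_ne_top (by simp) hb
  set gain : ℝ → ℝ → ℝ≥0∞ := fun x z => f (x + z) + f (x - z)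
  set loss : ℝ → ℝ → ℝ≥0∞ := fun x _ => 2 * f x with hloss
  have mgain : Measurable fun p : ℝ × ℝ => gain p.1 p.2 := by fun_prop
  have mloss : Measurable fun p : ℝ × ℝ => loss p.1 p.2 := by fun_prop
  have bgain : ∀ x z, gain x z ≤ 2 * b := fun x z => by
    rw [two_mul]; exact add_le_add (hfb _) (hfb _)
  have bloss : ∀ x z, loss x z ≤ 2 * b := fun x z => by
    simp only [hloss]; gcongr; exact hfb x
  set I : (ℝ → ℝ → ℝ≥0∞) → ℕ → ℕ → ℝ := fun g n j =>
    (∫⁻ p, flux (P.kern n) g p ∂(P.weighted n j).prod (P.weighted n j)).toReal with hI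
  have hCfin : 2 * b * P.normφ * P.bound ^ 2 ≠ ∞ := ENNReal.mul_ne_top
    (ENNReal.mul_ne_top h2b P.majorant_ne_top) (ENNReal.pow_ne_top P.bound_ne_top)
  have hfin : ∀ g, (∀ x z, g x z ≤ 2 * b) → ∀ n j, j ≤ n + 1 →
      ∫⁻ p, flux (P.kern n) g p ∂(P.weighted n j).prod (P.weighted n j) ≠ ∞ :=
    fun g hg n j hj => ne_top_of_le_ne_top hCfin (P.lintegral_flux_weighted_le hg hj)
  have hIle : ∀ g, (∀ x z, g x z ≤ 2 * b) → ∀ n j, j ≤ n + 1 →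
      I g n j ≤ (2 * b * P.normφ * P.bound ^ 2).toReal :=
    fun g hg n j hj => ENNReal.toReal_mono hCfin (P.lintegral_flux_weighted_le hg hj)
  have hffin : ∀ n j, j ≤ n + 1 → ∫⁻ x, f x ∂P.approx n j ≠ ∞ := by
    intro n j hj
    rw [← P.lintegral_weighted n j hf]
    refine ne_top_of_le_ne_top (ENNReal.mul_ne_top hb P.bound_ne_top)
      ((lintegral_mono fun x => inv_wt_mul_le (hfb x)).trans ?_)
    rw [lintegral_const]
    gcongr
    exact P.weighted_univ_le hj
  refine integral_eq_of_tendsto_euler P.T_pos Nat.hyperfilter_le_atTop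
    (a := fun n j => (∫⁻ x, f x ∂P.approx n j).toReal) (w := fun n j => I gain n j - I loss n j)
    (C := (2 * b * P.normφ * P.bound ^ 2).toReal) ?_ ?_ ?_ ?_ ?_
  · intro n j hj
    have hη : 0 ≤ P.T / (n + 1) := by have := P.T_pos; positivity
    have h := congrArg ENNReal.toReal (P.lintegral_approx_succ hj.le hf)
    have hs : P.step n ≠ ∞ := ENNReal.ofReal_ne_top
    rw [ENNReal.toReal_add (hffin _ _ (by omega))
        (ENNReal.mul_ne_top hs (hfin loss bloss n j hj.le)),
      ENNReal.toReal_add (hffin _ _ hj.le) (ENNReal.mul_ne_top hs (hfin gain bgain n j hj.le)),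
      ENNReal.toReal_mul, ENNReal.toReal_mul, step, ENNReal.toReal_ofReal hη] at h
    simp only [hI]
    linarith
  · intro n j hj
    have h1 := hIle gain bgain n j hj
    have h2 := hIle loss bloss n j hj
    have h3 : 0 ≤ I gain n j := ENNReal.toReal_nonneg
    have h4 : 0 ≤ I loss n j := ENNReal.toReal_nonneg
    exact abs_sub_le_of_nonneg_of_le h3 h1 h4 h2
  · intro ε hε
    obtain ⟨δ₁, hδ₁, h₁⟩ := P.exists_flux_equicontinuous mgain h2b bgain (half_pos hε)
    obtain ⟨δ₂, hδ₂, h₂⟩ := P.exists_flux_equicontinuous mloss h2b bloss (half_pos hε)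
    refine ⟨min δ₁ δ₂, lt_min hδ₁ hδ₂, fun n i j hi hj hij => ?_⟩
    have hji := hij
    rw [abs_sub_comm] at hji
    have a1 := h₁ n i j hi hj (hij.trans (min_le_left _ _))
    have a2 := h₁ n j i hj hi (hji.trans (min_le_left _ _))
    have a3 := h₂ n i j hi hj (hij.trans (min_le_right _ _))
    have a4 := h₂ n j i hj hi (hji.trans (min_le_right _ _))
    simp only [hI]
    rw [abs_le]
    constructor <;> linarith
  · intro t _
    rw [hF t]
    have h := P.tendsto_lintegral_limit t (g := fun x => (wt x)⁻¹ * f x) (by fun_prop) hb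
      fun x => inv_wt_mul_le (hfb x)
    have hne : ∫⁻ x, (wt x)⁻¹ * f x ∂P.limit t ≠ ∞ := by
      refine ne_top_of_le_ne_top (ENNReal.mul_ne_top hb (measure_ne_top (P.limit t) univ))
        ((lintegral_mono fun x => inv_wt_mul_le (hfb x)).trans_eq (lintegral_const _))
    refine ((ENNReal.tendsto_toReal hne).comp h).congr fun n => ?_
    simp only [Function.comp_apply, weightedAt]
    rw [P.lintegral_weighted _ _ hf]
  · intro t _
    rw [hG t]
    have hne : ∀ g, (∀ x z, g x z ≤ 2 * b) →
        ∫⁻ p, flux P.k g p ∂(P.limit t).prod (P.limit t) ≠ ∞ := by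
      intro g hg
      refine ne_top_of_le_ne_top (ENNReal.mul_ne_top (ENNReal.mul_ne_top h2b P.majorant_ne_top)
        (measure_ne_top ((P.limit t).prod (P.limit t)) univ))
        ((lintegral_mono fun p => P.regular.flux_le hg p).trans_eq (lintegral_const _))
    exact ((ENNReal.tendsto_toReal (hne gain bgain)).comp
      (P.tendsto_lintegral_flux mgain h2b bgain t)).sub
      ((ENNReal.tendsto_toReal (hne loss bloss)).comp
      (P.tendsto_lintegral_flux mloss h2b bloss t))

end EulerProblem

/-! ### Reduction to regular kernels and measurable data -/

/-- A function whose second derivative is at most `B` has second differences at most `B z²`. -/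
lemma second_difference_le {f : ℝ → ℝ} {a B : ℝ}
    (hf : ∀ x, a < x → DifferentiableAt ℝ f x ∧ DifferentiableAt ℝ (deriv f) x ∧
      deriv (deriv f) x ≤ B) {x z : ℝ} (hz : 0 ≤ z) (hx : a < x - z) :
    f (x + z) + f (x - z) ≤ 2 * f x + B * z ^ 2 := by
  have hconc : ConcaveOn ℝ (Ioi a) fun s => f s - B / 2 * s ^ 2 := by
    refine concaveOn_of_hasDerivWithinAt2_nonpos (convex_Ioi a)
      (f' := fun s => deriv f s - B * s) (f'' := fun s => deriv (deriv f) s - B) ?_ ?_ ?_ ?_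
    · exact fun s hs => ((hf s hs).1.continuousAt.sub (by fun_prop)).continuousWithinAt
    · rw [interior_Ioi]
      intro s hs
      have h2 : HasDerivAt (fun s : ℝ => B / 2 * s ^ 2) (B * s) s :=
        ((hasDerivAt_pow 2 s).const_mul (B / 2)).congr_deriv (by norm_num; ring)
      exact ((hf s hs).1.hasDerivAt.sub h2).hasDerivWithinAt
    · rw [interior_Ioi]
      intro s hs
      have h2 : HasDerivAt (fun s : ℝ => B * s) B s := by
        simpa using (hasDerivAt_id s).const_mul B
      exact ((hf s hs).2.1.hasDerivAt.sub h2).hasDerivWithinAt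
    · rw [interior_Ioi]
      intro s hs
      linarith [(hf s hs).2.2]
  have h := hconc.2 (show x + z ∈ Ioi a by simp only [mem_Ioi]; linarith)
    (show x - z ∈ Ioi a from hx) (by norm_num : (0 : ℝ) ≤ 1 / 2) (by norm_num : (0 : ℝ) ≤ 1 / 2)
    (by norm_num)
  simp only [smul_eq_mul] at h
  have e : 1 / 2 * (x + z) + 1 / 2 * (x - z) = x := by ring
  rw [e] at h
  nlinarith

lemma max_one_sq_le (x : ℝ) : (max 1 x) ^ 2 ≤ 1 + x ^ 2 := by
  rcases max_cases 1 x with ⟨h, -⟩ | ⟨h, -⟩ <;> rw [h] <;> nlinarith [sq_nonneg x]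

section Reduction

variable {K : ℝ → ℝ → ℝ → ℝ} {φ : ℝ → ℝ}

lemma majorant_nonneg (hK : IsKernel K) (hgrowth : QuadraticGrowth K φ) {z : ℝ} (hz : 0 ≤ z) :
    0 ≤ φ z := by
  simpa using (hK.nonneg 0 0 z le_rfl le_rfl hz).trans (hgrowth 0 0 z le_rfl le_rfl hz)

lemma kernel_le (hK : IsKernel K) (hgrowth : QuadraticGrowth K φ) {x y z : ℝ} (hx : 0 ≤ x)
    (hy : 0 ≤ y) (hz : 0 ≤ z) : K x y z ≤ (1 + x ^ 2) * (1 + y ^ 2) * φ z := by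
  refine (hgrowth x y z hx hy hz).trans ?_
  have := majorant_nonneg hK hgrowth hz
  gcongr
  · exact max_one_sq_le x
  · exact max_one_sq_le y

/-- The second differences of the kernel, extended by zero, are bounded from above at every point.
Away from the jump at `x = z` this is the bound on the second derivative; near the jump the growth
bound suffices, because all points involved are at most `3 z`. -/
lemma kernel_semiconcave (hK : IsKernel K) (hgrowth : QuadraticGrowth K φ)
    (hderiv : SecondDerivBound K φ) (x : ℝ) {y z : ℝ} (hy : 0 ≤ y) (hz : 0 ≤ z) :
    (if 0 ≤ x + z then K (x + z) y z else 0) + (if 0 ≤ x - z then K (x - z) y z else 0) ≤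
      2 * (if 0 ≤ x then K x y z else 0) + 10 * ((1 + z ^ 2) * φ z) * (1 + y ^ 2) := by
  have hφ := majorant_nonneg hK hgrowth hz
  have hBnn : 0 ≤ φ z * (1 + y ^ 2) := by positivity
  have hBig : 0 ≤ 10 * ((1 + z ^ 2) * φ z) * (1 + y ^ 2) := by positivity
  rcases lt_or_ge x 0 with hx | hx
  · have h1 : (if 0 ≤ x + z then K (x + z) y z else 0) = 0 := by
      split_ifs with h
      · exact hK.eq_zero _ _ _ h hy (by linarith)
      · rfl
    rw [h1, if_neg (by linarith), if_neg (by linarith)]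
    linarith
  have hKx := hK.nonneg x y z hx hy hz
  rw [if_pos hx, if_pos (by linarith)]
  rcases le_or_gt x (2 * z) with hxz | hxz
  · have h1 : K (x + z) y z ≤ 9 * ((1 + z ^ 2) * φ z) * (1 + y ^ 2) := by
      refine (kernel_le hK hgrowth (by linarith) hy hz).trans ?_
      have : 1 + (x + z) ^ 2 ≤ 9 * (1 + z ^ 2) := by nlinarith
      nlinarith [mul_le_mul_of_nonneg_right this hBnn]
    have h2 : (if 0 ≤ x - z then K (x - z) y z else 0) ≤ (1 + z ^ 2) * φ z * (1 + y ^ 2) := by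
      split_ifs with h
      · refine (kernel_le hK hgrowth h hy hz).trans ?_
        have : 1 + (x - z) ^ 2 ≤ 1 + z ^ 2 := by nlinarith
        nlinarith [mul_le_mul_of_nonneg_right this hBnn]
      · positivity
    linarith
  · rw [if_pos (by linarith)]
    have h1 := second_difference_le (fun x' hx' => hderiv y z hy hz x' hx') hz
      (show z < x - z by linarith)
    have h2 : max 1 y ^ 2 * φ z * z ^ 2 ≤ 10 * ((1 + z ^ 2) * φ z) * (1 + y ^ 2) := by
      have h3 : max 1 y ^ 2 * φ z * z ^ 2 ≤ (1 + y ^ 2) * φ z * z ^ 2 := by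
        gcongr
        exact max_one_sq_le y
      nlinarith [mul_nonneg hBnn (sq_nonneg z)]
    linarith

end Reduction

/-- A measurable `ℝ≥0∞`-valued version, vanishing on the negative half-line, of an almost everywhere
measurable function on the half-line. -/
lemma exists_measurable_version {g : ℝ → ℝ} (hg : AEStronglyMeasurable g halfLine) :
    ∃ g' : ℝ → ℝ≥0∞, Measurable g' ∧ (∀ x < 0, g' x = 0) ∧
      ∀ᵐ x ∂halfLine, g' x = ENNReal.ofReal (g x) := by
  refine ⟨(Ici 0).indicator fun x => ENNReal.ofReal (hg.mk g x),
    hg.stronglyMeasurable_mk.measurable.ennreal_ofReal.indicator measurableSet_Ici,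
    fun x hx => indicator_of_notMem (by simpa using hx) _, ?_⟩
  filter_upwards [hg.ae_eq_mk, ae_restrict_mem measurableSet_Ici] with x hx hx0
  rw [indicator_of_mem hx0, ← hx]

lemma lintegral_halfLine {f : ℝ → ℝ≥0∞} (hf : ∀ x < 0, f x = 0) :
    ∫⁻ x, f x ∂halfLine = ∫⁻ x, f x := by
  rw [halfLine, ← lintegral_indicator measurableSet_Ici]
  refine lintegral_congr fun x => ?_
  by_cases hx : 0 ≤ x
  · exact indicator_of_mem hx _
  · rw [indicator_of_notMem (by simpa using hx), hf x (not_le.1 hx)]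

lemma weight_zero_two (x : ℝ) : weight 0 2 x = 1 + x ^ 2 := by
  simp [weight]

lemma lintegral_wt_version {g : ℝ → ℝ} (hg : MemYPos 0 2 g) {g' : ℝ → ℝ≥0∞}
    (hneg : ∀ x < 0, g' x = 0) (hgg : ∀ᵐ x ∂halfLine, g' x = ENNReal.ofReal (g x)) :
    ∫⁻ x, wt x * g' x = ENNReal.ofReal (normY 0 2 g) := by
  rw [← lintegral_halfLine fun x hx => by rw [hneg x hx, mul_zero], normY,
    ofReal_integral_eq_lintegral_ofReal hg.1.2]
  · refine lintegral_congr_ae ?_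
    filter_upwards [hgg, hg.2] with x hx hx0
    rw [hx, wt, ← ENNReal.ofReal_mul (by positivity), weight_zero_two, abs_of_nonneg hx0]
  · refine ae_of_all _ fun x => ?_
    change 0 ≤ weight 0 2 x * |g x|
    rw [weight_zero_two]
    positivity

/-- Extension of a kernel by zero to `ℝ³`, in which a null set of exchanged masses may be removed so
that the growth bound holds everywhere with a measurable majorant. -/
lemma exists_regular_kernel {K : ℝ → ℝ → ℝ → ℝ} {φ : ℝ → ℝ} (hK : IsKernel K)
    (hgrowth : QuadraticGrowth K φ) (hderiv : SecondDerivBound K φ) {φ' : ℝ → ℝ≥0∞}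
    (hφ' : Measurable φ') (hφφ' : ∀ᵐ z ∂halfLine, φ' z = ENNReal.ofReal (φ z)) :
    ∃ k : ℝ → ℝ → ℝ → ℝ≥0∞, IsRegularKernel k φ' ∧
      (∀ x y z, (x, y, z) ∉ domain → k x y z = 0) ∧
      ∀ᵐ z ∂halfLine, ∀ x y, 0 ≤ x → 0 ≤ y → k x y z = ENNReal.ofReal (K x y z) := by
  obtain ⟨S, hS, hSm, hSφ⟩ := hφφ'.exists_measurable_mem
  set Q : Set (ℝ × ℝ × ℝ) := {p | 0 ≤ p.1 ∧ 0 ≤ p.2.1 ∧ 0 ≤ p.2.2 ∧ p.2.2 ∈ S}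
  set k : ℝ → ℝ → ℝ → ℝ≥0∞ := fun x y z =>
    Q.indicator (fun p => ENNReal.ofReal (K p.1 p.2.1 p.2.2)) (x, y, z)
  have hkpos : ∀ {x y z}, 0 ≤ x → 0 ≤ y → 0 ≤ z → z ∈ S → k x y z = ENNReal.ofReal (K x y z) :=
    fun hx hy hz hzS => indicator_of_mem (show _ ∈ Q from ⟨hx, hy, hz, hzS⟩) _
  have hkneg : ∀ {x y z}, (x, y, z) ∉ Q → k x y z = 0 := fun h => indicator_of_notMem h _
  have hzero : ∀ x y z, (x, y, z) ∉ domain → k x y z = 0 := by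
    intro x y z hp
    by_cases hq : (x, y, z) ∈ Q
    · obtain ⟨hx, hy, hz, hzS⟩ := hq
      simp only at hx hy hz hzS
      rw [hkpos hx hy hz hzS]
      rcases lt_or_ge x z with h | h
      · rw [hK.eq_zero x y z hx hy h, ENNReal.ofReal_zero]
      · have : y < z := by
          by_contra hc
          exact hp ⟨hz, h, not_lt.1 hc⟩
        rw [hK.symm x y z hx hy hz, hK.eq_zero y x z hy hx this, ENNReal.ofReal_zero]
    · exact hkneg hq
  refine ⟨k, ⟨?_, hφ', ?_, ?_, ?_⟩, hzero, ?_⟩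
  · have m1 : MeasurableSet {p : ℝ × ℝ × ℝ | 0 ≤ p.1} :=
      measurableSet_le measurable_const (by fun_prop)
    have m2 : MeasurableSet {p : ℝ × ℝ × ℝ | 0 ≤ p.2.1} :=
      measurableSet_le measurable_const (by fun_prop)
    have m3 : MeasurableSet {p : ℝ × ℝ × ℝ | 0 ≤ p.2.2} :=
      measurableSet_le measurable_const (by fun_prop)
    have hQm : MeasurableSet Q := m1.inter (m2.inter (m3.inter
      (hSm.preimage (by fun_prop : Measurable fun p : ℝ × ℝ × ℝ => p.2.2))))
    have hm : Measurable fun p : ℝ × ℝ × ℝ =>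
        ENNReal.ofReal (K (p.1.toNNReal) (p.2.1.toNNReal) (p.2.2.toNNReal)) :=
      (hK.measurable.comp (by fun_prop : Measurable fun p : ℝ × ℝ × ℝ =>
        (p.1.toNNReal, p.2.1.toNNReal, p.2.2.toNNReal))).ennreal_ofReal
    refine (congrArg Measurable (funext fun p => ?_)).mp (hm.indicator hQm)
    by_cases hp : p ∈ Q
    · have hp' := hp
      obtain ⟨hx, hy, hz, hzS⟩ := hp'
      rw [indicator_of_mem hp, hkpos hx hy hz hzS, Real.coe_toNNReal _ hx, Real.coe_toNNReal _ hy,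
        Real.coe_toNNReal _ hz]
    · rw [indicator_of_notMem hp]
      exact (hkneg hp).symm
  · exact fun x y z hz => hzero x y z fun hp => hz ⟨hp.1, hp.2.1⟩
  · intro x y z
    by_cases hq : (x, y, z) ∈ Q
    · obtain ⟨hx, hy, hz, hzS⟩ := hq
      simp only at hx hy hz hzS
      rw [hkpos hx hy hz hzS, hSφ z hzS, wt, wt, ← ENNReal.ofReal_mul (by positivity),
        ← ENNReal.ofReal_mul (by positivity)]
      exact ENNReal.ofReal_le_ofReal (kernel_le hK hgrowth hx hy hz)
    · rw [hkneg hq]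
      exact zero_le
  · intro x y z
    by_cases hq : 0 ≤ y ∧ 0 ≤ z ∧ z ∈ S
    · obtain ⟨hy, hz, hzS⟩ := hq
      have hv : ∀ x, k x y z = ENNReal.ofReal (if 0 ≤ x then K x y z else 0) := by
        intro x
        split_ifs with hx
        · exact hkpos hx hy hz hzS
        · rw [ENNReal.ofReal_zero]
          exact hkneg fun h => hx h.1
      have hnn : ∀ x, 0 ≤ if 0 ≤ x then K x y z else 0 := by
        intro x
        split_ifs with hx
        · exact hK.nonneg x y z hx hy hz
        · exact le_rfl
      have hφ := majorant_nonneg hK hgrowth hz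
      have h10 : (10 : ℝ≥0∞) = ENNReal.ofReal 10 := by simp
      have h2 : (2 : ℝ≥0∞) = ENNReal.ofReal 2 := by simp
      rw [hv, hv, hv, hSφ z hzS, wt, wt, h10, h2, ← ENNReal.ofReal_add (hnn _) (hnn _),
        ← ENNReal.ofReal_mul (by norm_num), ← ENNReal.ofReal_mul (by positivity),
        ← ENNReal.ofReal_mul (by norm_num), ← ENNReal.ofReal_mul (by positivity),
        ← ENNReal.ofReal_add (mul_nonneg (by norm_num) (hnn _)) (by positivity)]
      exact ENNReal.ofReal_le_ofReal (kernel_semiconcave hK hgrowth hderiv x hy hz)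
    · have h0 : ∀ x, k x y z = 0 := fun x => hkneg fun h => hq h.2
      rw [h0, h0, add_zero]
      exact zero_le
  · filter_upwards [hS, ae_restrict_mem measurableSet_Ici] with z hzS hz x y hx hy
    exact hkpos hx hy hz hzS

/-! ### The weak form in terms of fluxes -/

lemma measurableSet_domain : MeasurableSet domain := by
  have m1 : MeasurableSet {p : ℝ × ℝ × ℝ | 0 ≤ p.2.2} :=
    measurableSet_le measurable_const (by fun_prop)
  have m2 : MeasurableSet {p : ℝ × ℝ × ℝ | p.2.2 ≤ p.1} :=
    measurableSet_le (by fun_prop) (by fun_prop)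
  have m3 : MeasurableSet {p : ℝ × ℝ × ℝ | p.2.2 ≤ p.2.1} :=
    measurableSet_le (by fun_prop) (by fun_prop)
  exact m1.inter (m2.inter m3)

lemma ae_domain_of_ae_halfLine {Q : ℝ → Prop} (hQ : ∀ᵐ x ∂halfLine, Q x) {s : ℝ × ℝ × ℝ → ℝ}
    (hs : Measure.QuasiMeasurePreserving s volume volume) (h0 : ∀ p ∈ domain, 0 ≤ s p) :
    ∀ᵐ p ∂volume.restrict domain, Q (s p) := by
  rw [halfLine, ae_restrict_iff' measurableSet_Ici] at hQ
  filter_upwards [ae_restrict_of_ae (hs.ae hQ), ae_restrict_mem measurableSet_domain] with p hp hpd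
  exact hp (h0 p hpd)

lemma quasiMeasurePreserving_mass :
    Measure.QuasiMeasurePreserving (fun p : ℝ × ℝ × ℝ => p.2.2) volume volume :=
  Measure.quasiMeasurePreserving_snd.comp Measure.quasiMeasurePreserving_snd

lemma weakForm_congr_ae (K : ℝ → ℝ → ℝ → ℝ) (c : ℝ → ℝ) {f g : ℝ → ℝ} (hfg : f =ᵐ[halfLine] g) :
    weakForm K f c = weakForm K g c := by
  have hadd : Measure.QuasiMeasurePreserving (fun p : ℝ × ℝ × ℝ => p.1 + p.2.2) volume volume :=
    QuasiMeasurePreserving.prod_of_right (by fun_prop) (ae_of_all _ fun x =>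
      (quasiMeasurePreserving_add_left volume x).comp Measure.quasiMeasurePreserving_snd)
  have hsub : Measure.QuasiMeasurePreserving (fun p : ℝ × ℝ × ℝ => p.1 - p.2.2) volume volume :=
    QuasiMeasurePreserving.prod_of_right (by fun_prop) (ae_of_all _ fun x =>
      (quasiMeasurePreserving_sub_left volume x).comp Measure.quasiMeasurePreserving_snd)
  refine integral_congr_ae ?_
  filter_upwards [ae_domain_of_ae_halfLine hfg hadd fun p hp => by
      have := hp.1; have := hp.2.1; linarith,
    ae_domain_of_ae_halfLine hfg Measure.quasiMeasurePreserving_fst fun p hp => by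
      have := hp.1; have := hp.2.1; linarith,
    ae_domain_of_ae_halfLine hfg hsub fun p hp => by
      have := hp.2.1; linarith] with p h1 h2 h3
  simp only [discreteLaplacian]
  rw [h1, h2, h3]

/-- The measure on `ℝ` with density `c`. -/
def densityMeasure (c : ℝ → ℝ) : Measure ℝ := volume.withDensity fun x => ENNReal.ofReal (c x)

instance (c : ℝ → ℝ) : SFinite (densityMeasure c) := by
  unfold densityMeasure; infer_instance

section WeakForm

variable {K : ℝ → ℝ → ℝ → ℝ} {k : ℝ → ℝ → ℝ → ℝ≥0∞} {φ' : ℝ → ℝ≥0∞} {c : ℝ → ℝ}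

/-- Integrals against `κ[c]` over the domain are integrals of the flux against the product of the
weighted densities. -/
lemma IsRegularKernel.lintegral_domain (hk : IsRegularKernel k φ')
    (hdom : ∀ x y z, (x, y, z) ∉ domain → k x y z = 0) (hc : Measurable c) {g : ℝ → ℝ → ℝ≥0∞}
    (hg : Measurable fun p : ℝ × ℝ => g p.1 p.2) :
    ∫⁻ p in domain, g p.1 p.2.2 *
        (k p.1 p.2.1 p.2.2 * ENNReal.ofReal (c p.1) * ENNReal.ofReal (c p.2.1)) =
      ∫⁻ p, flux k g p ∂((densityMeasure c).withDensity wt).prod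
        ((densityMeasure c).withDensity wt) := by
  have hD : Measurable fun x => ENNReal.ofReal (c x) := hc.ennreal_ofReal
  have hm : Measurable fun p : ℝ × ℝ × ℝ => g p.1 p.2.2 *
      (k p.1 p.2.1 p.2.2 * ENNReal.ofReal (c p.1) * ENNReal.ofReal (c p.2.1)) :=
    (hg.comp (by fun_prop : Measurable fun p : ℝ × ℝ × ℝ => (p.1, p.2.2))).mul
      ((hk.measurable.mul (hD.comp measurable_fst)).mul
        (hD.comp (by fun_prop : Measurable fun p : ℝ × ℝ × ℝ => p.2.1)))
  have hset : ∫⁻ p in domain, g p.1 p.2.2 *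
        (k p.1 p.2.1 p.2.2 * ENNReal.ofReal (c p.1) * ENNReal.ofReal (c p.2.1)) =
      ∫⁻ p : ℝ × ℝ × ℝ, g p.1 p.2.2 *
        (k p.1 p.2.1 p.2.2 * ENNReal.ofReal (c p.1) * ENNReal.ofReal (c p.2.1)) := by
    rw [← lintegral_indicator measurableSet_domain]
    refine lintegral_congr fun p => ?_
    by_cases hp : p ∈ domain
    · exact indicator_of_mem hp _
    · rw [indicator_of_notMem hp, hdom p.1 p.2.1 p.2.2 hp]
      simp
  have hJ := hk.measurable_jumpRate (μ := densityMeasure c)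
  have hJx : Measurable fun x => ∫⁻ z, jumpRate k (densityMeasure c) x z * g x z :=
    (hJ.mul hg).lintegral_prod_right'
  rw [hset, ← hk.lintegral_flux hg]
  refine Eq.trans ?_ (lintegral_withDensity_eq_lintegral_mul volume hD hJx).symm
  rw [Measure.volume_eq_prod, lintegral_prod _ hm.aemeasurable]
  refine lintegral_congr fun x => ?_
  have hmx : Measurable fun q : ℝ × ℝ => g x q.2 *
      (k x q.1 q.2 * ENNReal.ofReal (c x) * ENNReal.ofReal (c q.1)) :=
    hm.comp measurable_prodMk_left
  have hJgx : Measurable fun z => jumpRate k (densityMeasure c) x z * g x z :=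
    (hJ.mul hg).comp measurable_prodMk_left
  rw [Measure.volume_eq_prod, lintegral_prod_symm _ hmx.aemeasurable, Pi.mul_apply,
    ← lintegral_const_mul _ hJgx]
  refine lintegral_congr fun z => ?_
  have hkz : Measurable fun y => k x y z :=
    hk.measurable.comp (by fun_prop : Measurable fun y : ℝ => (x, y, z))
  rw [jumpRate, densityMeasure, lintegral_withDensity_eq_lintegral_mul _ hD hkz,
    ← lintegral_mul_const _ (hD.mul hkz), ← lintegral_const_mul _ ((hD.mul hkz).mul_const _)]
  refine lintegral_congr fun y => ?_
  simp only [Pi.mul_apply]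
  ring

/-- The weak form is the difference of the total gain and the total loss. -/
lemma weakForm_eq_flux (hk : IsRegularKernel k φ')
    (hdom : ∀ x y z, (x, y, z) ∉ domain → k x y z = 0)
    (hkK : ∀ᵐ z ∂halfLine, ∀ x y, 0 ≤ x → 0 ≤ y → k x y z = ENNReal.ofReal (K x y z))
    (hK : IsKernel K) (hφ : ∫⁻ z, wt z * φ' z ≠ ∞) (hc : Measurable c) (hc0 : ∀ x, 0 ≤ c x)
    (hcfin : (densityMeasure c).withDensity wt univ ≠ ∞)
    {f : ℝ → ℝ} (hf : Measurable f) (hf0 : ∀ x, 0 ≤ f x) {B : ℝ} (hfB : ∀ x, f x ≤ B) :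
    weakForm K f c =
      (∫⁻ p, flux k (fun x z => ENNReal.ofReal (f (x + z)) + ENNReal.ofReal (f (x - z))) p
        ∂((densityMeasure c).withDensity wt).prod ((densityMeasure c).withDensity wt)).toReal -
      (∫⁻ p, flux k (fun x _ => 2 * ENNReal.ofReal (f x)) p
        ∂((densityMeasure c).withDensity wt).prod ((densityMeasure c).withDensity wt)).toReal := by
  have key : ∀ (g : ℝ → ℝ → ℝ) (g' : ℝ → ℝ → ℝ≥0∞), (Measurable fun p : ℝ × ℝ => g p.1 p.2) →
      (∀ x z, 0 ≤ g x z) → (∀ x z, g x z ≤ 2 * B) → (∀ x z, g' x z = ENNReal.ofReal (g x z)) →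
      Integrable (fun p : ℝ × ℝ × ℝ => g p.1 p.2.2 * rate K c p.1 p.2.1 p.2.2)
          (volume.restrict domain) ∧
        ∫ p in domain, g p.1 p.2.2 * rate K c p.1 p.2.1 p.2.2 =
          (∫⁻ p, flux k g' p ∂((densityMeasure c).withDensity wt).prod
            ((densityMeasure c).withDensity wt)).toReal := by
    intro g g' hg hg0 hgB hgg'
    have hae : ∀ᵐ p ∂volume.restrict domain,
        k p.1 p.2.1 p.2.2 = ENNReal.ofReal (K p.1 p.2.1 p.2.2) := by
      filter_upwards [ae_domain_of_ae_halfLine hkK quasiMeasurePreserving_mass fun p hp => hp.1,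
        ae_restrict_mem measurableSet_domain] with p hp hpd
      exact hp _ _ (hpd.1.trans hpd.2.1) (hpd.1.trans hpd.2.2)
    have hKnn : ∀ᵐ p ∂volume.restrict domain, 0 ≤ K p.1 p.2.1 p.2.2 := by
      filter_upwards [ae_restrict_mem measurableSet_domain] with p hpd
      exact hK.nonneg _ _ _ (hpd.1.trans hpd.2.1) (hpd.1.trans hpd.2.2) hpd.1
    have hnn : ∀ᵐ p ∂volume.restrict domain,
        0 ≤ g p.1 p.2.2 * rate K c p.1 p.2.1 p.2.2 := by
      filter_upwards [hKnn] with p hp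
      exact mul_nonneg (hg0 _ _) (mul_nonneg (mul_nonneg hp (hc0 _)) (hc0 _))
    have hmeas : AEStronglyMeasurable
        (fun p : ℝ × ℝ × ℝ => g p.1 p.2.2 * rate K c p.1 p.2.1 p.2.2) (volume.restrict domain) := by
      have hm : Measurable fun p : ℝ × ℝ × ℝ =>
          g p.1 p.2.2 * ((k p.1 p.2.1 p.2.2).toReal * c p.1 * c p.2.1) :=
        (hg.comp (by fun_prop : Measurable fun p : ℝ × ℝ × ℝ => (p.1, p.2.2))).mul
          ((hk.measurable.ennreal_toReal.mul (hc.comp measurable_fst)).mul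
            (hc.comp (by fun_prop : Measurable fun p : ℝ × ℝ × ℝ => p.2.1)))
      refine hm.aestronglyMeasurable.congr ?_
      filter_upwards [hae, hKnn] with p hp hp0
      rw [hp, ENNReal.toReal_ofReal hp0, rate]
    have hlint : ∫⁻ p in domain, ENNReal.ofReal (g p.1 p.2.2 * rate K c p.1 p.2.1 p.2.2) =
        ∫⁻ p, flux k g' p ∂((densityMeasure c).withDensity wt).prod
            ((densityMeasure c).withDensity wt) := by
      have hg'm : Measurable fun p : ℝ × ℝ => g' p.1 p.2 := by
        simp_rw [hgg']
        exact hg.ennreal_ofReal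
      rw [← hk.lintegral_domain hdom hc hg'm]
      refine lintegral_congr_ae ?_
      filter_upwards [hae, hKnn] with p hp hp0
      rw [hp, hgg', rate, ← ENNReal.ofReal_mul hp0, ← ENNReal.ofReal_mul (mul_nonneg hp0 (hc0 _)),
        ← ENNReal.ofReal_mul (hg0 _ _)]
    have hfin : ∫⁻ p in domain, ENNReal.ofReal (g p.1 p.2.2 * rate K c p.1 p.2.1 p.2.2) ≠ ∞ := by
      rw [hlint]
      refine ne_top_of_le_ne_top ?_ ((lintegral_mono fun p => hk.flux_le
        (b := ENNReal.ofReal (2 * B)) (fun x z => ?_) p).trans_eq (lintegral_const _))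
      · rw [← univ_prod_univ, Measure.prod_prod]
        exact ENNReal.mul_ne_top (ENNReal.mul_ne_top ENNReal.ofReal_ne_top hφ)
          (ENNReal.mul_ne_top hcfin hcfin)
      · rw [hgg']
        exact ENNReal.ofReal_le_ofReal (hgB x z)
    refine ⟨⟨hmeas, ?_⟩, ?_⟩
    · rw [hasFiniteIntegral_iff_ofReal hnn]
      exact hfin.lt_top
    · rw [integral_eq_lintegral_of_nonneg_ae hnn hmeas, hlint]
  obtain ⟨i1, e1⟩ := key (fun x z => f (x + z) + f (x - z))
    (fun x z => ENNReal.ofReal (f (x + z)) + ENNReal.ofReal (f (x - z))) (by fun_prop)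
    (fun x z => add_nonneg (hf0 _) (hf0 _)) (fun x z => by linarith [hfB (x + z), hfB (x - z)])
    (fun x z => (ENNReal.ofReal_add (hf0 _) (hf0 _)).symm)
  obtain ⟨i2, e2⟩ := key (fun x _ => 2 * f x) (fun x _ => 2 * ENNReal.ofReal (f x)) (by fun_prop)
    (fun x z => by linarith [hf0 x]) (fun x z => by linarith [hfB x])
    (fun x z => by rw [ENNReal.ofReal_mul zero_le_two, ENNReal.ofReal_ofNat])
  rw [← e1, ← e2, ← integral_sub i1 i2, weakForm]
  congr 1
  funext p
  simp only [discreteLaplacian]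
  ring

end WeakForm

/-! ### Densities of weighted measures -/

/-- Finite measures on the half-line are of the form `(1 + x²) c(x) dx`. -/
lemma exists_density (μ : Measure ℝ) [IsFiniteMeasure μ] (hμ : μ ≪ halfLine) :
    ∃ c : ℝ → ℝ, Measurable c ∧ (∀ x, 0 ≤ c x) ∧ (∀ x < 0, c x = 0) ∧
      (densityMeasure c).withDensity wt = μ := by
  have : SigmaFinite halfLine := by unfold halfLine; infer_instance
  set r := μ.rnDeriv halfLine
  have hr : Measurable r := Measure.measurable_rnDeriv _ _
  set c : ℝ → ℝ := (Ici 0).indicator fun x => (r x).toReal / (1 + x ^ 2) with hc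
  have hcm : Measurable c := Measurable.indicator (by fun_prop) measurableSet_Ici
  refine ⟨c, hcm, fun x => indicator_nonneg (fun x _ => by positivity) x,
    fun x hx => indicator_of_notMem (by simpa using hx) _, ?_⟩
  have hprod : (fun x => ENNReal.ofReal (c x)) * wt =
      (Ici (0 : ℝ)).indicator fun x => ENNReal.ofReal (r x).toReal := by
    funext x
    rw [Pi.mul_apply]
    by_cases hx : x ∈ Ici (0 : ℝ)
    · rw [hc, indicator_of_mem hx, indicator_of_mem hx, wt, ← ENNReal.ofReal_mul (by positivity),
        div_mul_cancel₀ _ (by positivity)]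
    · rw [hc, indicator_of_notMem hx, indicator_of_notMem hx, ENNReal.ofReal_zero, zero_mul]
  rw [densityMeasure, ← withDensity_mul _ hcm.ennreal_ofReal measurable_wt, hprod,
    withDensity_indicator measurableSet_Ici, ← halfLine]
  refine Eq.trans (withDensity_congr_ae ?_) (Measure.withDensity_rnDeriv_eq μ halfLine hμ)
  exact (Measure.rnDeriv_lt_top _ _).mono fun x hx => ENNReal.ofReal_toReal hx.ne

section Density

variable {c : ℝ → ℝ}

lemma lintegral_density (hc : Measurable c) (hneg : ∀ x < 0, c x = 0) {G : ℝ → ℝ≥0∞}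
    (hG : Measurable G) : ∫⁻ x, ENNReal.ofReal (c x) * G x ∂halfLine =
      ∫⁻ x, (wt x)⁻¹ * G x ∂(densityMeasure c).withDensity wt := by
  rw [lintegral_halfLine fun x hx => by rw [hneg x hx, ENNReal.ofReal_zero, zero_mul],
    lintegral_withDensity_eq_lintegral_mul _ measurable_wt (by fun_prop), densityMeasure,
    lintegral_withDensity_eq_lintegral_mul _ hc.ennreal_ofReal (by fun_prop)]
  refine lintegral_congr fun x => ?_
  simp only [Pi.mul_apply]
  rw [← mul_assoc (wt x), ENNReal.mul_inv_cancel (wt_ne_zero x) (wt_ne_top x), one_mul]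

lemma integral_density (hc : Measurable c) (hc0 : ∀ x, 0 ≤ c x) (hneg : ∀ x < 0, c x = 0)
    {g : ℝ → ℝ} (hg : Measurable g) (hg0 : ∀ x, 0 ≤ x → 0 ≤ g x) :
    ∫ x, g x * c x ∂halfLine =
      (∫⁻ x, (wt x)⁻¹ * ENNReal.ofReal (g x) ∂(densityMeasure c).withDensity wt).toReal := by
  rw [← lintegral_density hc hneg hg.ennreal_ofReal, integral_eq_lintegral_of_nonneg_ae]
  · congr 1
    refine lintegral_congr fun x => ?_
    rw [mul_comm, ENNReal.ofReal_mul (hc0 x)]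
  · filter_upwards [ae_restrict_mem measurableSet_Ici] with x hx
    exact mul_nonneg (hg0 x hx) (hc0 x)
  · exact (hg.mul hc).aestronglyMeasurable

lemma integrable_weight_density (hc : Measurable c) (hc0 : ∀ x, 0 ≤ c x) (hneg : ∀ x < 0, c x = 0)
    (hfin : (densityMeasure c).withDensity wt univ ≠ ∞) :
    Integrable (fun x => (1 + x ^ 2) * c x) halfLine := by
  refine ⟨(Measurable.mul (by fun_prop) hc).aestronglyMeasurable, ?_⟩
  rw [hasFiniteIntegral_iff_ofReal (ae_of_all _ fun x => mul_nonneg (by positivity) (hc0 x))]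
  have : ∀ x, ENNReal.ofReal ((1 + x ^ 2) * c x) = ENNReal.ofReal (c x) * wt x := fun x => by
    rw [mul_comm, ENNReal.ofReal_mul (hc0 x), wt]
  simp_rw [this]
  rw [lintegral_density hc hneg measurable_wt]
  simp_rw [ENNReal.inv_mul_cancel (wt_ne_zero _) (wt_ne_top _)]
  simpa using hfin.lt_top

lemma integrable_density (hc : Measurable c) (hc0 : ∀ x, 0 ≤ c x) (hneg : ∀ x < 0, c x = 0)
    (hfin : (densityMeasure c).withDensity wt univ ≠ ∞) : Integrable c halfLine := by
  refine (integrable_weight_density hc hc0 hneg hfin).mono hc.aestronglyMeasurable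
    (ae_of_all _ fun x => ?_)
  rw [Real.norm_of_nonneg (hc0 x), Real.norm_of_nonneg (mul_nonneg (by positivity) (hc0 x))]
  nlinarith [mul_nonneg (sq_nonneg x) (hc0 x)]

lemma integrable_mul_density (hc : Measurable c) (hc0 : ∀ x, 0 ≤ c x) (hneg : ∀ x < 0, c x = 0)
    (hfin : (densityMeasure c).withDensity wt univ ≠ ∞) {g : ℝ → ℝ} (hg : Measurable g) {B : ℝ}
    (hgB : ∀ x, |g x| ≤ B) : Integrable (fun x => g x * c x) halfLine :=
  (integrable_density hc hc0 hneg hfin).bdd_mul hg.aestronglyMeasurable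
    (ae_of_all _ fun x => by simpa using hgB x)

lemma memYPos_density (hc : Measurable c) (hc0 : ∀ x, 0 ≤ c x) (hneg : ∀ x < 0, c x = 0)
    (hfin : (densityMeasure c).withDensity wt univ ≠ ∞) : MemYPos 0 2 c := by
  refine ⟨⟨integrable_density hc hc0 hneg hfin, ?_⟩, ae_of_all _ hc0⟩
  simpa only [weight_zero_two, abs_of_nonneg (hc0 _)] using
    integrable_weight_density hc hc0 hneg hfin

lemma normY_density (hc : Measurable c) (hc0 : ∀ x, 0 ≤ c x) (hneg : ∀ x < 0, c x = 0) :
    normY 0 2 c = ((densityMeasure c).withDensity wt univ).toReal := by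
  have h := integral_density hc hc0 hneg (g := fun x => 1 + x ^ 2) (by fun_prop)
    fun x _ => by positivity
  have e : ∀ x, (wt x)⁻¹ * ENNReal.ofReal (1 + x ^ 2) = 1 := fun x =>
    ENNReal.inv_mul_cancel (wt_ne_zero x) (wt_ne_top x)
  simp_rw [e] at h
  simp only [normY, weight_zero_two, abs_of_nonneg (hc0 _), h]
  simp

lemma moment_zero_density (hc : Measurable c) (hc0 : ∀ x, 0 ≤ c x) (hneg : ∀ x < 0, c x = 0) :
    moment 0 c = (∫⁻ x, (wt x)⁻¹ ∂(densityMeasure c).withDensity wt).toReal := by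
  have h := integral_density hc hc0 hneg (g := fun _ => 1) (by fun_prop) fun x _ => zero_le_one
  simpa [moment] using h

lemma moment_one_density (hc : Measurable c) (hc0 : ∀ x, 0 ≤ c x) (hneg : ∀ x < 0, c x = 0) :
    moment 1 c =
      (∫⁻ x, (wt x)⁻¹ * ENNReal.ofReal x ∂(densityMeasure c).withDensity wt).toReal := by
  have h := integral_density hc hc0 hneg (g := fun x => x) (by fun_prop) fun x hx => hx
  simpa [moment] using h

lemma lintegral_rate_le {K : ℝ → ℝ → ℝ → ℝ} {k : ℝ → ℝ → ℝ → ℝ≥0∞} {φ' : ℝ → ℝ≥0∞}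
    (hk : IsRegularKernel k φ')
    (hkK : ∀ᵐ z ∂halfLine, ∀ x y, 0 ≤ x → 0 ≤ y → k x y z = ENNReal.ofReal (K x y z))
    (hK : IsKernel K) (hc : Measurable c) (hc0 : ∀ x, 0 ≤ c x) :
    ∫⁻ z in Ici (0 : ℝ), ∫⁻ x in Ici z, ∫⁻ y in Ici (0 : ℝ), ENNReal.ofReal (rate K c x y z) ≤
      (∫⁻ z, wt z * φ' z) * (densityMeasure c).withDensity wt univ ^ 2 := by
  set m := (densityMeasure c).withDensity wt univ with hm
  have hD := hc.ennreal_ofReal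
  have hmE : ∫⁻ x, ENNReal.ofReal (c x) * wt x = m := by
    rw [hm, withDensity_apply _ MeasurableSet.univ, setLIntegral_univ, densityMeasure,
      lintegral_withDensity_eq_lintegral_mul _ hD measurable_wt]
    rfl
  have hDw : Measurable fun x => ENNReal.ofReal (c x) * wt x := hD.mul measurable_wt
  have hφ := hk.measurable_majorant
  calc _ ≤ ∫⁻ z in Ici (0 : ℝ), wt z * φ' z * m ^ 2 := by
        refine lintegral_mono_ae ?_
        filter_upwards [hkK, ae_restrict_mem measurableSet_Ici] with z hz hz0
        calc ∫⁻ x in Ici z, ∫⁻ y in Ici (0 : ℝ), ENNReal.ofReal (rate K c x y z)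
            ≤ ∫⁻ x in Ici z, ∫⁻ y in Ici (0 : ℝ), wt z * φ' z * (ENNReal.ofReal (c x) * wt x) *
                (ENNReal.ofReal (c y) * wt y) := by
              refine setLIntegral_mono' measurableSet_Ici fun x hx => ?_
              refine setLIntegral_mono' measurableSet_Ici fun y hy => ?_
              have hx0 : 0 ≤ x := le_trans hz0 hx
              have hKnn := hK.nonneg x y z hx0 hy hz0
              rw [rate, ENNReal.ofReal_mul (mul_nonneg hKnn (hc0 x)), ENNReal.ofReal_mul hKnn,
                ← hz x y hx0 hy]
              calc k x y z * ENNReal.ofReal (c x) * ENNReal.ofReal (c y)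
                  ≤ wt x * wt y * (1 * φ' z) * ENNReal.ofReal (c x) * ENNReal.ofReal (c y) := by
                    rw [one_mul]
                    gcongr
                    exact hk.le x y z
                _ ≤ wt x * wt y * (wt z * φ' z) * ENNReal.ofReal (c x) * ENNReal.ofReal (c y) := by
                    gcongr
                    exact one_le_wt z
                _ = _ := by ring
          _ ≤ ∫⁻ x, (∫⁻ y, wt z * φ' z * (ENNReal.ofReal (c x) * wt x) *
                (ENNReal.ofReal (c y) * wt y)) :=
              (setLIntegral_le_lintegral _ _).trans
                (lintegral_mono fun x => setLIntegral_le_lintegral _ _)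
          _ = wt z * φ' z * m ^ 2 := by
              simp_rw [lintegral_const_mul _ hDw, hmE]
              rw [lintegral_mul_const _ (hDw.const_mul _), lintegral_const_mul _ hDw, hmE]
              ring
    _ ≤ ∫⁻ z, wt z * φ' z * m ^ 2 := setLIntegral_le_lintegral _ _
    _ = _ := lintegral_mul_const _ (by fun_prop)

end Density

lemma exists_bounded_version {f : ℝ → ℝ} (hf : MemLp f ∞ halfLine) :
    ∃ (g : ℝ → ℝ) (B : ℝ), Measurable g ∧ (∀ x, |g x| ≤ B) ∧ f =ᵐ[halfLine] g := by
  set B := (eLpNormEssSup f halfLine).toReal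
  have hB : 0 ≤ B := ENNReal.toReal_nonneg
  have htop : eLpNormEssSup f halfLine ≠ ∞ := by simpa using hf.2.ne
  have hm := hf.1.stronglyMeasurable_mk.measurable
  refine ⟨fun x => max (-B) (min B (hf.1.mk f x)), B, by fun_prop, fun x => ?_, ?_⟩
  · exact abs_le.2 ⟨le_max_left _ _, max_le (by linarith) (min_le_left _ _)⟩
  · filter_upwards [hf.1.ae_eq_mk, ae_le_eLpNormEssSup (f := f) (μ := halfLine)] with x hx hxB
    have h1 : |f x| ≤ B := by
      have := ENNReal.toReal_mono htop hxB
      simpa using this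
    rw [← hx, min_eq_right (abs_le.1 h1).2, max_eq_right (abs_le.1 h1).1]

lemma timeInterval_ofReal (T : ℝ) : timeInterval (ENNReal.ofReal T) = Ico 0 T := by
  ext t
  simp only [timeInterval, mem_ofPred_eq, mem_Ico]
  refine and_congr_right fun ht => ?_
  exact ENNReal.ofReal_lt_ofReal_iff_of_nonneg ht

/-! ### Existence -/

/-- The densities of the limits of the Euler schemes form a weak solution. -/
theorem EulerProblem.exists_isWeakSolution (P : EulerProblem) {K : ℝ → ℝ → ℝ → ℝ} {c₀ : ℝ → ℝ}
    (hK : IsKernel K) (hdom : ∀ x y z, (x, y, z) ∉ domain → P.k x y z = 0)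
    (hkK : ∀ᵐ z ∂halfLine, ∀ x y, 0 ≤ x → 0 ≤ y → P.k x y z = ENNReal.ofReal (K x y z))
    (hc₀ : ∀ᵐ x ∂halfLine, P.c x = ENNReal.ofReal (c₀ x)) (hc₀0 : ∀ᵐ x ∂halfLine, 0 ≤ c₀ x) :
    ∃ c : ℝ → ℝ → ℝ, IsWeakSolution K 0 2 (ENNReal.ofReal P.T) c₀ c ∧
      ∀ t, moment 0 (c t) = moment 0 c₀ ∧ moment 1 (c t) = moment 1 c₀ := by
  choose c hc hc0 hneg hlim using fun t =>
    exists_density (P.limit t) (P.limit_absolutelyContinuous t)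
  have hfin : ∀ t, (densityMeasure (c t)).withDensity wt univ ≠ ∞ := fun t => by
    rw [hlim]; exact measure_ne_top _ _
  have hinit : c 0 =ᵐ[halfLine] c₀ := by
    have h1 := (hlim 0).trans P.limit_zero
    rw [densityMeasure, ← withDensity_mul _ (hc 0).ennreal_ofReal measurable_wt,
      ← withDensity_mul _ P.measurable_datum measurable_wt,
      withDensity_eq_iff_of_sigmaFinite
        ((hc 0).ennreal_ofReal.mul measurable_wt).aemeasurable
        (P.measurable_datum.mul measurable_wt).aemeasurable] at h1
    filter_upwards [ae_restrict_of_ae h1, hc₀, hc₀0] with x hx1 hx2 hx3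
    simp only [Pi.mul_apply] at hx1
    rw [ENNReal.mul_left_inj (wt_ne_zero x) (wt_ne_top x), hx2,
      ENNReal.ofReal_eq_ofReal_iff (hc0 0 x) hx3] at hx1
    exact hx1
  have hmom0 : ∀ t, moment 0 (c t) = (volume.withDensity P.c univ).toReal := fun t => by
    rw [moment_zero_density (hc t) (hc0 t) (hneg t), hlim, P.lintegral_limit_one]
  have hmom1 : ∀ t, moment 1 (c t) =
      (∫⁻ x, ENNReal.ofReal x ∂volume.withDensity P.c).toReal := fun t => by
    rw [moment_one_density (hc t) (hc0 t) (hneg t), hlim, P.lintegral_limit_id]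
  have hcongr : ∀ p, moment p (c 0) = moment p c₀ := fun p =>
    integral_congr_ae (hinit.mono fun x hx => by simp only [hx])
  have hmass : ∀ t, ∫ x, c t x ∂halfLine = ∫ x, c 0 x ∂halfLine := fun t => by
    simpa [moment] using (hmom0 t).trans (hmom0 0).symm
  -- The weak equation for `g + B ≥ 0`; constants drop out of second differences.
  have hweak : ∀ (g : ℝ → ℝ) (B : ℝ), Measurable g → (∀ x, |g x| ≤ B) →
      ContinuousOn (fun t => ∫ x, g x * c t x ∂halfLine) (Icc 0 P.T) ∧
      ContinuousOn (fun t => weakForm K g (c t)) (Icc 0 P.T) ∧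
      ∀ t ∈ Icc 0 P.T, ∫ x, g x * c t x ∂halfLine - ∫ x, g x * c 0 x ∂halfLine =
        ∫ s in (0 : ℝ)..t, weakForm K g (c s) := by
    intro g B hg hgB
    have hB : 0 ≤ B := (abs_nonneg _).trans (hgB 0)
    set f : ℝ → ℝ := fun x => g x + B with hf_def
    have hf : Measurable f := by fun_prop
    have hf0 : ∀ x, 0 ≤ f x := fun x => by
      simp only [hf_def]; linarith [neg_le_of_abs_le (hgB x)]
    have hfB : ∀ x, f x ≤ 2 * B := fun x => by
      simp only [hf_def]; linarith [le_of_abs_le (hgB x)]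
    have e1 : ∀ t, ∫ x, f x * c t x ∂halfLine =
        ∫ x, g x * c t x ∂halfLine + B * ∫ x, c 0 x ∂halfLine := by
      intro t
      have hi := integrable_mul_density (hc t) (hc0 t) (hneg t) (hfin t) hg hgB
      have hi' := (integrable_density (hc t) (hc0 t) (hneg t) (hfin t)).const_mul B
      rw [← hmass t, ← integral_const_mul, ← integral_add hi hi']
      refine integral_congr_ae (ae_of_all _ fun x => ?_)
      simp only [hf_def]
      ring
    have e2 : ∀ t, weakForm K g (c t) = weakForm K f (c t) := by
      intro t
      simp only [weakForm]
      congr 1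
      funext p
      simp only [discreteLaplacian, hf_def]
      ring
    obtain ⟨h1, h2, h3⟩ := P.weak_equation_limit (f := fun x => ENNReal.ofReal (f x))
      hf.ennreal_ofReal (b := ENNReal.ofReal (2 * B)) ENNReal.ofReal_ne_top
      (fun x => ENNReal.ofReal_le_ofReal (hfB x))
      (F := fun t => ∫ x, f x * c t x ∂halfLine) (G := fun t => weakForm K g (c t))
      (fun t => by
        rw [integral_density (hc t) (hc0 t) (hneg t) hf fun x _ => hf0 x, hlim])
      (fun t => by
        rw [e2, weakForm_eq_flux P.regular hdom hkK hK P.majorant_ne_top (hc t) (hc0 t) (hfin t)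
          hf hf0 hfB, hlim])
    simp only [e1] at h1 h3
    refine ⟨?_, h2, fun t ht => ?_⟩
    · exact (h1.sub (continuousOn_const (c := B * ∫ x, c 0 x ∂halfLine))).congr
        fun t _ => (add_sub_cancel_right _ _).symm
    · rw [← h3 t ht]
      ring
  refine ⟨c, ⟨?_, hinit, ?_, ?_, ?_, ?_⟩, fun t => ⟨?_, ?_⟩⟩
  · exact fun t _ => memYPos_density (hc t) (hc0 t) (hneg t) (hfin t)
  · intro f hf
    obtain ⟨g, B, hg, hgB, hfg⟩ := exists_bounded_version hf
    rw [timeInterval_ofReal]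
    have h := ((hweak g B hg hgB).1.mono Ico_subset_Icc_self).const_mul 2
    refine h.congr fun t _ => ?_
    simp only
    rw [← integral_const_mul]
    refine integral_congr_ae (hfg.mono fun x hx => ?_)
    simp only [weight, hx, neg_zero, Real.rpow_zero]
    ring
  · refine ⟨P.bound.toReal, fun t _ => ?_⟩
    rw [normY_density (hc t) (hc0 t) (hneg t), hlim]
    exact ENNReal.toReal_mono P.bound_ne_top (P.limit_univ_le t)
  · intro t _
    calc _ ≤ ∫⁻ s in Icc 0 t, P.normφ * P.bound ^ 2 := by
          refine lintegral_mono fun s => ?_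
          refine (lintegral_rate_le P.regular hkK hK (hc s) (hc0 s)).trans ?_
          rw [hlim]
          exact mul_le_mul_right (pow_le_pow_left' (P.limit_univ_le s) 2) _
      _ < ∞ := by
          rw [setLIntegral_const]
          exact ENNReal.mul_lt_top (ENNReal.mul_lt_top P.majorant_ne_top.lt_top
            (ENNReal.pow_lt_top P.bound_ne_top.lt_top)) measure_Icc_lt_top
  · intro t ht f hf
    rw [timeInterval_ofReal] at ht
    obtain ⟨g, B, hg, hgB, hfg⟩ := exists_bounded_version hf
    obtain ⟨-, h2, h3⟩ := hweak g B hg hgB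
    have htT : t ∈ Icc 0 P.T := Ico_subset_Icc_self ht
    simp_rw [weakForm_congr_ae K _ hfg]
    refine ⟨(h2.mono ?_).intervalIntegrable, ?_⟩
    · rw [uIcc_of_le ht.1]
      exact Icc_subset_Icc_right ht.2.le
    · rw [← h3 t htT, ← integral_sub
        (integrable_mul_density (hc t) (hc0 t) (hneg t) (hfin t) hg hgB)
        (integrable_mul_density (hc 0) (hc0 0) (hneg 0) (hfin 0) hg hgB)]
      refine integral_congr_ae ?_
      filter_upwards [hfg, hinit] with x hx1 hx2
      rw [hx1, hx2]
      ring
  · rw [← hcongr 0, hmom0, hmom0]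
  · rw [← hcongr 1, hmom1, hmom1]

/-- If no mass is exchanged, the initial datum is a stationary solution. -/
lemma isWeakSolution_const {K : ℝ → ℝ → ℝ → ℝ} {c₀ : ℝ → ℝ} (hc₀ : MemYPos 0 2 c₀)
    (hK0 : ∀ᵐ z ∂halfLine, ∀ x y, 0 ≤ x → 0 ≤ y → K x y z = 0) (T : ℝ≥0∞) :
    IsWeakSolution K 0 2 T c₀ fun _ => c₀ := by
  have hweak : ∀ f, weakForm K f c₀ = 0 := by
    intro f
    refine integral_eq_zero_of_ae ?_
    filter_upwards [ae_domain_of_ae_halfLine hK0 quasiMeasurePreserving_mass fun p hp => hp.1,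
      ae_restrict_mem measurableSet_domain] with p hp hpd
    simp [rate, hp _ _ (hpd.1.trans hpd.2.1) (hpd.1.trans hpd.2.2)]
  have hrate : ∫⁻ z in Ici (0 : ℝ), ∫⁻ x in Ici z, ∫⁻ y in Ici (0 : ℝ),
      ENNReal.ofReal (rate K c₀ x y z) = 0 := by
    rw [← lintegral_zero (μ := volume.restrict (Ici (0 : ℝ)))]
    refine lintegral_congr_ae ?_
    filter_upwards [hK0, ae_restrict_mem measurableSet_Ici] with z hz hz0
    refine (setLIntegral_congr_fun measurableSet_Ici (g := fun _ => 0) fun x hx => ?_).trans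
      (by simp)
    refine (setLIntegral_congr_fun measurableSet_Ici (g := fun _ => 0) fun y hy => ?_).trans
      (by simp)
    simp [rate, hz x y (le_trans hz0 hx) hy]
  exact
    { mem := fun _ _ => hc₀
      initial := Filter.EventuallyEq.rfl
      continuous := fun f _ => continuousOn_const
      bounded := ⟨normY 0 2 c₀, fun _ _ => le_rfl⟩
      finite_rate := fun t _ => by simp [hrate]
      weak_eq := fun t _ f _ => by simp [hweak] }

lemma normY_eq_moments {g : ℝ → ℝ} (hg : MemYPos 0 2 g) :
    moment 0 g + moment 2 g = normY 0 2 g := by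
  have h1 : Integrable (fun x => (1 + x ^ 2) * g x) halfLine := by
    refine hg.1.2.congr (hg.2.mono fun x hx => ?_)
    simp only [weight_zero_two, abs_of_nonneg hx]
  have h2 : Integrable (fun x => x ^ 2 * g x) halfLine :=
    (h1.sub hg.1.1).congr (ae_of_all _ fun x => by simp only [Pi.sub_apply]; ring)
  have e : normY 0 2 g = ∫ x, (g x + x ^ 2 * g x) ∂halfLine := by
    refine integral_congr_ae (hg.2.mono fun x hx => ?_)
    simp only [weight_zero_two, abs_of_nonneg hx]
    ring
  rw [e, integral_add hg.1.1 h2]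
  simp [moment]

lemma normY_nonneg (g : ℝ → ℝ) : 0 ≤ normY 0 2 g := by
  refine integral_nonneg fun x => ?_
  change 0 ≤ weight 0 2 x * |g x|
  rw [weight_zero_two]
  positivity

lemma ae_eq_zero_of_normY_eq_zero {g : ℝ → ℝ} (hg : MemY 0 2 g) (h : normY 0 2 g = 0) :
    g =ᵐ[halfLine] 0 := by
  rw [normY, integral_eq_zero_iff_of_nonneg (fun x => ?_) hg.2] at h
  · refine h.mono fun x hx => ?_
    simp only [weight_zero_two, Pi.zero_apply, mul_eq_zero, abs_eq_zero] at hx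
    exact hx.resolve_left (by positivity)
  · change 0 ≤ weight 0 2 x * |g x|
    rw [weight_zero_two]
    positivity

end CGEDG

end

theorem theorem3 (K : ℝ → ℝ → ℝ → ℝ) (φ c₀ : ℝ → ℝ)
    (hK : CGEDG.IsKernel K)
    (hgrowth : CGEDG.QuadraticGrowth K φ)
    (hderiv : CGEDG.SecondDerivBound K φ)
    (hφ : CGEDG.MemYPos 0 2 φ)
    (hc₀ : CGEDG.MemYPos 0 2 c₀)
    (hc₀_ne : ¬ c₀ =ᵐ[CGEDG.halfLine] 0) :
    ∃ c : ℝ → ℝ → ℝ,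
      CGEDG.IsWeakSolution K 0 2 (CGEDG.existenceTime φ c₀) c₀ c ∧
      ∀ t ∈ CGEDG.timeInterval (CGEDG.existenceTime φ c₀),
        CGEDG.moment 0 (c t) = CGEDG.moment 0 c₀ ∧
        CGEDG.moment 1 (c t) = CGEDG.moment 1 c₀ := by
  open CGEDG in
  rcases (normY_nonneg φ).eq_or_lt' with hΦ | hΦ
  · have hφ0 := ae_eq_zero_of_normY_eq_zero hφ.1 hΦ
    refine ⟨fun _ => c₀, isWeakSolution_const hc₀ ?_ _, fun _ _ => ⟨rfl, rfl⟩⟩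
    filter_upwards [hφ0, ae_restrict_mem measurableSet_Ici] with z hz hz0 x y hx hy
    refine le_antisymm ?_ (hK.nonneg x y z hx hy hz0)
    simpa [hz] using hgrowth x y z hx hy hz0
  have hu : 0 < normY 0 2 c₀ := (normY_nonneg c₀).lt_of_ne' fun h =>
    hc₀_ne (ae_eq_zero_of_normY_eq_zero hc₀.1 h)
  have hpos : 0 < 2 * normY 0 2 φ * normY 0 2 c₀ := by positivity
  obtain ⟨φ', hφ'm, hφ'neg, hφ'⟩ := exists_measurable_version hφ.1.1.1
  obtain ⟨c', hc'm, hc'neg, hc'⟩ := exists_measurable_version hc₀.1.1.1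
  obtain ⟨k, hk, hdom, hkK⟩ := exists_regular_kernel hK hgrowth hderiv hφ'm hφ'
  have hΦint := lintegral_wt_version hφ hφ'neg hφ'
  have huint := lintegral_wt_version hc₀ hc'neg hc'
  -- The second moment of `φ` is strictly smaller than its norm, so the bound on the second moment
  -- of the solution does not blow up at the existence time.
  have hlt : (∫⁻ z, ENNReal.ofReal (z ^ 2) * φ' z).toReal < normY 0 2 φ := by
    have hsplit : ∫⁻ z, wt z * φ' z = (∫⁻ z, φ' z) + ∫⁻ z, ENNReal.ofReal (z ^ 2) * φ' z := by
      rw [← lintegral_add_left hφ'm]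
      refine lintegral_congr fun z => ?_
      rw [wt, ENNReal.ofReal_add zero_le_one (sq_nonneg z), ENNReal.ofReal_one, add_mul, one_mul]
    have hne : ∫⁻ z, φ' z ≠ 0 := by
      intro h0
      have hae := (lintegral_eq_zero_iff hφ'm).1 h0
      have : ∫⁻ z, wt z * φ' z = 0 := by
        rw [lintegral_eq_zero_iff (by fun_prop)]
        exact hae.mono fun z hz => by simp [hz]
      rw [hΦint, ENNReal.ofReal_eq_zero] at this
      linarith
    rw [hΦint] at hsplit
    have htop : (∫⁻ z, φ' z) + ∫⁻ z, ENNReal.ofReal (z ^ 2) * φ' z ≠ ∞ := by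
      rw [← hsplit]; exact ENNReal.ofReal_ne_top
    obtain ⟨t1, t2⟩ := ENNReal.add_ne_top.1 htop
    have h := congrArg ENNReal.toReal hsplit
    rw [ENNReal.toReal_ofReal hΦ.le, ENNReal.toReal_add t1 t2] at h
    linarith [ENNReal.toReal_pos hne t1]
  let P : EulerProblem :=
    { k := k
      φ := φ'
      c := c'
      T := (2 * normY 0 2 φ * normY 0 2 c₀)⁻¹
      regular := hk
      majorant_ne_top := by rw [hΦint]; exact ENNReal.ofReal_ne_top
      measurable_datum := hc'm
      datum_ne_top := by rw [huint]; exact ENNReal.ofReal_ne_top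
      datum_neg := hc'neg
      T_pos := by positivity
      lt_one := by
        rw [huint, ENNReal.toReal_ofReal hu.le, ← div_eq_mul_inv, div_lt_one hpos]
        gcongr }
  have hT : existenceTime φ c₀ = ENNReal.ofReal P.T := by
    rw [existenceTime, normY_eq_moments hc₀, ← ENNReal.ofReal_inv_of_pos hpos]
  obtain ⟨c, hc, hmom⟩ := P.exists_isWeakSolution hK hdom hkK hc' hc₀.2
  exact ⟨c, hT ▸ hc, fun t _ => hmom t⟩
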